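/- Fix a bounded security lattice $(\mathcal L,\sqsubseteq,\bot,\top)$, a set of base types $\mathsf b$, and a (possibly empty) set of constants, each of a given base type. Write $\mathsf{bool}=\mathsf{unit}+\mathsf{unit}$. Both calculi below are higher-order and call-by-value; heaps are finite maps from locations to closed terms; evaluation counts steps; substitutions are closed. **CG (coarse-grained).** Types: $\tau::=\mathsf b\mid\mathsf{unit}\mid\tau\to\tau\mid\tau\times\tau\mid\tau+\tau\mid\mathsf{ref}\,\ell\,\tau\mid\mathsf{Labeled}\,\ell\,\tau\mid\mathbb C\,\ell_1\,\ell_2\,\tau$, where $\mathbb C\,\ell_1\,\ell_2\,\tau$ is the type of suspended stateful computations with pc-label $\ell_1$ and taint label $\ell_2$. Besides simply typed $\lambda$-calculus the rules for $\Gamma\vdash e:\tau$ are: $\mathsf{Lb}(e):\mathsf{Labeled}\,\ell\,\tau$ if $e:\tau$; $\mathsf{unlabel}(e):\mathbb C\,\top\,\ell\,\tau$ if $e:\mathsf{Labeled}\,\ell\,\tau$; $\mathsf{toLabeled}(e):\mathbb C\,\ell_1\,\bot\,(\mathsf{Labeled}\,\ell_2\,\tau)$ if $e:\mathbb C\,\ell_1\,\ell_2\,\tau$;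 $\mathsf{ret}(e):\mathbb C\,\top\,\bot\,\tau$ if $e:\tau$; $\mathsf{bind}(e_1,x.e_2):\mathbb C\,\ell\,\ell_4\,\tau'$ if $e_1:\mathbb C\,\ell_1\,\ell_2\,\tau$, $x:\tau\vdash e_2:\mathbb C\,\ell_3\,\ell_4\,\tau'$, $\ell\sqsubseteq\ell_1$, $\ell\sqsubseteq\ell_3$, $\ell_2\sqsubseteq\ell_3$, $\ell_2\sqsubseteq\ell_4$; $\mathsf{new}\,e:\mathbb C\,\ell\,\bot\,(\mathsf{ref}\,\ell\,\tau)$ if $e:\mathsf{Labeled}\,\ell\,\tau$; $!e:\mathbb C\,\top\,\bot\,(\mathsf{Labeled}\,\ell\,\tau)$ if $e:\mathsf{ref}\,\ell\,\tau$; $e_1:=e_2:\mathbb C\,\ell\,\bot\,\mathsf{unit}$ if $e_1:\mathsf{ref}\,\ell\,\tau$ and $e_2:\mathsf{Labeled}\,\ell\,\tau$; and subsumption for structural subtyping, covariant in the label of $\mathsf{Labeled}$ and in the taint label, contravariant in the pc-label, invariant at $\mathsf{ref}$. Pure evaluation $e\Downarrow_i v$ does not touch the heap and treats all monadic terms as values;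 forcing $(H,v)\Downarrow^f_i(H',v')$ runs such a value. **FG (fine-grained).** Types: $\tau::=A^\ell$, $A::=\mathsf b\mid\mathsf{unit}\mid\tau\xrightarrow{\ell_e}\tau\mid\tau\times\tau\mid\tau+\tau\mid\mathsf{ref}\,\tau$; an unlabeled $\mathsf{unit}$ stands for $\mathsf{unit}^\bot$, and $A^{\ell'}\searrow\ell$ means $\ell\sqsubseteq\ell'$. Rules for $\Gamma\vdash_{pc}e:\tau$: introduction forms get outer label $\bot$ (the body of a $\lambda$ is typed at $\ell_e$); eliminating something labeled $\ell$ into type $\tau$ requires $\tau\searrow\ell$; application requires $\ell\sqcup pc\sqsubseteq\ell_e$; the branches of a case are typed at $pc\sqcup\ell$; $\mathsf{new}\,e$ with $e:\tau$ requires $\tau\searrow pc$; $e_1:=e_2$ with $e_1:(\mathsf{ref}\,\tau)^\ell$ requires $\tau\searrow pc\sqcup\ell$; and subsumption holds in $\tau$ (labels covariant, $\ell_e$ contravariant, references invariant) and $pc$ (which may be lowered). Evaluation is $(H,e)\Downarrow_i(H',v)$. **Translation.** $[\![\mathsf b]\!]=\mathsf b^\bot$, $[\![\mathsf{unit}]\!]=\mathsf{unit}^\bot$,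 $[\![\tau_1\to\tau_2]\!]=([\![\tau_1]\!]\xrightarrow{\top}[\![\tau_2]\!])^\bot$, $\times$ and $+$ componentwise with label $\bot$, $[\![\mathsf{Labeled}\,\ell\,\tau]\!]=([\![\tau]\!]+\mathsf{unit})^\ell$, $[\![\mathsf{ref}\,\ell\,\tau]\!]=(\mathsf{ref}\,([\![\tau]\!]+\mathsf{unit})^\ell)^\bot$, $[\![\mathbb C\,\ell_1\,\ell_2\,\tau]\!]=(\mathsf{unit}\xrightarrow{\ell_1}([\![\tau]\!]+\mathsf{unit})^{\ell_2})^\bot$. The judgment $\Gamma\vdash e:\tau\leadsto e_F$ follows CG typing; it is homomorphic on $\lambda$-terms and maps $\mathsf{Lb}(e)\leadsto\mathsf{inl}(e_F)$, $\mathsf{unlabel}(e)\leadsto\lambda\_.e_F$, $\mathsf{toLabeled}(e)\leadsto\lambda\_.\mathsf{inl}(e_F())$, $\mathsf{ret}(e)\leadsto\lambda\_.\mathsf{inl}(e_F)$, $\mathsf{bind}(e_1,x.e_2)\leadsto\lambda\_.\mathsf{case}(e_{F1}(),x.e_{F2}(),y.\mathsf{inr}())$, $\mathsf{new}\,e\leadsto\lambda\_.\mathsf{inl}(\mathsf{new}\,e_F)$,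 $!e\leadsto\lambda\_.\mathsf{inl}(!e_F)$, $e_1:=e_2\leadsto\lambda\_.\mathsf{inl}(e_{F1}:=e_{F2})$. **Cross-language relation.** For a CG store typing $\theta$ (partial map from locations to CG types), a partial bijection $\beta$ of CG to FG locations and $m\in\mathbb N$, define $\lfloor\tau\rfloor_V^\beta\ni(\theta,m,v_s,v_t)$ by: equal constants of type $\mathsf b$ at $\mathsf b$, $()$ and $()$ at $\mathsf{unit}$; componentwise at $\times,+$; at $\tau_1\to\tau_2$, $\lambda$-abstractions that for all $\theta'\sqsupseteq\theta$, $\beta'\supseteq\beta$, $j<m$ send arguments in $\lfloor\tau_1\rfloor_V^{\beta'}$ to bodies in $\lfloor\tau_2\rfloor_E^{\beta'}$ at $(\theta',j)$; at $\mathsf{ref}\,\ell\,\tau$, locations $(a,b)\in\beta$ with $\theta(a)=\mathsf{Labeled}\,\ell\,\tau$; at $\mathsf{Labeled}\,\ell\,\tau$, pairs $(\mathsf{Lb}(v),\mathsf{inl}(w))$ with $(\theta,m,v,w)\in\lfloor\tau\rfloor_V^\beta$; at $\mathbb C\,\ell_1\,\ell_2\,\tau$, pairs of values such that for all $\theta_1\sqsupseteq\theta$,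 $\beta_1\supseteq\beta$, $k\le m$, $i<k$, if $(k,H_s,H_t)\triangleright^{\beta_1}\theta_1$ and $(H_s,v_s)\Downarrow^f_i(H_s',v_s')$ then $(H_t,v_t\,())\Downarrow(H_t',\mathsf{inl}\,v_t')$ for some $H_t',v_t'$ and there are $\theta_2\sqsupseteq\theta_1$, $\beta_2\supseteq\beta_1$ with $(k-i,H_s',H_t')\triangleright^{\beta_2}\theta_2$ and $(\theta_2,k-i,v_s',v_t')\in\lfloor\tau\rfloor_V^{\beta_2}$. Here $(\theta,n,e_s,e_t)\in\lfloor\tau\rfloor_E^\beta$ means that whenever $i<n$ and $e_s\Downarrow_iv_s$, then for every $H_t$ there is $v_t$ with $(H_t,e_t)\Downarrow(H_t,v_t)$ and $(\theta,n-i,v_s,v_t)\in\lfloor\tau\rfloor_V^\beta$; and $(n,H_s,H_t)\triangleright^\beta\theta$ means $\mathrm{dom}\,\theta\subseteq\mathrm{dom}\,H_s$, $\beta\subseteq\mathrm{dom}\,\theta\times\mathrm{dom}\,H_t$, and $(\theta,j,H_s(a),H_t(b))\in\lfloor\theta(a)\rfloor_V^\beta$ for $(a,b)\in\beta$, $j<n$.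 **Models of FG.** For FG store typings $\theta$, the unary relation $\lfloor A^\ell\rfloor_V=\lfloor A\rfloor_V$ on $(\theta,m,v)$ is the usual step-indexed Kripke predicate, with bodies of functions of type $\tau_1\xrightarrow{\ell_e}\tau_2$ in $\lfloor\tau_2\rfloor_E^{\ell_e}$ and with $a\in\lfloor\mathsf{ref}\,\tau\rfloor_V$ iff $\theta(a)=\tau$. Here $(\theta,n,e)\in\lfloor\tau\rfloor_E^{pc}$ iff every run $(H,e)\Downarrow_i(H',v)$ with $i<n$ and $(n,H)\triangleright\theta$ admits $\theta'\sqsupseteq\theta$ with $(n-i,H')\triangleright\theta'$ and $(\theta',n-i,v)\in\lfloor\tau\rfloor_V$, such that $\theta(a)\searrow pc$ for each $a\in\mathrm{dom}\,\theta$ with $H(a)\ne H'(a)$ and $\theta'(a)\searrow pc$ for each $a\in\mathrm{dom}\,\theta'\setminus\mathrm{dom}\,\theta$; and $(n,H)\triangleright\theta$ means $(\theta,j,H(a))\in\lfloor\theta(a)\rfloor_V$ for $a\in\mathrm{dom}\,\theta$ (where $H(a)$ must be defined), $j<n$. For an observer level $\mathcal A$ and worlds $W=(\theta_1,\theta_2,\beta)$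 with $\beta$ a partial bijection of locations, the binary relation $\lceil A^\ell\rceil_V^{\mathcal A}$ on $(W,n,v_1,v_2)$ is: if $\ell\not\sqsubseteq\mathcal A$, that $(\theta_i,n,v_i)\in\lfloor A\rfloor_V$ for $i=1,2$; if $\ell\sqsubseteq\mathcal A$, the usual relational step-indexed Kripke interpretation of $A$ (equality at $\mathsf b$ and $\mathsf{unit}$, membership in $\beta$ with $\theta_1(a_1)=\theta_2(a_2)=\tau$ at $\mathsf{ref}\,\tau$, and at function types additionally both functions in the unary relation). Here $(W,n,e_1,e_2)\in\lceil\tau\rceil_E^{\mathcal A}$ iff for all $(n,H_1,H_2)\triangleright W$ and runs $(H_1,e_1)\Downarrow_i(H_1',v_1)$, $(H_2,e_2)\Downarrow_j(H_2',v_2)$ with $i+j<n$ there is $W'\sqsupseteq W$ with $(n-i-j,H_1',H_2')\triangleright W'$ and $(W',n-i-j,v_1,v_2)\in\lceil\tau\rceil_V^{\mathcal A}$; and $(n,H_1,H_2)\triangleright W$ means $(n,H_i)\triangleright\theta_i$ for $i=1,2$ and, for $(a_1,a_2)\in\beta$, that $\theta_1(a_1)=\theta_2(a_2)$ and the contents are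 related by $\lceil\theta_1(a_1)\rceil_V^{\mathcal A}$ at every $j<n$. **Theorem.** 1. (Translation.) If $\Gamma\vdash e:\tau$ in CG, then there is exactly one $e_F$ with $\Gamma\vdash e:\tau\leadsto e_F$, and $[\![\Gamma]\!]\vdash_\top e_F:[\![\tau]\!]$ in FG. 2. (Cross-language fundamental theorem.) If $\Gamma\vdash e_s:\tau\leadsto e_t$ and $(\theta,m,\delta_s(x),\delta_t(x))\in\lfloor\Gamma(x)\rfloor_V^\beta$ for all $x$, then $(\theta,m,e_s\delta_s,e_t\delta_t)\in\lfloor\tau\rfloor_E^\beta$. 3. (Preservation of meaning.) Let $\tau$ be built from $\mathsf b,\mathsf{unit},\times,+,\mathsf{Labeled}$, and let $v\approx w$ mean that $v$ and $w$ are the same data up to reading $\mathsf{Lb}$ as $\mathsf{inl}$. (a) If $\vdash e_s:\tau\leadsto e_t$ and $e_s\Downarrow v$, then for every heap $H_t$ there is $w\approx v$ with $(H_t,e_t)\Downarrow(H_t,w)$. (b) If $\vdash e_s:\mathbb C\,\ell_1\,\ell_2\,\tau\leadsto e_t$, $e_s\Downarrow c$ and $(H_s,c)\Downarrow^f(H_s',v)$,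 then for every heap $H_t$ there are $H_t'$ and $w\approx v$ with $(H_t,e_t\,())\Downarrow(H_t',\mathsf{inl}\,w)$. 4. (Binary fundamental theorem of FG.) For every $\mathcal A$, if $\Gamma\vdash_{pc}e:\tau$ and $(W,m,\gamma_1(x),\gamma_2(x))\in\lceil\Gamma(x)\rceil_V^{\mathcal A}$ for all $x$, then $(W,m,e\gamma_1,e\gamma_2)\in\lceil\tau\rceil_E^{\mathcal A}$. 5. (Noninterference for CG.) Suppose $\ell_i\not\sqsubseteq\ell$, $x:\mathsf{Labeled}\,\ell_i\,\tau\vdash e:\mathbb C\,\ell'\,\ell\,\mathsf{bool}$, and $v_1,v_2$ are closed values of type $\mathsf{Labeled}\,\ell_i\,\tau$. If $e[v_1/x]\Downarrow c_1$, $(H_1,c_1)\Downarrow^f(H_1',r_1)$, $e[v_2/x]\Downarrow c_2$ and $(H_2,c_2)\Downarrow^f(H_2',r_2)$, then $r_1=r_2$. -/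

import Mathlib

/-!
The coarse-grained calculus CG, the fine-grained calculus FG (types, terms, typing, big-step
semantics with step counts), the translation from CG to FG, the step-indexed Kripke relation
across the two languages, and the unary and binary step-indexed Kripke models of FG.

`L` is the security lattice, `B` the set of base types, `K` the set of constants of base type.
Terms are well-scoped de Bruijn terms: an element of `CExp K n` (or `FExp K n`) has its free
variables among `n` variables, variable `0` being the one bound last, and `CExp K 0` is the
type of closed terms. Terms carry no labels and no types.
-/

namespace IFC

universe u v w

/-- Extension of a finite sequence (a context or a substitution) by an entry for variable `0`. -/
def scons {α : Type u} {n : ℕ} (a : α) (f : Fin n → α) : Fin (n + 1) → α :=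
  Fin.cases a f

/-- Lifting of a renaming under a binder. -/
def liftRen {n m : ℕ} (ρ : Fin n → Fin m) : Fin (n + 1) → Fin (m + 1) :=
  Fin.cases 0 (fun i => (ρ i).succ)

/-! ### CG: types, terms, substitution -/

/-- CG types. `labeled ℓ τ` is `Labeled ℓ τ`, and `comp ℓ₁ ℓ₂ τ` is the type of monadic
computations with pc-label `ℓ₁`, taint label `ℓ₂` and output type `τ`. -/
inductive CTy (L : Type u) (B : Type v) : Type (max u v)
  | base (b : B)
  | unit
  | arrow (τ₁ τ₂ : CTy L B)
  | prod (τ₁ τ₂ : CTy L B)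
  | sum (τ₁ τ₂ : CTy L B)
  | ref (ℓ : L) (τ : CTy L B)
  | labeled (ℓ : L) (τ : CTy L B)
  | comp (ℓ₁ ℓ₂ : L) (τ : CTy L B)

/-- `bool` is `unit + unit`. -/
def CTy.bool (L : Type u) (B : Type v) : CTy L B := .sum .unit .unit

/-- CG terms. Locations `loc a` occur at run time only and have no typing rule. -/
inductive CExp (K : Type w) : ℕ → Type w
  | var {n : ℕ} (i : Fin n) : CExp K n
  | const {n : ℕ} (k : K) : CExp K n
  | unit {n : ℕ} : CExp K n
  | loc {n : ℕ} (a : ℕ) : CExp K n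
  | lam {n : ℕ} (e : CExp K (n + 1)) : CExp K n
  | app {n : ℕ} (e₁ e₂ : CExp K n) : CExp K n
  | pair {n : ℕ} (e₁ e₂ : CExp K n) : CExp K n
  | fst {n : ℕ} (e : CExp K n) : CExp K n
  | snd {n : ℕ} (e : CExp K n) : CExp K n
  | inl {n : ℕ} (e : CExp K n) : CExp K n
  | inr {n : ℕ} (e : CExp K n) : CExp K n
  | caseOf {n : ℕ} (e : CExp K n) (e₁ e₂ : CExp K (n + 1)) : CExp K n
  | newRef {n : ℕ} (e : CExp K n) : CExp K n
  | deref {n : ℕ} (e : CExp K n) : CExp K n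
  | assign {n : ℕ} (e₁ e₂ : CExp K n) : CExp K n
  | label {n : ℕ} (e : CExp K n) : CExp K n
  | unlabel {n : ℕ} (e : CExp K n) : CExp K n
  | toLabeled {n : ℕ} (e : CExp K n) : CExp K n
  | ret {n : ℕ} (e : CExp K n) : CExp K n
  | bind {n : ℕ} (e₁ : CExp K n) (e₂ : CExp K (n + 1)) : CExp K n

/-- Renaming of variables. -/
def CExp.rename {K : Type w} : {n m : ℕ} → (Fin n → Fin m) → CExp K n → CExp K m
  | _, _, ρ, .var i => .var (ρ i)
  | _, _, _, .const k => .const k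
  | _, _, _, .unit => .unit
  | _, _, _, .loc a => .loc a
  | _, _, ρ, .lam e => .lam (e.rename (liftRen ρ))
  | _, _, ρ, .app e₁ e₂ => .app (e₁.rename ρ) (e₂.rename ρ)
  | _, _, ρ, .pair e₁ e₂ => .pair (e₁.rename ρ) (e₂.rename ρ)
  | _, _, ρ, .fst e => .fst (e.rename ρ)
  | _, _, ρ, .snd e => .snd (e.rename ρ)
  | _, _, ρ, .inl e => .inl (e.rename ρ)
  | _, _, ρ, .inr e => .inr (e.rename ρ)
  | _, _, ρ, .caseOf e e₁ e₂ =>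
      .caseOf (e.rename ρ) (e₁.rename (liftRen ρ)) (e₂.rename (liftRen ρ))
  | _, _, ρ, .newRef e => .newRef (e.rename ρ)
  | _, _, ρ, .deref e => .deref (e.rename ρ)
  | _, _, ρ, .assign e₁ e₂ => .assign (e₁.rename ρ) (e₂.rename ρ)
  | _, _, ρ, .label e => .label (e.rename ρ)
  | _, _, ρ, .unlabel e => .unlabel (e.rename ρ)
  | _, _, ρ, .toLabeled e => .toLabeled (e.rename ρ)
  | _, _, ρ, .ret e => .ret (e.rename ρ)
  | _, _, ρ, .bind e₁ e₂ => .bind (e₁.rename ρ) (e₂.rename (liftRen ρ))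

/-- Lifting of a substitution under a binder. -/
def CExp.lift {K : Type w} {n m : ℕ} (σ : Fin n → CExp K m) : Fin (n + 1) → CExp K (m + 1) :=
  scons (.var 0) (fun i => (σ i).rename Fin.succ)

/-- Simultaneous capture-avoiding substitution. -/
def CExp.subst {K : Type w} : {n m : ℕ} → (Fin n → CExp K m) → CExp K n → CExp K m
  | _, _, σ, .var i => σ i
  | _, _, _, .const k => .const k
  | _, _, _, .unit => .unit
  | _, _, _, .loc a => .loc a
  | _, _, σ, .lam e => .lam (e.subst (CExp.lift σ))
  | _, _, σ, .app e₁ e₂ => .app (e₁.subst σ) (e₂.subst σ)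
  | _, _, σ, .pair e₁ e₂ => .pair (e₁.subst σ) (e₂.subst σ)
  | _, _, σ, .fst e => .fst (e.subst σ)
  | _, _, σ, .snd e => .snd (e.subst σ)
  | _, _, σ, .inl e => .inl (e.subst σ)
  | _, _, σ, .inr e => .inr (e.subst σ)
  | _, _, σ, .caseOf e e₁ e₂ =>
      .caseOf (e.subst σ) (e₁.subst (CExp.lift σ)) (e₂.subst (CExp.lift σ))
  | _, _, σ, .newRef e => .newRef (e.subst σ)
  | _, _, σ, .deref e => .deref (e.subst σ)
  | _, _, σ, .assign e₁ e₂ => .assign (e₁.subst σ) (e₂.subst σ)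
  | _, _, σ, .label e => .label (e.subst σ)
  | _, _, σ, .unlabel e => .unlabel (e.subst σ)
  | _, _, σ, .toLabeled e => .toLabeled (e.subst σ)
  | _, _, σ, .ret e => .ret (e.subst σ)
  | _, _, σ, .bind e₁ e₂ => .bind (e₁.subst σ) (e₂.subst (CExp.lift σ))

/-- `e[v/x]`, where `x` is variable `0`. -/
def CExp.inst {K : Type w} {n : ℕ} (e : CExp K (n + 1)) (v : CExp K n) : CExp K n :=
  e.subst (scons v CExp.var)

/-! ### CG: subtyping and typing -/

/-- Subtyping of CG. References are invariant. -/
inductive CSub {L : Type u} {B : Type v} [Lattice L] : CTy L B → CTy L B → Prop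
  | refl (τ : CTy L B) : CSub τ τ
  | arrow {τ₁ τ₂ τ₁' τ₂' : CTy L B} :
      CSub τ₁' τ₁ → CSub τ₂ τ₂' → CSub (.arrow τ₁ τ₂) (.arrow τ₁' τ₂')
  | prod {τ₁ τ₂ τ₁' τ₂' : CTy L B} :
      CSub τ₁ τ₁' → CSub τ₂ τ₂' → CSub (.prod τ₁ τ₂) (.prod τ₁' τ₂')
  | sum {τ₁ τ₂ τ₁' τ₂' : CTy L B} :
      CSub τ₁ τ₁' → CSub τ₂ τ₂' → CSub (.sum τ₁ τ₂) (.sum τ₁' τ₂')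
  | labeled {τ τ' : CTy L B} {ℓ ℓ' : L} :
      CSub τ τ' → ℓ ≤ ℓ' → CSub (.labeled ℓ τ) (.labeled ℓ' τ')
  | comp {τ τ' : CTy L B} {ℓ₁ ℓ₂ ℓ₁' ℓ₂' : L} :
      CSub τ τ' → ℓ₁' ≤ ℓ₁ → ℓ₂ ≤ ℓ₂' → CSub (.comp ℓ₁ ℓ₂ τ) (.comp ℓ₁' ℓ₂' τ')

section CGTyping

variable {L : Type u} {B : Type v} {K : Type w} [Lattice L] [BoundedOrder L]

/-- The CG typing judgment `Γ ⊢ e : τ`; `ty k` is the base type of the constant `k`. -/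
inductive CTyped (ty : K → B) : {n : ℕ} → (Fin n → CTy L B) → CExp K n → CTy L B → Prop
  | var {n : ℕ} {Γ : Fin n → CTy L B} (i : Fin n) : CTyped ty Γ (.var i) (Γ i)
  | const {n : ℕ} {Γ : Fin n → CTy L B} (k : K) : CTyped ty Γ (.const k) (.base (ty k))
  | unit {n : ℕ} {Γ : Fin n → CTy L B} : CTyped ty Γ .unit .unit
  | lam {n : ℕ} {Γ : Fin n → CTy L B} {e : CExp K (n + 1)} {τ₁ τ₂ : CTy L B} :
      CTyped ty (scons τ₁ Γ) e τ₂ → CTyped ty Γ (.lam e) (.arrow τ₁ τ₂)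
  | app {n : ℕ} {Γ : Fin n → CTy L B} {e₁ e₂ : CExp K n} {τ₁ τ₂ : CTy L B} :
      CTyped ty Γ e₁ (.arrow τ₁ τ₂) → CTyped ty Γ e₂ τ₁ → CTyped ty Γ (.app e₁ e₂) τ₂
  | pair {n : ℕ} {Γ : Fin n → CTy L B} {e₁ e₂ : CExp K n} {τ₁ τ₂ : CTy L B} :
      CTyped ty Γ e₁ τ₁ → CTyped ty Γ e₂ τ₂ → CTyped ty Γ (.pair e₁ e₂) (.prod τ₁ τ₂)
  | fst {n : ℕ} {Γ : Fin n → CTy L B} {e : CExp K n} {τ₁ τ₂ : CTy L B} :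
      CTyped ty Γ e (.prod τ₁ τ₂) → CTyped ty Γ (.fst e) τ₁
  | snd {n : ℕ} {Γ : Fin n → CTy L B} {e : CExp K n} {τ₁ τ₂ : CTy L B} :
      CTyped ty Γ e (.prod τ₁ τ₂) → CTyped ty Γ (.snd e) τ₂
  | inl {n : ℕ} {Γ : Fin n → CTy L B} {e : CExp K n} {τ₁ τ₂ : CTy L B} :
      CTyped ty Γ e τ₁ → CTyped ty Γ (.inl e) (.sum τ₁ τ₂)
  | inr {n : ℕ} {Γ : Fin n → CTy L B} {e : CExp K n} {τ₁ τ₂ : CTy L B} :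
      CTyped ty Γ e τ₂ → CTyped ty Γ (.inr e) (.sum τ₁ τ₂)
  | caseOf {n : ℕ} {Γ : Fin n → CTy L B} {e : CExp K n} {e₁ e₂ : CExp K (n + 1)}
      {τ₁ τ₂ τ : CTy L B} :
      CTyped ty Γ e (.sum τ₁ τ₂) → CTyped ty (scons τ₁ Γ) e₁ τ → CTyped ty (scons τ₂ Γ) e₂ τ →
      CTyped ty Γ (.caseOf e e₁ e₂) τ
  | label {n : ℕ} {Γ : Fin n → CTy L B} {e : CExp K n} {τ : CTy L B} {ℓ : L} :
      CTyped ty Γ e τ → CTyped ty Γ (.label e) (.labeled ℓ τ)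
  | unlabel {n : ℕ} {Γ : Fin n → CTy L B} {e : CExp K n} {τ : CTy L B} {ℓ : L} :
      CTyped ty Γ e (.labeled ℓ τ) → CTyped ty Γ (.unlabel e) (.comp ⊤ ℓ τ)
  | toLabeled {n : ℕ} {Γ : Fin n → CTy L B} {e : CExp K n} {τ : CTy L B} {ℓ₁ ℓ₂ : L} :
      CTyped ty Γ e (.comp ℓ₁ ℓ₂ τ) →
      CTyped ty Γ (.toLabeled e) (.comp ℓ₁ ⊥ (.labeled ℓ₂ τ))
  | ret {n : ℕ} {Γ : Fin n → CTy L B} {e : CExp K n} {τ : CTy L B} :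
      CTyped ty Γ e τ → CTyped ty Γ (.ret e) (.comp ⊤ ⊥ τ)
  | bind {n : ℕ} {Γ : Fin n → CTy L B} {e₁ : CExp K n} {e₂ : CExp K (n + 1)}
      {τ τ' : CTy L B} {ℓ ℓ₁ ℓ₂ ℓ₃ ℓ₄ : L} :
      CTyped ty Γ e₁ (.comp ℓ₁ ℓ₂ τ) → CTyped ty (scons τ Γ) e₂ (.comp ℓ₃ ℓ₄ τ') →
      ℓ ≤ ℓ₁ → ℓ ≤ ℓ₃ → ℓ₂ ≤ ℓ₃ → ℓ₂ ≤ ℓ₄ →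
      CTyped ty Γ (.bind e₁ e₂) (.comp ℓ ℓ₄ τ')
  | newRef {n : ℕ} {Γ : Fin n → CTy L B} {e : CExp K n} {τ : CTy L B} {ℓ : L} :
      CTyped ty Γ e (.labeled ℓ τ) → CTyped ty Γ (.newRef e) (.comp ℓ ⊥ (.ref ℓ τ))
  | deref {n : ℕ} {Γ : Fin n → CTy L B} {e : CExp K n} {τ : CTy L B} {ℓ : L} :
      CTyped ty Γ e (.ref ℓ τ) → CTyped ty Γ (.deref e) (.comp ⊤ ⊥ (.labeled ℓ τ))
  | assign {n : ℕ} {Γ : Fin n → CTy L B} {e₁ e₂ : CExp K n} {τ : CTy L B} {ℓ : L} :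
      CTyped ty Γ e₁ (.ref ℓ τ) → CTyped ty Γ e₂ (.labeled ℓ τ) →
      CTyped ty Γ (.assign e₁ e₂) (.comp ℓ ⊥ .unit)
  | sub {n : ℕ} {Γ : Fin n → CTy L B} {e : CExp K n} {τ τ' : CTy L B} :
      CTyped ty Γ e τ' → CSub τ' τ → CTyped ty Γ e τ

end CGTyping

/-! ### CG: values, pure evaluation, forcing -/

/-- Closed CG values. All monadic terms are values: they are suspended computations. -/
inductive CVal {K : Type w} : CExp K 0 → Prop
  | const (k : K) : CVal (.const k)
  | unit : CVal .unit
  | loc (a : ℕ) : CVal (.loc a)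
  | lam (e : CExp K 1) : CVal (.lam e)
  | pair {v₁ v₂ : CExp K 0} : CVal v₁ → CVal v₂ → CVal (.pair v₁ v₂)
  | inl {v : CExp K 0} : CVal v → CVal (.inl v)
  | inr {v : CExp K 0} : CVal v → CVal (.inr v)
  | label {v : CExp K 0} : CVal v → CVal (.label v)
  | unlabel (e : CExp K 0) : CVal (.unlabel e)
  | toLabeled (e : CExp K 0) : CVal (.toLabeled e)
  | ret (e : CExp K 0) : CVal (.ret e)
  | bind (e₁ : CExp K 0) (e₂ : CExp K 1) : CVal (.bind e₁ e₂)
  | newRef (e : CExp K 0) : CVal (.newRef e)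
  | deref (e : CExp K 0) : CVal (.deref e)
  | assign (e₁ e₂ : CExp K 0) : CVal (.assign e₁ e₂)

/-- Pure call-by-value evaluation of CG, `e ⇓ v` in `i` steps; it does not touch the heap. -/
inductive CEval {K : Type w} : CExp K 0 → ℕ → CExp K 0 → Prop
  | const (k : K) : CEval (.const k) 0 (.const k)
  | unit : CEval .unit 0 .unit
  | loc (a : ℕ) : CEval (.loc a) 0 (.loc a)
  | lam (e : CExp K 1) : CEval (.lam e) 0 (.lam e)
  | app {e₁ e₂ : CExp K 0} {e : CExp K 1} {v v' : CExp K 0} {i j k : ℕ} :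
      CEval e₁ i (.lam e) → CEval e₂ j v → CEval (e.inst v) k v' →
      CEval (.app e₁ e₂) (i + j + k + 1) v'
  | pair {e₁ e₂ v₁ v₂ : CExp K 0} {i j : ℕ} :
      CEval e₁ i v₁ → CEval e₂ j v₂ → CEval (.pair e₁ e₂) (i + j + 1) (.pair v₁ v₂)
  | fst {e v₁ v₂ : CExp K 0} {i : ℕ} :
      CEval e i (.pair v₁ v₂) → CEval (.fst e) (i + 1) v₁
  | snd {e v₁ v₂ : CExp K 0} {i : ℕ} :
      CEval e i (.pair v₁ v₂) → CEval (.snd e) (i + 1) v₂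
  | inl {e v : CExp K 0} {i : ℕ} : CEval e i v → CEval (.inl e) (i + 1) (.inl v)
  | inr {e v : CExp K 0} {i : ℕ} : CEval e i v → CEval (.inr e) (i + 1) (.inr v)
  | caseInl {e : CExp K 0} {e₁ e₂ : CExp K 1} {v v' : CExp K 0} {i j : ℕ} :
      CEval e i (.inl v) → CEval (e₁.inst v) j v' → CEval (.caseOf e e₁ e₂) (i + j + 1) v'
  | caseInr {e : CExp K 0} {e₁ e₂ : CExp K 1} {v v' : CExp K 0} {i j : ℕ} :
      CEval e i (.inr v) → CEval (e₂.inst v) j v' → CEval (.caseOf e e₁ e₂) (i + j + 1) v'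
  | label {e v : CExp K 0} {i : ℕ} : CEval e i v → CEval (.label e) (i + 1) (.label v)
  | unlabel (e : CExp K 0) : CEval (.unlabel e) 0 (.unlabel e)
  | toLabeled (e : CExp K 0) : CEval (.toLabeled e) 0 (.toLabeled e)
  | ret (e : CExp K 0) : CEval (.ret e) 0 (.ret e)
  | bind (e₁ : CExp K 0) (e₂ : CExp K 1) : CEval (.bind e₁ e₂) 0 (.bind e₁ e₂)
  | newRef (e : CExp K 0) : CEval (.newRef e) 0 (.newRef e)
  | deref (e : CExp K 0) : CEval (.deref e) 0 (.deref e)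
  | assign (e₁ e₂ : CExp K 0) : CEval (.assign e₁ e₂) 0 (.assign e₁ e₂)

/-- CG heaps: finite maps from locations to closed terms. -/
abbrev CHeap (K : Type w) : Type w := Finmap (fun _ : ℕ => CExp K 0)

/-- The forcing semantics of CG: `CForce H e i H' v` says that running the suspended
computation `e` in the heap `H` takes `i` steps, ends in the heap `H'` and returns `v`. -/
inductive CForce {K : Type w} : CHeap K → CExp K 0 → ℕ → CHeap K → CExp K 0 → Prop
  | ret {H : CHeap K} {e v : CExp K 0} {i : ℕ} :
      CEval e i v → CForce H (.ret e) (i + 1) H v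
  | bind {H H' H'' : CHeap K} {e₁ : CExp K 0} {e₂ : CExp K 1} {v₁ v₁' v₂ v₂' : CExp K 0}
      {i j k l : ℕ} :
      CEval e₁ i v₁ → CForce H v₁ j H' v₁' → CEval (e₂.inst v₁') k v₂ →
      CForce H' v₂ l H'' v₂' → CForce H (.bind e₁ e₂) (i + j + k + l + 1) H'' v₂'
  | unlabel {H : CHeap K} {e v : CExp K 0} {i : ℕ} :
      CEval e i (.label v) → CForce H (.unlabel e) (i + 1) H v
  | toLabeled {H H' : CHeap K} {e v v' : CExp K 0} {i j : ℕ} :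
      CEval e i v → CForce H v j H' v' → CForce H (.toLabeled e) (i + j + 1) H' (.label v')
  | newRef {H : CHeap K} {e v : CExp K 0} {i a : ℕ} :
      CEval e i v → a ∉ H → CForce H (.newRef e) (i + 1) (H.insert a v) (.loc a)
  | deref {H : CHeap K} {e v : CExp K 0} {i a : ℕ} :
      CEval e i (.loc a) → H.lookup a = some v → CForce H (.deref e) (i + 1) H v
  | assign {H : CHeap K} {e₁ e₂ v : CExp K 0} {i j a : ℕ} :
      CEval e₁ i (.loc a) → CEval e₂ j v → a ∈ H →
      CForce H (.assign e₁ e₂) (i + j + 1) (H.insert a v) .unit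

/-! ### FG: types, terms, substitution -/

/-- FG types. An FG type is an unlabeled type `A` with a label `ℓ` on it, written `A^ℓ`; here
the label `ℓ` is the last argument of each constructor, so `arrow τ₁ ℓe τ₂ ℓ` is
the type of functions from `τ₁` to `τ₂` with pc-label `ℓe` on the arrow and label `ℓ` outside. -/
inductive FTy (L : Type u) (B : Type v) : Type (max u v)
  | base (b : B) (ℓ : L)
  | unit (ℓ : L)
  | arrow (τ₁ : FTy L B) (ℓe : L) (τ₂ : FTy L B) (ℓ : L)
  | prod (τ₁ τ₂ : FTy L B) (ℓ : L)
  | sum (τ₁ τ₂ : FTy L B) (ℓ : L)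
  | ref (τ : FTy L B) (ℓ : L)

/-- The outer label of an FG type: `(A^ℓ).lab = ℓ`. Thus `A^ℓ'` is protected at `ℓ` when
`ℓ ≤ (A^ℓ').lab`. -/
def FTy.lab {L : Type u} {B : Type v} : FTy L B → L
  | .base _ ℓ => ℓ
  | .unit ℓ => ℓ
  | .arrow _ _ _ ℓ => ℓ
  | .prod _ _ ℓ => ℓ
  | .sum _ _ ℓ => ℓ
  | .ref _ ℓ => ℓ

/-- FG terms. Locations `loc a` occur at run time only and have no typing rule. -/
inductive FExp (K : Type w) : ℕ → Type w
  | var {n : ℕ} (i : Fin n) : FExp K n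
  | const {n : ℕ} (k : K) : FExp K n
  | unit {n : ℕ} : FExp K n
  | loc {n : ℕ} (a : ℕ) : FExp K n
  | lam {n : ℕ} (e : FExp K (n + 1)) : FExp K n
  | app {n : ℕ} (e₁ e₂ : FExp K n) : FExp K n
  | pair {n : ℕ} (e₁ e₂ : FExp K n) : FExp K n
  | fst {n : ℕ} (e : FExp K n) : FExp K n
  | snd {n : ℕ} (e : FExp K n) : FExp K n
  | inl {n : ℕ} (e : FExp K n) : FExp K n
  | inr {n : ℕ} (e : FExp K n) : FExp K n
  | caseOf {n : ℕ} (e : FExp K n) (e₁ e₂ : FExp K (n + 1)) : FExp K n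
  | newRef {n : ℕ} (e : FExp K n) : FExp K n
  | deref {n : ℕ} (e : FExp K n) : FExp K n
  | assign {n : ℕ} (e₁ e₂ : FExp K n) : FExp K n

/-- Renaming of variables. -/
def FExp.rename {K : Type w} : {n m : ℕ} → (Fin n → Fin m) → FExp K n → FExp K m
  | _, _, ρ, .var i => .var (ρ i)
  | _, _, _, .const k => .const k
  | _, _, _, .unit => .unit
  | _, _, _, .loc a => .loc a
  | _, _, ρ, .lam e => .lam (e.rename (liftRen ρ))
  | _, _, ρ, .app e₁ e₂ => .app (e₁.rename ρ) (e₂.rename ρ)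
  | _, _, ρ, .pair e₁ e₂ => .pair (e₁.rename ρ) (e₂.rename ρ)
  | _, _, ρ, .fst e => .fst (e.rename ρ)
  | _, _, ρ, .snd e => .snd (e.rename ρ)
  | _, _, ρ, .inl e => .inl (e.rename ρ)
  | _, _, ρ, .inr e => .inr (e.rename ρ)
  | _, _, ρ, .caseOf e e₁ e₂ =>
      .caseOf (e.rename ρ) (e₁.rename (liftRen ρ)) (e₂.rename (liftRen ρ))
  | _, _, ρ, .newRef e => .newRef (e.rename ρ)
  | _, _, ρ, .deref e => .deref (e.rename ρ)
  | _, _, ρ, .assign e₁ e₂ => .assign (e₁.rename ρ) (e₂.rename ρ)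

/-- Lifting of a substitution under a binder. -/
def FExp.lift {K : Type w} {n m : ℕ} (σ : Fin n → FExp K m) : Fin (n + 1) → FExp K (m + 1) :=
  scons (.var 0) (fun i => (σ i).rename Fin.succ)

/-- Simultaneous capture-avoiding substitution. -/
def FExp.subst {K : Type w} : {n m : ℕ} → (Fin n → FExp K m) → FExp K n → FExp K m
  | _, _, σ, .var i => σ i
  | _, _, _, .const k => .const k
  | _, _, _, .unit => .unit
  | _, _, _, .loc a => .loc a
  | _, _, σ, .lam e => .lam (e.subst (FExp.lift σ))
  | _, _, σ, .app e₁ e₂ => .app (e₁.subst σ) (e₂.subst σ)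
  | _, _, σ, .pair e₁ e₂ => .pair (e₁.subst σ) (e₂.subst σ)
  | _, _, σ, .fst e => .fst (e.subst σ)
  | _, _, σ, .snd e => .snd (e.subst σ)
  | _, _, σ, .inl e => .inl (e.subst σ)
  | _, _, σ, .inr e => .inr (e.subst σ)
  | _, _, σ, .caseOf e e₁ e₂ =>
      .caseOf (e.subst σ) (e₁.subst (FExp.lift σ)) (e₂.subst (FExp.lift σ))
  | _, _, σ, .newRef e => .newRef (e.subst σ)
  | _, _, σ, .deref e => .deref (e.subst σ)
  | _, _, σ, .assign e₁ e₂ => .assign (e₁.subst σ) (e₂.subst σ)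

/-- `e[v/x]`, where `x` is variable `0`. -/
def FExp.inst {K : Type w} {n : ℕ} (e : FExp K (n + 1)) (v : FExp K n) : FExp K n :=
  e.subst (scons v FExp.var)

/-- `λ_. e`, where the bound variable does not occur in `e`. -/
def FExp.thunk {K : Type w} {n : ℕ} (e : FExp K n) : FExp K n :=
  .lam (e.rename Fin.succ)

/-! ### FG: subtyping, typing, evaluation -/

/-- Subtyping of FG: labels are covariant, the pc-label of an arrow is contravariant, and
references are invariant below their outer label. -/
inductive FSub {L : Type u} {B : Type v} [Lattice L] : FTy L B → FTy L B → Prop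
  | base {b : B} {ℓ ℓ' : L} : ℓ ≤ ℓ' → FSub (.base b ℓ) (.base b ℓ')
  | unit {ℓ ℓ' : L} : ℓ ≤ ℓ' → FSub (.unit ℓ) (.unit ℓ')
  | arrow {τ₁ τ₂ τ₁' τ₂' : FTy L B} {ℓe ℓe' ℓ ℓ' : L} :
      FSub τ₁' τ₁ → FSub τ₂ τ₂' → ℓe' ≤ ℓe → ℓ ≤ ℓ' →
      FSub (.arrow τ₁ ℓe τ₂ ℓ) (.arrow τ₁' ℓe' τ₂' ℓ')
  | prod {τ₁ τ₂ τ₁' τ₂' : FTy L B} {ℓ ℓ' : L} :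
      FSub τ₁ τ₁' → FSub τ₂ τ₂' → ℓ ≤ ℓ' → FSub (.prod τ₁ τ₂ ℓ) (.prod τ₁' τ₂' ℓ')
  | sum {τ₁ τ₂ τ₁' τ₂' : FTy L B} {ℓ ℓ' : L} :
      FSub τ₁ τ₁' → FSub τ₂ τ₂' → ℓ ≤ ℓ' → FSub (.sum τ₁ τ₂ ℓ) (.sum τ₁' τ₂' ℓ')
  | ref {τ : FTy L B} {ℓ ℓ' : L} : ℓ ≤ ℓ' → FSub (.ref τ ℓ) (.ref τ ℓ')

section FGTyping

variable {L : Type u} {B : Type v} {K : Type w} [Lattice L] [BoundedOrder L]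

/-- The FG typing judgment `Γ ⊢_pc e : τ`. -/
inductive FTyped (ty : K → B) :
    {n : ℕ} → (Fin n → FTy L B) → L → FExp K n → FTy L B → Prop
  | var {n : ℕ} {Γ : Fin n → FTy L B} {pc : L} (i : Fin n) : FTyped ty Γ pc (.var i) (Γ i)
  | const {n : ℕ} {Γ : Fin n → FTy L B} {pc : L} (k : K) :
      FTyped ty Γ pc (.const k) (.base (ty k) ⊥)
  | unit {n : ℕ} {Γ : Fin n → FTy L B} {pc : L} : FTyped ty Γ pc .unit (.unit ⊥)
  | lam {n : ℕ} {Γ : Fin n → FTy L B} {pc ℓe : L} {e : FExp K (n + 1)} {τ₁ τ₂ : FTy L B} :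
      FTyped ty (scons τ₁ Γ) ℓe e τ₂ → FTyped ty Γ pc (.lam e) (.arrow τ₁ ℓe τ₂ ⊥)
  | app {n : ℕ} {Γ : Fin n → FTy L B} {pc ℓe ℓ : L} {e₁ e₂ : FExp K n} {τ₁ τ₂ : FTy L B} :
      FTyped ty Γ pc e₁ (.arrow τ₁ ℓe τ₂ ℓ) → FTyped ty Γ pc e₂ τ₁ →
      ℓ ⊔ pc ≤ ℓe → ℓ ≤ τ₂.lab → FTyped ty Γ pc (.app e₁ e₂) τ₂
  | pair {n : ℕ} {Γ : Fin n → FTy L B} {pc : L} {e₁ e₂ : FExp K n} {τ₁ τ₂ : FTy L B} :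
      FTyped ty Γ pc e₁ τ₁ → FTyped ty Γ pc e₂ τ₂ →
      FTyped ty Γ pc (.pair e₁ e₂) (.prod τ₁ τ₂ ⊥)
  | fst {n : ℕ} {Γ : Fin n → FTy L B} {pc ℓ : L} {e : FExp K n} {τ₁ τ₂ : FTy L B} :
      FTyped ty Γ pc e (.prod τ₁ τ₂ ℓ) → ℓ ≤ τ₁.lab → FTyped ty Γ pc (.fst e) τ₁
  | snd {n : ℕ} {Γ : Fin n → FTy L B} {pc ℓ : L} {e : FExp K n} {τ₁ τ₂ : FTy L B} :
      FTyped ty Γ pc e (.prod τ₁ τ₂ ℓ) → ℓ ≤ τ₂.lab → FTyped ty Γ pc (.snd e) τ₂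
  | inl {n : ℕ} {Γ : Fin n → FTy L B} {pc : L} {e : FExp K n} {τ₁ τ₂ : FTy L B} :
      FTyped ty Γ pc e τ₁ → FTyped ty Γ pc (.inl e) (.sum τ₁ τ₂ ⊥)
  | inr {n : ℕ} {Γ : Fin n → FTy L B} {pc : L} {e : FExp K n} {τ₁ τ₂ : FTy L B} :
      FTyped ty Γ pc e τ₂ → FTyped ty Γ pc (.inr e) (.sum τ₁ τ₂ ⊥)
  | caseOf {n : ℕ} {Γ : Fin n → FTy L B} {pc ℓ : L} {e : FExp K n} {e₁ e₂ : FExp K (n + 1)}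
      {τ₁ τ₂ τ : FTy L B} :
      FTyped ty Γ pc e (.sum τ₁ τ₂ ℓ) → FTyped ty (scons τ₁ Γ) (pc ⊔ ℓ) e₁ τ →
      FTyped ty (scons τ₂ Γ) (pc ⊔ ℓ) e₂ τ → ℓ ≤ τ.lab →
      FTyped ty Γ pc (.caseOf e e₁ e₂) τ
  | newRef {n : ℕ} {Γ : Fin n → FTy L B} {pc : L} {e : FExp K n} {τ : FTy L B} :
      FTyped ty Γ pc e τ → pc ≤ τ.lab → FTyped ty Γ pc (.newRef e) (.ref τ ⊥)
  | deref {n : ℕ} {Γ : Fin n → FTy L B} {pc ℓ : L} {e : FExp K n} {τ τ' : FTy L B} :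
      FTyped ty Γ pc e (.ref τ ℓ) → FSub τ τ' → ℓ ≤ τ'.lab → FTyped ty Γ pc (.deref e) τ'
  | assign {n : ℕ} {Γ : Fin n → FTy L B} {pc ℓ : L} {e₁ e₂ : FExp K n} {τ : FTy L B} :
      FTyped ty Γ pc e₁ (.ref τ ℓ) → FTyped ty Γ pc e₂ τ → pc ⊔ ℓ ≤ τ.lab →
      FTyped ty Γ pc (.assign e₁ e₂) (.unit ⊥)
  | sub {n : ℕ} {Γ : Fin n → FTy L B} {pc pc' : L} {e : FExp K n} {τ τ' : FTy L B} :
      FTyped ty Γ pc' e τ' → pc ≤ pc' → FSub τ' τ → FTyped ty Γ pc e τ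

end FGTyping

/-- FG heaps: finite maps from locations to closed terms. -/
abbrev FHeap (K : Type w) : Type w := Finmap (fun _ : ℕ => FExp K 0)

/-- Closed FG values. -/
inductive FVal {K : Type w} : FExp K 0 → Prop
  | const (k : K) : FVal (.const k)
  | unit : FVal .unit
  | loc (a : ℕ) : FVal (.loc a)
  | lam (e : FExp K 1) : FVal (.lam e)
  | pair {v₁ v₂ : FExp K 0} : FVal v₁ → FVal v₂ → FVal (.pair v₁ v₂)
  | inl {v : FExp K 0} : FVal v → FVal (.inl v)
  | inr {v : FExp K 0} : FVal v → FVal (.inr v)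

/-- Call-by-value evaluation of FG: `FEval H e i H' v` says that `(H, e) ⇓ (H', v)` in `i`
steps. -/
inductive FEval {K : Type w} : FHeap K → FExp K 0 → ℕ → FHeap K → FExp K 0 → Prop
  | const {H : FHeap K} (k : K) : FEval H (.const k) 0 H (.const k)
  | unit {H : FHeap K} : FEval H .unit 0 H .unit
  | loc {H : FHeap K} (a : ℕ) : FEval H (.loc a) 0 H (.loc a)
  | lam {H : FHeap K} (e : FExp K 1) : FEval H (.lam e) 0 H (.lam e)
  | app {H H₁ H₂ H₃ : FHeap K} {e₁ e₂ : FExp K 0} {e : FExp K 1} {v v' : FExp K 0}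
      {i j k : ℕ} :
      FEval H e₁ i H₁ (.lam e) → FEval H₁ e₂ j H₂ v → FEval H₂ (e.inst v) k H₃ v' →
      FEval H (.app e₁ e₂) (i + j + k + 1) H₃ v'
  | pair {H H₁ H₂ : FHeap K} {e₁ e₂ v₁ v₂ : FExp K 0} {i j : ℕ} :
      FEval H e₁ i H₁ v₁ → FEval H₁ e₂ j H₂ v₂ →
      FEval H (.pair e₁ e₂) (i + j + 1) H₂ (.pair v₁ v₂)
  | fst {H H₁ : FHeap K} {e v₁ v₂ : FExp K 0} {i : ℕ} :
      FEval H e i H₁ (.pair v₁ v₂) → FEval H (.fst e) (i + 1) H₁ v₁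
  | snd {H H₁ : FHeap K} {e v₁ v₂ : FExp K 0} {i : ℕ} :
      FEval H e i H₁ (.pair v₁ v₂) → FEval H (.snd e) (i + 1) H₁ v₂
  | inl {H H₁ : FHeap K} {e v : FExp K 0} {i : ℕ} :
      FEval H e i H₁ v → FEval H (.inl e) (i + 1) H₁ (.inl v)
  | inr {H H₁ : FHeap K} {e v : FExp K 0} {i : ℕ} :
      FEval H e i H₁ v → FEval H (.inr e) (i + 1) H₁ (.inr v)
  | caseInl {H H₁ H₂ : FHeap K} {e : FExp K 0} {e₁ e₂ : FExp K 1} {v v' : FExp K 0}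
      {i j : ℕ} :
      FEval H e i H₁ (.inl v) → FEval H₁ (e₁.inst v) j H₂ v' →
      FEval H (.caseOf e e₁ e₂) (i + j + 1) H₂ v'
  | caseInr {H H₁ H₂ : FHeap K} {e : FExp K 0} {e₁ e₂ : FExp K 1} {v v' : FExp K 0}
      {i j : ℕ} :
      FEval H e i H₁ (.inr v) → FEval H₁ (e₂.inst v) j H₂ v' →
      FEval H (.caseOf e e₁ e₂) (i + j + 1) H₂ v'
  | newRef {H H₁ : FHeap K} {e v : FExp K 0} {i a : ℕ} :
      FEval H e i H₁ v → a ∉ H₁ → FEval H (.newRef e) (i + 1) (H₁.insert a v) (.loc a)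
  | deref {H H₁ : FHeap K} {e v : FExp K 0} {i a : ℕ} :
      FEval H e i H₁ (.loc a) → H₁.lookup a = some v → FEval H (.deref e) (i + 1) H₁ v
  | assign {H H₁ H₂ : FHeap K} {e₁ e₂ v : FExp K 0} {i j a : ℕ} :
      FEval H e₁ i H₁ (.loc a) → FEval H₁ e₂ j H₂ v → a ∈ H₂ →
      FEval H (.assign e₁ e₂) (i + j + 1) (H₂.insert a v) .unit

/-! ### The translation from CG to FG -/

section Translation

variable {L : Type u} {B : Type v} {K : Type w} [Lattice L] [BoundedOrder L]

/-- `(τ + unit)^ℓ`. -/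
def FTy.opt (τ : FTy L B) (ℓ : L) : FTy L B := .sum τ (.unit ⊥) ℓ

/-- The type translation. -/
def CTy.trans : CTy L B → FTy L B
  | .base b => .base b ⊥
  | .unit => .unit ⊥
  | .arrow τ₁ τ₂ => .arrow τ₁.trans ⊤ τ₂.trans ⊥
  | .prod τ₁ τ₂ => .prod τ₁.trans τ₂.trans ⊥
  | .sum τ₁ τ₂ => .sum τ₁.trans τ₂.trans ⊥
  | .ref ℓ τ => .ref (τ.trans.opt ℓ) ⊥
  | .labeled ℓ τ => τ.trans.opt ℓ
  | .comp ℓ₁ ℓ₂ τ => .arrow (.unit ⊥) ℓ₁ (τ.trans.opt ℓ₂) ⊥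

/-- The translation judgment `Γ ⊢ e : τ ⇝ e_F`, directed by CG typing derivations. -/
inductive CTrans (ty : K → B) :
    {n : ℕ} → (Fin n → CTy L B) → CExp K n → CTy L B → FExp K n → Prop
  | var {n : ℕ} {Γ : Fin n → CTy L B} (i : Fin n) : CTrans ty Γ (.var i) (Γ i) (.var i)
  | const {n : ℕ} {Γ : Fin n → CTy L B} (k : K) :
      CTrans ty Γ (.const k) (.base (ty k)) (.const k)
  | unit {n : ℕ} {Γ : Fin n → CTy L B} : CTrans ty Γ .unit .unit .unit
  | lam {n : ℕ} {Γ : Fin n → CTy L B} {e : CExp K (n + 1)} {f : FExp K (n + 1)}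
      {τ₁ τ₂ : CTy L B} :
      CTrans ty (scons τ₁ Γ) e τ₂ f → CTrans ty Γ (.lam e) (.arrow τ₁ τ₂) (.lam f)
  | app {n : ℕ} {Γ : Fin n → CTy L B} {e₁ e₂ : CExp K n} {f₁ f₂ : FExp K n}
      {τ₁ τ₂ : CTy L B} :
      CTrans ty Γ e₁ (.arrow τ₁ τ₂) f₁ → CTrans ty Γ e₂ τ₁ f₂ →
      CTrans ty Γ (.app e₁ e₂) τ₂ (.app f₁ f₂)
  | pair {n : ℕ} {Γ : Fin n → CTy L B} {e₁ e₂ : CExp K n} {f₁ f₂ : FExp K n}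
      {τ₁ τ₂ : CTy L B} :
      CTrans ty Γ e₁ τ₁ f₁ → CTrans ty Γ e₂ τ₂ f₂ →
      CTrans ty Γ (.pair e₁ e₂) (.prod τ₁ τ₂) (.pair f₁ f₂)
  | fst {n : ℕ} {Γ : Fin n → CTy L B} {e : CExp K n} {f : FExp K n} {τ₁ τ₂ : CTy L B} :
      CTrans ty Γ e (.prod τ₁ τ₂) f → CTrans ty Γ (.fst e) τ₁ (.fst f)
  | snd {n : ℕ} {Γ : Fin n → CTy L B} {e : CExp K n} {f : FExp K n} {τ₁ τ₂ : CTy L B} :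
      CTrans ty Γ e (.prod τ₁ τ₂) f → CTrans ty Γ (.snd e) τ₂ (.snd f)
  | inl {n : ℕ} {Γ : Fin n → CTy L B} {e : CExp K n} {f : FExp K n} {τ₁ τ₂ : CTy L B} :
      CTrans ty Γ e τ₁ f → CTrans ty Γ (.inl e) (.sum τ₁ τ₂) (.inl f)
  | inr {n : ℕ} {Γ : Fin n → CTy L B} {e : CExp K n} {f : FExp K n} {τ₁ τ₂ : CTy L B} :
      CTrans ty Γ e τ₂ f → CTrans ty Γ (.inr e) (.sum τ₁ τ₂) (.inr f)
  | caseOf {n : ℕ} {Γ : Fin n → CTy L B} {e : CExp K n} {e₁ e₂ : CExp K (n + 1)}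
      {f : FExp K n} {f₁ f₂ : FExp K (n + 1)} {τ₁ τ₂ τ : CTy L B} :
      CTrans ty Γ e (.sum τ₁ τ₂) f → CTrans ty (scons τ₁ Γ) e₁ τ f₁ →
      CTrans ty (scons τ₂ Γ) e₂ τ f₂ → CTrans ty Γ (.caseOf e e₁ e₂) τ (.caseOf f f₁ f₂)
  | label {n : ℕ} {Γ : Fin n → CTy L B} {e : CExp K n} {f : FExp K n} {τ : CTy L B} {ℓ : L} :
      CTrans ty Γ e τ f → CTrans ty Γ (.label e) (.labeled ℓ τ) (.inl f)
  | unlabel {n : ℕ} {Γ : Fin n → CTy L B} {e : CExp K n} {f : FExp K n} {τ : CTy L B}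
      {ℓ : L} :
      CTrans ty Γ e (.labeled ℓ τ) f → CTrans ty Γ (.unlabel e) (.comp ⊤ ℓ τ) f.thunk
  | toLabeled {n : ℕ} {Γ : Fin n → CTy L B} {e : CExp K n} {f : FExp K n} {τ : CTy L B}
      {ℓ₁ ℓ₂ : L} :
      CTrans ty Γ e (.comp ℓ₁ ℓ₂ τ) f →
      CTrans ty Γ (.toLabeled e) (.comp ℓ₁ ⊥ (.labeled ℓ₂ τ))
        (FExp.thunk (.inl (.app f .unit)))
  | ret {n : ℕ} {Γ : Fin n → CTy L B} {e : CExp K n} {f : FExp K n} {τ : CTy L B} :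
      CTrans ty Γ e τ f → CTrans ty Γ (.ret e) (.comp ⊤ ⊥ τ) (FExp.thunk (.inl f))
  | bind {n : ℕ} {Γ : Fin n → CTy L B} {e₁ : CExp K n} {e₂ : CExp K (n + 1)}
      {f₁ : FExp K n} {f₂ : FExp K (n + 1)} {τ τ' : CTy L B} {ℓ ℓ₁ ℓ₂ ℓ₃ ℓ₄ : L} :
      CTrans ty Γ e₁ (.comp ℓ₁ ℓ₂ τ) f₁ → CTrans ty (scons τ Γ) e₂ (.comp ℓ₃ ℓ₄ τ') f₂ →
      ℓ ≤ ℓ₁ → ℓ ≤ ℓ₃ → ℓ₂ ≤ ℓ₃ → ℓ₂ ≤ ℓ₄ →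
      CTrans ty Γ (.bind e₁ e₂) (.comp ℓ ℓ₄ τ')
        (FExp.thunk (.caseOf (.app f₁ .unit) (.app f₂ .unit) (.inr .unit)))
  | newRef {n : ℕ} {Γ : Fin n → CTy L B} {e : CExp K n} {f : FExp K n} {τ : CTy L B}
      {ℓ : L} :
      CTrans ty Γ e (.labeled ℓ τ) f →
      CTrans ty Γ (.newRef e) (.comp ℓ ⊥ (.ref ℓ τ)) (FExp.thunk (.inl (.newRef f)))
  | deref {n : ℕ} {Γ : Fin n → CTy L B} {e : CExp K n} {f : FExp K n} {τ : CTy L B} {ℓ : L} :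
      CTrans ty Γ e (.ref ℓ τ) f →
      CTrans ty Γ (.deref e) (.comp ⊤ ⊥ (.labeled ℓ τ)) (FExp.thunk (.inl (.deref f)))
  | assign {n : ℕ} {Γ : Fin n → CTy L B} {e₁ e₂ : CExp K n} {f₁ f₂ : FExp K n}
      {τ : CTy L B} {ℓ : L} :
      CTrans ty Γ e₁ (.ref ℓ τ) f₁ → CTrans ty Γ e₂ (.labeled ℓ τ) f₂ →
      CTrans ty Γ (.assign e₁ e₂) (.comp ℓ ⊥ .unit) (FExp.thunk (.inl (.assign f₁ f₂)))
  | sub {n : ℕ} {Γ : Fin n → CTy L B} {e : CExp K n} {f : FExp K n} {τ τ' : CTy L B} :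
      CTrans ty Γ e τ' f → CSub τ' τ → CTrans ty Γ e τ f

end Translation

/-! ### Observable results -/

/-- Ground types: those whose values hold no functions, references or computations. -/
inductive CTy.Ground {L : Type u} {B : Type v} : CTy L B → Prop
  | base (b : B) : Ground (.base b)
  | unit : Ground .unit
  | prod {τ₁ τ₂ : CTy L B} : Ground τ₁ → Ground τ₂ → Ground (.prod τ₁ τ₂)
  | sum {τ₁ τ₂ : CTy L B} : Ground τ₁ → Ground τ₂ → Ground (.sum τ₁ τ₂)
  | labeled {τ : CTy L B} {ℓ : L} : Ground τ → Ground (.labeled ℓ τ)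

/-- The CG value on the left and the FG value on the right are the same piece of data; a
labeled CG value is represented by a left injection. -/
inductive SameData {K : Type w} : CExp K 0 → FExp K 0 → Prop
  | const (k : K) : SameData (.const k) (.const k)
  | unit : SameData .unit .unit
  | pair {v₁ v₂ : CExp K 0} {w₁ w₂ : FExp K 0} :
      SameData v₁ w₁ → SameData v₂ w₂ → SameData (.pair v₁ v₂) (.pair w₁ w₂)
  | inl {v : CExp K 0} {w : FExp K 0} : SameData v w → SameData (.inl v) (.inl w)
  | inr {v : CExp K 0} {w : FExp K 0} : SameData v w → SameData (.inr v) (.inr w)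
  | label {v : CExp K 0} {w : FExp K 0} : SameData v w → SameData (.label v) (.inl w)

/-! ### Store typings and location bijections -/

/-- Partial maps from locations to types. -/
abbrev StoreTy (T : Type u) : Type u := ℕ → Option T

/-- `θ ⊑ θ'`. -/
def StoreTy.Le {T : Type u} (θ θ' : StoreTy T) : Prop := ∀ a t, θ a = some t → θ' a = some t

/-- Partial bijections between locations. -/
structure PBij where
  rel : ℕ → ℕ → Prop
  functional : ∀ {a b b' : ℕ}, rel a b → rel a b' → b = b'
  injective : ∀ {a a' b : ℕ}, rel a b → rel a' b → a = a'

/-- `β ⊆ β'`. -/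
def PBij.Le (β β' : PBij) : Prop := ∀ a b, β.rel a b → β'.rel a b

/-! ### The cross-language relation -/

section Cross

variable {L : Type u} {B : Type v} {K : Type w}

mutual

/-- The value relation across the languages, at a CG type: `CrossV ty τ θ m β v w` relates the
CG value `v` and the FG value `w` for `m` steps of the CG program, in the CG store typing `θ`
and under the correspondence `β` of CG locations to FG locations. -/
def CrossV (ty : K → B) (τ : CTy L B) (θ : StoreTy (CTy L B)) (m : ℕ) (β : PBij)
    (v : CExp K 0) (w : FExp K 0) : Prop :=
  match τ with
  | .base b => ∃ k, ty k = b ∧ v = .const k ∧ w = .const k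
  | .unit => v = .unit ∧ w = .unit
  | .arrow τ₁ τ₂ => ∃ e f, v = .lam e ∧ w = .lam f ∧
      ∀ θ' : StoreTy (CTy L B), θ.Le θ' → ∀ β' : PBij, β.Le β' → ∀ j, ∀ _hj : j < m,
        ∀ v' w', CrossV ty τ₁ θ' j β' v' w' → CrossE ty τ₂ θ' j β' (e.inst v') (f.inst w')
  | .prod τ₁ τ₂ => ∃ v₁ v₂ w₁ w₂, v = .pair v₁ v₂ ∧ w = .pair w₁ w₂ ∧
      CrossV ty τ₁ θ m β v₁ w₁ ∧ CrossV ty τ₂ θ m β v₂ w₂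
  | .sum τ₁ τ₂ =>
      (∃ v' w', v = .inl v' ∧ w = .inl w' ∧ CrossV ty τ₁ θ m β v' w') ∨
      (∃ v' w', v = .inr v' ∧ w = .inr w' ∧ CrossV ty τ₂ θ m β v' w')
  | .ref ℓ τ => ∃ a b, v = .loc a ∧ w = .loc b ∧ θ a = some (.labeled ℓ τ) ∧ β.rel a b
  | .labeled _ τ => ∃ v' w', v = .label v' ∧ w = .inl w' ∧ CrossV ty τ θ m β v' w'
  | .comp _ _ τ => CVal v ∧ FVal w ∧
      ∀ θ₁ : StoreTy (CTy L B), θ.Le θ₁ → ∀ β₁ : PBij, β.Le β₁ → ∀ k, ∀ _hk : k ≤ m,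
        ∀ (Hs : CHeap K) (Ht : FHeap K), CrossH ty k Hs Ht θ₁ β₁ →
        ∀ i (Hs' : CHeap K) v', i < k → CForce Hs v i Hs' v' →
        ∃ (i' : ℕ) (Ht' : FHeap K) (w' : FExp K 0), FEval Ht (.app w .unit) i' Ht' (.inl w') ∧
        ∃ (θ₂ : StoreTy (CTy L B)) (β₂ : PBij), θ₁.Le θ₂ ∧ β₁.Le β₂ ∧
          CrossH ty (k - i) Hs' Ht' θ₂ β₂ ∧ CrossV ty τ θ₂ (k - i) β₂ v' w'
termination_by (m, sizeOf τ, 0)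
decreasing_by
  all_goals simp_wf
  all_goals first
    | (apply Prod.Lex.left; omega)
    | (apply Prod.Lex.right; apply Prod.Lex.left; omega)
    | (rcases Nat.lt_or_ge (k - i) m with h | h
       · exact Prod.Lex.left _ _ h
       · have h' : k - i = m := by omega
         rw [h']; apply Prod.Lex.right; apply Prod.Lex.left; omega)
    | (rcases Nat.lt_or_ge k m with h | h
       · exact Prod.Lex.left _ _ h
       · have h' : k = m := by omega
         rw [h']; apply Prod.Lex.right; apply Prod.Lex.left; omega)

/-- The expression relation across the languages. Evaluation of CG terms is pure, and so the
FG term has to evaluate without a change of the heap; effects appear only when computations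
are run, in the value relation at the types `comp`. -/
def CrossE (ty : K → B) (τ : CTy L B) (θ : StoreTy (CTy L B)) (n : ℕ) (β : PBij)
    (e : CExp K 0) (f : FExp K 0) : Prop :=
  ∀ (Ht : FHeap K) (i : ℕ) (v : CExp K 0), i < n → CEval e i v →
    ∃ (i' : ℕ) (w : FExp K 0), FEval Ht f i' Ht w ∧ CrossV ty τ θ (n - i) β v w
termination_by (n, sizeOf τ, 1)
decreasing_by
  rcases Nat.lt_or_ge (n - i) n with h | h
  · exact Prod.Lex.left _ _ h
  · have h' : n - i = n := by omega
    rw [h']; apply Prod.Lex.right; apply Prod.Lex.right; omega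

/-- The heap relation `(n, Hs, Ht) ▷ (θ, β)`: corresponding locations hold values that are
related for fewer than `n` steps, at the type that `θ` gives. -/
def CrossH (ty : K → B) (n : ℕ) (Hs : CHeap K) (Ht : FHeap K) (θ : StoreTy (CTy L B))
    (β : PBij) : Prop :=
  (∀ a t, θ a = some t → a ∈ Hs) ∧
  ∀ a b, β.rel a b → ∃ t v w, θ a = some t ∧ Hs.lookup a = some v ∧ Ht.lookup b = some w ∧
    ∀ j, ∀ _hj : j < n, CrossV ty t θ j β v w
termination_by (n, 0, 0)
decreasing_by
  apply Prod.Lex.left; omega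

end

end Cross

/-! ### The unary model of FG -/

section Unary

variable {L : Type u} {B : Type v} {K : Type w} [Lattice L]

mutual

/-- The unary value relation of FG; it ignores the outer label. -/
def UnV (ty : K → B) (τ : FTy L B) (θ : StoreTy (FTy L B)) (m : ℕ) (v : FExp K 0) : Prop :=
  match τ with
  | .base b _ => ∃ k, ty k = b ∧ v = .const k
  | .unit _ => v = .unit
  | .arrow τ₁ ℓe τ₂ _ => ∃ e, v = .lam e ∧
      ∀ θ' : StoreTy (FTy L B), θ.Le θ' → ∀ j, ∀ _hj : j < m, ∀ v',
        UnV ty τ₁ θ' j v' → UnE ty ℓe τ₂ θ' j (e.inst v')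
  | .prod τ₁ τ₂ _ => ∃ v₁ v₂, v = .pair v₁ v₂ ∧ UnV ty τ₁ θ m v₁ ∧ UnV ty τ₂ θ m v₂
  | .sum τ₁ τ₂ _ =>
      (∃ v', v = .inl v' ∧ UnV ty τ₁ θ m v') ∨ (∃ v', v = .inr v' ∧ UnV ty τ₂ θ m v')
  | .ref τ _ => ∃ a, v = .loc a ∧ θ a = some τ
termination_by (m, sizeOf τ, 0)
decreasing_by
  all_goals simp_wf
  all_goals first
    | (apply Prod.Lex.left; omega)
    | (apply Prod.Lex.right; apply Prod.Lex.left; omega)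

/-- The unary expression relation of FG at a pc-label: a run that takes fewer than `n` steps
ends in a good heap with a good value, changes a location known to `θ` only if its type is
labeled `pc` or above, and gives new locations such types only. -/
def UnE (ty : K → B) (pc : L) (τ : FTy L B) (θ : StoreTy (FTy L B)) (n : ℕ) (e : FExp K 0) :
    Prop :=
  ∀ (H : FHeap K) (i : ℕ) (H' : FHeap K) (v : FExp K 0),
    UnH ty n H θ → i < n → FEval H e i H' v →
    ∃ θ' : StoreTy (FTy L B), θ.Le θ' ∧ UnH ty (n - i) H' θ' ∧ UnV ty τ θ' (n - i) v ∧
      (∀ a t, θ a = some t → H.lookup a ≠ H'.lookup a → pc ≤ t.lab) ∧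
      (∀ a t, θ a = none → θ' a = some t → pc ≤ t.lab)
termination_by (n, sizeOf τ, 1)
decreasing_by
  · apply Prod.Lex.right
    rcases Nat.eq_zero_or_pos (sizeOf τ) with h | h
    · rw [h]; apply Prod.Lex.right; omega
    · apply Prod.Lex.left; omega
  · rcases Nat.lt_or_ge (n - i) n with h | h
    · exact Prod.Lex.left _ _ h
    · have h' : n - i = n := by omega
      rw [h']; apply Prod.Lex.right
      rcases Nat.eq_zero_or_pos (sizeOf τ) with h | h
      · rw [h]; apply Prod.Lex.right; omega
      · apply Prod.Lex.left; omega
  · rcases Nat.lt_or_ge (n - i) n with h | h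
    · exact Prod.Lex.left _ _ h
    · have h' : n - i = n := by omega
      rw [h']; apply Prod.Lex.right; apply Prod.Lex.right; omega

/-- The unary heap relation `(n, H) ▷ θ`. -/
def UnH (ty : K → B) (n : ℕ) (H : FHeap K) (θ : StoreTy (FTy L B)) : Prop :=
  ∀ a t, θ a = some t → ∃ v, H.lookup a = some v ∧ ∀ j, ∀ _hj : j < n, UnV ty t θ j v
termination_by (n, 0, 0)
decreasing_by
  apply Prod.Lex.left; omega

end

end Unary

/-! ### The binary model of FG -/

/-- Worlds of the binary model: a store typing for each of the two runs and a partial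
bijection between the locations of the two runs that an observer can see as equal. -/
structure World (L : Type u) (B : Type v) where
  θ₁ : StoreTy (FTy L B)
  θ₂ : StoreTy (FTy L B)
  β : PBij

/-- `W ⊑ W'`. -/
def World.Le {L : Type u} {B : Type v} (W W' : World L B) : Prop :=
  W.θ₁.Le W'.θ₁ ∧ W.θ₂.Le W'.θ₂ ∧ W.β.Le W'.β

section Binary

variable {L : Type u} {B : Type v} {K : Type w} [Lattice L]

mutual

/-- The binary value relation of FG for an observer at level `A`: at a type labeled `A` or
below it relates equal-looking values, and at any other type it relates any two values
that are good in the unary sense. -/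
def BinV (ty : K → B) (A : L) (τ : FTy L B) (W : World L B) (n : ℕ) (v₁ v₂ : FExp K 0) :
    Prop :=
  (¬ τ.lab ≤ A → UnV ty τ W.θ₁ n v₁ ∧ UnV ty τ W.θ₂ n v₂) ∧
  (τ.lab ≤ A →
    match τ with
    | .base b _ => ∃ k, ty k = b ∧ v₁ = .const k ∧ v₂ = .const k
    | .unit _ => v₁ = .unit ∧ v₂ = .unit
    | .arrow τ₁ ℓe τ₂ ℓ => ∃ e₁ e₂, v₁ = .lam e₁ ∧ v₂ = .lam e₂ ∧
        (∀ W' : World L B, W.Le W' → ∀ j, ∀ _hj : j < n, ∀ u₁ u₂,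
          BinV ty A τ₁ W' j u₁ u₂ → BinE ty A τ₂ W' j (e₁.inst u₁) (e₂.inst u₂)) ∧
        UnV ty (.arrow τ₁ ℓe τ₂ ℓ) W.θ₁ n v₁ ∧ UnV ty (.arrow τ₁ ℓe τ₂ ℓ) W.θ₂ n v₂
    | .prod τ₁ τ₂ _ => ∃ u₁ u₁' u₂ u₂', v₁ = .pair u₁ u₁' ∧ v₂ = .pair u₂ u₂' ∧
        BinV ty A τ₁ W n u₁ u₂ ∧ BinV ty A τ₂ W n u₁' u₂'
    | .sum τ₁ τ₂ _ =>
        (∃ u₁ u₂, v₁ = .inl u₁ ∧ v₂ = .inl u₂ ∧ BinV ty A τ₁ W n u₁ u₂) ∨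
        (∃ u₁ u₂, v₁ = .inr u₁ ∧ v₂ = .inr u₂ ∧ BinV ty A τ₂ W n u₁ u₂)
    | .ref τ _ => ∃ a₁ a₂, v₁ = .loc a₁ ∧ v₂ = .loc a₂ ∧ W.β.rel a₁ a₂ ∧
        W.θ₁ a₁ = some τ ∧ W.θ₂ a₂ = some τ)
termination_by (n, sizeOf τ, 0)
decreasing_by
  all_goals simp_wf
  all_goals first
    | (apply Prod.Lex.left; omega)
    | (apply Prod.Lex.right; apply Prod.Lex.left; omega)

/-- The binary expression relation of FG: two terminating runs that together take fewer than
`n` steps and start in related heaps end in related heaps with related values. -/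
def BinE (ty : K → B) (A : L) (τ : FTy L B) (W : World L B) (n : ℕ) (e₁ e₂ : FExp K 0) :
    Prop :=
  ∀ (H₁ H₂ : FHeap K) (i j : ℕ) (H₁' H₂' : FHeap K) (v₁ v₂ : FExp K 0),
    BinH ty A n H₁ H₂ W → i + j < n → FEval H₁ e₁ i H₁' v₁ → FEval H₂ e₂ j H₂' v₂ →
    ∃ W' : World L B, W.Le W' ∧ BinH ty A (n - (i + j)) H₁' H₂' W' ∧
      BinV ty A τ W' (n - (i + j)) v₁ v₂
termination_by (n, sizeOf τ, 1)
decreasing_by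
  · apply Prod.Lex.right
    rcases Nat.eq_zero_or_pos (sizeOf τ) with h | h
    · rw [h]; apply Prod.Lex.right; omega
    · apply Prod.Lex.left; omega
  · rcases Nat.lt_or_ge (n - (i + j)) n with h | h
    · exact Prod.Lex.left _ _ h
    · have h' : n - (i + j) = n := by omega
      rw [h']; apply Prod.Lex.right
      rcases Nat.eq_zero_or_pos (sizeOf τ) with h | h
      · rw [h]; apply Prod.Lex.right; omega
      · apply Prod.Lex.left; omega
  · rcases Nat.lt_or_ge (n - (i + j)) n with h | h
    · exact Prod.Lex.left _ _ h
    · have h' : n - (i + j) = n := by omega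
      rw [h']; apply Prod.Lex.right; apply Prod.Lex.right; omega

/-- The binary heap relation `(n, H₁, H₂) ▷ W`. -/
def BinH (ty : K → B) (A : L) (n : ℕ) (H₁ H₂ : FHeap K) (W : World L B) : Prop :=
  UnH ty n H₁ W.θ₁ ∧ UnH ty n H₂ W.θ₂ ∧
  ∀ a₁ a₂, W.β.rel a₁ a₂ → ∃ t v₁ v₂, W.θ₁ a₁ = some t ∧ W.θ₂ a₂ = some t ∧
    H₁.lookup a₁ = some v₁ ∧ H₂.lookup a₂ = some v₂ ∧
    ∀ j, ∀ _hj : j < n, BinV ty A t W j v₁ v₂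
termination_by (n, 0, 0)
decreasing_by
  apply Prod.Lex.left; omega

end

end Binary

end IFC

open IFC

/-!
The translation commutes with typing because CG evaluation is pure: a translated term is typed in
FG at the pc-label `⊤`, and all effects sit in the bodies of thunks, whose pc-labels come from
the monadic types. The translated term depends on the CG term only, not on the typing derivation;
it is `CExp.translate`.

The three fundamental theorems are proved by induction on typing (or translation) derivations,
from the monotonicity of the value relations in worlds and step indices and from their closure
under subtyping. In the cross-language relation (`CTrans.crossE`) one needs to consider, at a
monadic type, only the body of the thunk (`crossE_thunk`), and sequencing is `CrossE.run`. In the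
unary model (`FTyped.unE`) the effect of a run is described by `Confined`: old locations that
change and new locations have types labeled at the pc-label or above. In the binary model
(`FTyped.binE`) related runs stay in step until a secret is eliminated. From then on they may
differ, but the typing rules make the pc-label and the label of the result unobservable, and the
unary theorem for each run yields the relation of the two (`BinE.of_unE`): a location whose
contents change has a type at which the observer relates any two good values
(`BinH.of_confined`).

Noninterference for CG (`noninterference`) is read off from FG. Each CG run is simulated by an FG
run from the empty heap, with the secret input replaced by an FG counterpart
(`CTyped.exists_crossV`), which is good in the unary sense. At a level that must not learn the
secret any two good values are related, and so the binary fundamental theorem relates the two FG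
results, which are booleans visible at that level and hence equal; the cross-language relation
carries this back to the CG results.
-/

namespace IFC

/-! ### Substitution -/

section Substitution

variable {K : Type*}

@[simp] theorem scons_succ {α : Type*} {n : ℕ} (a : α) (f : Fin n → α) (i : Fin n) :
    scons a f i.succ = f i := rfl

@[simp] theorem liftRen_succ {n m : ℕ} (ρ : Fin n → Fin m) (i : Fin n) :
    liftRen ρ i.succ = (ρ i).succ := rfl

theorem liftRen_comp {n m k : ℕ} (ρ : Fin n → Fin m) (ρ' : Fin m → Fin k) :
    (fun i => liftRen ρ' (liftRen ρ i)) = liftRen (fun i => ρ' (ρ i)) :=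
  funext <| Fin.cases rfl fun _ => rfl

namespace CExp

theorem rename_rename {n m k : ℕ} (e : CExp K n) (ρ : Fin n → Fin m) (ρ' : Fin m → Fin k) :
    (e.rename ρ).rename ρ' = e.rename (fun i => ρ' (ρ i)) := by
  induction e generalizing m k <;> simp only [rename, liftRen_comp, *]

theorem lift_comp_liftRen {n m k : ℕ} (ρ : Fin n → Fin m) (σ : Fin m → CExp K k) :
    (fun i => lift σ (liftRen ρ i)) = lift (fun i => σ (ρ i)) :=
  funext <| Fin.cases rfl fun _ => rfl

theorem subst_rename {n m k : ℕ} (e : CExp K n) (ρ : Fin n → Fin m) (σ : Fin m → CExp K k) :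
    (e.rename ρ).subst σ = e.subst (fun i => σ (ρ i)) := by
  induction e generalizing m k <;> simp only [rename, subst, lift_comp_liftRen, *]

theorem rename_lift {n m k : ℕ} (σ : Fin n → CExp K m) (ρ : Fin m → Fin k) :
    (fun i => (lift σ i).rename (liftRen ρ)) = lift (fun i => (σ i).rename ρ) :=
  funext <| Fin.cases rfl fun i => by simp [lift, rename_rename]

theorem rename_subst {n m k : ℕ} (e : CExp K n) (σ : Fin n → CExp K m) (ρ : Fin m → Fin k) :
    (e.subst σ).rename ρ = e.subst (fun i => (σ i).rename ρ) := by
  induction e generalizing m k <;> simp only [rename, subst, rename_lift, *]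

theorem subst_lift {n m k : ℕ} (σ : Fin n → CExp K m) (σ' : Fin m → CExp K k) :
    (fun i => (lift σ i).subst (lift σ')) = lift (fun i => (σ i).subst σ') :=
  funext <| Fin.cases rfl fun i => by simp [lift, rename_subst, subst_rename]

theorem subst_subst {n m k : ℕ} (e : CExp K n) (σ : Fin n → CExp K m) (σ' : Fin m → CExp K k) :
    (e.subst σ).subst σ' = e.subst (fun i => (σ i).subst σ') := by
  induction e generalizing m k <;> simp only [subst, subst_lift, *]

theorem lift_var {n : ℕ} : lift (var : Fin n → CExp K n) = var :=
  funext <| Fin.cases rfl fun _ => rfl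

theorem subst_var {n : ℕ} (e : CExp K n) : e.subst var = e := by
  induction e <;> simp only [subst, lift_var, *]

theorem subst_closed (e : CExp K 0) (σ : Fin 0 → CExp K 0) : e.subst σ = e := by
  rw [Subsingleton.elim σ var, subst_var]

/-- Substituting under a binder and then instantiating the bound variable is one simultaneous
substitution. This turns the body of a substituted abstraction into an instance of the induction
hypothesis for the body. -/
theorem inst_subst_lift {n m : ℕ} (e : CExp K (n + 1)) (σ : Fin n → CExp K m) (v : CExp K m) :
    (e.subst (lift σ)).inst v = e.subst (scons v σ) := by
  rw [inst, subst_subst]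
  congr 1
  exact funext <| Fin.cases rfl fun i => by simp [lift, subst_rename, subst_var]

end CExp

namespace FExp

theorem rename_rename {n m k : ℕ} (e : FExp K n) (ρ : Fin n → Fin m) (ρ' : Fin m → Fin k) :
    (e.rename ρ).rename ρ' = e.rename (fun i => ρ' (ρ i)) := by
  induction e generalizing m k <;> simp only [rename, liftRen_comp, *]

theorem lift_comp_liftRen {n m k : ℕ} (ρ : Fin n → Fin m) (σ : Fin m → FExp K k) :
    (fun i => lift σ (liftRen ρ i)) = lift (fun i => σ (ρ i)) :=
  funext <| Fin.cases rfl fun _ => rfl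

theorem subst_rename {n m k : ℕ} (e : FExp K n) (ρ : Fin n → Fin m) (σ : Fin m → FExp K k) :
    (e.rename ρ).subst σ = e.subst (fun i => σ (ρ i)) := by
  induction e generalizing m k <;> simp only [rename, subst, lift_comp_liftRen, *]

theorem rename_lift {n m k : ℕ} (σ : Fin n → FExp K m) (ρ : Fin m → Fin k) :
    (fun i => (lift σ i).rename (liftRen ρ)) = lift (fun i => (σ i).rename ρ) :=
  funext <| Fin.cases rfl fun i => by simp [lift, rename_rename]

theorem rename_subst {n m k : ℕ} (e : FExp K n) (σ : Fin n → FExp K m) (ρ : Fin m → Fin k) :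
    (e.subst σ).rename ρ = e.subst (fun i => (σ i).rename ρ) := by
  induction e generalizing m k <;> simp only [rename, subst, rename_lift, *]

theorem subst_lift {n m k : ℕ} (σ : Fin n → FExp K m) (σ' : Fin m → FExp K k) :
    (fun i => (lift σ i).subst (lift σ')) = lift (fun i => (σ i).subst σ') :=
  funext <| Fin.cases rfl fun i => by simp [lift, rename_subst, subst_rename]

theorem subst_subst {n m k : ℕ} (e : FExp K n) (σ : Fin n → FExp K m) (σ' : Fin m → FExp K k) :
    (e.subst σ).subst σ' = e.subst (fun i => (σ i).subst σ') := by
  induction e generalizing m k <;> simp only [subst, subst_lift, *]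

theorem lift_var {n : ℕ} : lift (var : Fin n → FExp K n) = var :=
  funext <| Fin.cases rfl fun _ => rfl

theorem subst_var {n : ℕ} (e : FExp K n) : e.subst var = e := by
  induction e <;> simp only [subst, lift_var, *]

theorem subst_closed (e : FExp K 0) (σ : Fin 0 → FExp K 0) : e.subst σ = e := by
  rw [Subsingleton.elim σ var, subst_var]

/-- Substituting under a binder and then instantiating the bound variable is one simultaneous
substitution. This turns the body of a substituted abstraction into an instance of the induction
hypothesis for the body. -/
theorem inst_subst_lift {n m : ℕ} (e : FExp K (n + 1)) (σ : Fin n → FExp K m) (v : FExp K m) :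
    (e.subst (lift σ)).inst v = e.subst (scons v σ) := by
  rw [inst, subst_subst]
  congr 1
  exact funext <| Fin.cases rfl fun i => by simp [lift, subst_rename, subst_var]

theorem thunk_subst {n m : ℕ} (e : FExp K n) (σ : Fin n → FExp K m) :
    e.thunk.subst σ = (e.subst σ).thunk := by
  simp only [thunk, subst, subst_rename, rename_subst]
  rfl

theorem inst_rename_succ {n : ℕ} (e : FExp K n) (v : FExp K n) :
    (e.rename Fin.succ).inst v = e := by
  simp only [inst, subst_rename, scons_succ]
  exact subst_var e

end FExp

end Substitution

/-! ### Evaluation of values -/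

section Values

variable {K : Type*}

/-- Values of compound form still take steps to evaluate to themselves. -/
theorem CVal.exists_eval {v : CExp K 0} (h : CVal v) : ∃ i, CEval v i v := by
  induction h with
  | const k => exact ⟨_, .const k⟩
  | unit => exact ⟨_, .unit⟩
  | loc a => exact ⟨_, .loc a⟩
  | lam e => exact ⟨_, .lam e⟩
  | pair _ _ ih₁ ih₂ => exact ⟨_, .pair ih₁.choose_spec ih₂.choose_spec⟩
  | inl _ ih => exact ⟨_, .inl ih.choose_spec⟩
  | inr _ ih => exact ⟨_, .inr ih.choose_spec⟩
  | label _ ih => exact ⟨_, .label ih.choose_spec⟩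
  | unlabel e => exact ⟨_, .unlabel e⟩
  | toLabeled e => exact ⟨_, .toLabeled e⟩
  | ret e => exact ⟨_, .ret e⟩
  | bind e₁ e₂ => exact ⟨_, .bind e₁ e₂⟩
  | newRef e => exact ⟨_, .newRef e⟩
  | deref e => exact ⟨_, .deref e⟩
  | assign e₁ e₂ => exact ⟨_, .assign e₁ e₂⟩

theorem CVal.eq_of_eval {v v' : CExp K 0} {i : ℕ} (h : CVal v) (he : CEval v i v') : v' = v := by
  induction h generalizing i v' with
  | pair _ _ ih₁ ih₂ => cases he with | pair h₁ h₂ => rw [ih₁ h₁, ih₂ h₂]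
  | inl _ ih => cases he with | inl h => rw [ih h]
  | inr _ ih => cases he with | inr h => rw [ih h]
  | label _ ih => cases he with | label h => rw [ih h]
  | _ => cases he; rfl

theorem FVal.exists_eval {v : FExp K 0} (h : FVal v) : ∃ i, ∀ H, FEval H v i H v := by
  induction h with
  | const k => exact ⟨_, fun _ => .const k⟩
  | unit => exact ⟨_, fun _ => .unit⟩
  | loc a => exact ⟨_, fun _ => .loc a⟩
  | lam e => exact ⟨_, fun _ => .lam e⟩
  | pair _ _ ih₁ ih₂ => exact ⟨_, fun H => .pair (ih₁.choose_spec H) (ih₂.choose_spec H)⟩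
  | inl _ ih => exact ⟨_, fun H => .inl (ih.choose_spec H)⟩
  | inr _ ih => exact ⟨_, fun H => .inr (ih.choose_spec H)⟩

theorem FVal.eq_of_eval {v v' : FExp K 0} {i : ℕ} {H H' : FHeap K} (h : FVal v)
    (he : FEval H v i H' v') : H' = H ∧ v' = v := by
  induction h generalizing i v' H H' with
  | pair _ _ ih₁ ih₂ =>
    cases he with
    | pair h₁ h₂ =>
      obtain ⟨rfl, rfl⟩ := ih₁ h₁
      obtain ⟨rfl, rfl⟩ := ih₂ h₂
      exact ⟨rfl, rfl⟩
  | inl _ ih => cases he with | inl h => obtain ⟨rfl, rfl⟩ := ih h; exact ⟨rfl, rfl⟩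
  | inr _ ih => cases he with | inr h => obtain ⟨rfl, rfl⟩ := ih h; exact ⟨rfl, rfl⟩
  | _ => cases he; exact ⟨rfl, rfl⟩

/-- The function part of an application may be replaced by its value. -/
theorem FEval.app_of_fun_eval {H₀ H₁ H₂ : FHeap K} {f w u v : FExp K 0} {i j : ℕ} (hw : FVal w)
    (hf : FEval H₀ f i H₁ w) (ha : FEval H₁ (.app w u) j H₂ v) :
    ∃ k, FEval H₀ (.app f u) k H₂ v := by
  cases ha with
  | app h₁ h₂ h₃ =>
    obtain ⟨rfl, rfl⟩ := hw.eq_of_eval h₁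
    exact ⟨_, .app hf h₂ h₃⟩

/-- Applying a thunk to `()` runs its body. -/
theorem FEval.thunk_app {H H' : FHeap K} {f v : FExp K 0} {i : ℕ} (h : FEval H f i H' v) :
    ∃ j, FEval H (.app f.thunk .unit) j H' v :=
  ⟨_, .app (.lam _) .unit (by rwa [FExp.inst_rename_succ])⟩

end Values

/-! ### The translation preserves typing -/

section Translation

variable {L : Type*} {B : Type*} {K : Type*}

/-- The translation as a function on terms: the translation of a well-typed term does not depend
on its type. Locations, which are ill-typed, get a dummy value. -/
def CExp.translate : {n : ℕ} → CExp K n → FExp K n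
  | _, .var i => .var i
  | _, .const k => .const k
  | _, .unit => .unit
  | _, .loc _ => .unit
  | _, .lam e => .lam e.translate
  | _, .app e₁ e₂ => .app e₁.translate e₂.translate
  | _, .pair e₁ e₂ => .pair e₁.translate e₂.translate
  | _, .fst e => .fst e.translate
  | _, .snd e => .snd e.translate
  | _, .inl e => .inl e.translate
  | _, .inr e => .inr e.translate
  | _, .caseOf e e₁ e₂ => .caseOf e.translate e₁.translate e₂.translate
  | _, .label e => .inl e.translate
  | _, .unlabel e => e.translate.thunk
  | _, .toLabeled e => FExp.thunk (.inl (.app e.translate .unit))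
  | _, .ret e => FExp.thunk (.inl e.translate)
  | _, .bind e₁ e₂ =>
      FExp.thunk (.caseOf (.app e₁.translate .unit) (.app e₂.translate .unit) (.inr .unit))
  | _, .newRef e => FExp.thunk (.inl (.newRef e.translate))
  | _, .deref e => FExp.thunk (.inl (.deref e.translate))
  | _, .assign e₁ e₂ => FExp.thunk (.inl (.assign e₁.translate e₂.translate))

variable [Lattice L]

theorem FSub.refl (τ : FTy L B) : FSub τ τ := by
  induction τ with
  | base => exact .base le_rfl
  | unit => exact .unit le_rfl
  | arrow _ _ _ _ ih₁ ih₂ => exact .arrow ih₁ ih₂ le_rfl le_rfl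
  | prod _ _ _ ih₁ ih₂ => exact .prod ih₁ ih₂ le_rfl
  | sum _ _ _ ih₁ ih₂ => exact .sum ih₁ ih₂ le_rfl
  | ref => exact .ref le_rfl

variable [BoundedOrder L] {ty : K → B}

theorem CTrans.eq_translate {n : ℕ} {Γ : Fin n → CTy L B} {e : CExp K n} {τ : CTy L B}
    {f : FExp K n} (h : CTrans ty Γ e τ f) : f = e.translate := by
  induction h <;> simp only [CExp.translate, *]

theorem CTyped.translate {n : ℕ} {Γ : Fin n → CTy L B} {e : CExp K n} {τ : CTy L B}
    (h : CTyped ty Γ e τ) : CTrans ty Γ e τ e.translate := by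
  induction h with
  | var i => exact .var i
  | const k => exact .const k
  | unit => exact .unit
  | lam _ ih => exact .lam ih
  | app _ _ ih₁ ih₂ => exact .app ih₁ ih₂
  | pair _ _ ih₁ ih₂ => exact .pair ih₁ ih₂
  | fst _ ih => exact .fst ih
  | snd _ ih => exact .snd ih
  | inl _ ih => exact .inl ih
  | inr _ ih => exact .inr ih
  | caseOf _ _ _ ih ih₁ ih₂ => exact .caseOf ih ih₁ ih₂
  | label _ ih => exact .label ih
  | unlabel _ ih => exact .unlabel ih
  | toLabeled _ ih => exact .toLabeled ih
  | ret _ ih => exact .ret ih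
  | bind _ _ h₁ h₂ h₃ h₄ ih₁ ih₂ => exact .bind ih₁ ih₂ h₁ h₂ h₃ h₄
  | newRef _ ih => exact .newRef ih
  | deref _ ih => exact .deref ih
  | assign _ _ ih₁ ih₂ => exact .assign ih₁ ih₂
  | sub _ hs ih => exact .sub ih hs

theorem CSub.trans_sub {τ τ' : CTy L B} (h : CSub τ τ') : FSub τ.trans τ'.trans := by
  induction h with
  | refl τ => exact .refl _
  | arrow _ _ ih₁ ih₂ => exact .arrow ih₁ ih₂ le_rfl le_rfl
  | prod _ _ ih₁ ih₂ => exact .prod ih₁ ih₂ le_rfl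
  | sum _ _ ih₁ ih₂ => exact .sum ih₁ ih₂ le_rfl
  | labeled _ hl ih => exact .sum ih (.refl _) hl
  | comp _ h₁ h₂ ih => exact .arrow (.refl _) (.sum ih (.refl _) h₂) h₁ le_rfl

theorem FTyped.rename {n m : ℕ} {Γ : Fin n → FTy L B} {pc : L} {e : FExp K n} {τ : FTy L B}
    (h : FTyped ty Γ pc e τ) (Δ : Fin m → FTy L B) (ρ : Fin n → Fin m)
    (hρ : ∀ i, Δ (ρ i) = Γ i) : FTyped ty Δ pc (e.rename ρ) τ := by
  have lift {n m : ℕ} {Γ : Fin n → FTy L B} {Δ : Fin m → FTy L B} {ρ : Fin n → Fin m}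
      (hρ : ∀ i, Δ (ρ i) = Γ i) (τ : FTy L B) :
      ∀ i, scons τ Δ (liftRen ρ i) = scons τ Γ i := Fin.cases rfl hρ
  induction h generalizing m with
  | var i => rw [← hρ i]; exact .var _
  | const k => exact .const k
  | unit => exact .unit
  | lam _ ih => exact .lam (ih _ _ (lift hρ _))
  | app _ _ h₁ h₂ ih₁ ih₂ => exact .app (ih₁ _ _ hρ) (ih₂ _ _ hρ) h₁ h₂
  | pair _ _ ih₁ ih₂ => exact .pair (ih₁ _ _ hρ) (ih₂ _ _ hρ)
  | fst _ h ih => exact .fst (ih _ _ hρ) h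
  | snd _ h ih => exact .snd (ih _ _ hρ) h
  | inl _ ih => exact .inl (ih _ _ hρ)
  | inr _ ih => exact .inr (ih _ _ hρ)
  | caseOf _ _ _ h ih ih₁ ih₂ =>
    exact .caseOf (ih _ _ hρ) (ih₁ _ _ (lift hρ _)) (ih₂ _ _ (lift hρ _)) h
  | newRef _ h ih => exact .newRef (ih _ _ hρ) h
  | deref _ h₁ h₂ ih => exact .deref (ih _ _ hρ) h₁ h₂
  | assign _ _ h ih₁ ih₂ => exact .assign (ih₁ _ _ hρ) (ih₂ _ _ hρ) h
  | sub _ h₁ h₂ ih => exact .sub (ih _ _ hρ) h₁ h₂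

theorem FTyped.thunk {n : ℕ} {Γ : Fin n → FTy L B} {pc ℓe : L} {e : FExp K n} {τ : FTy L B}
    (h : FTyped ty Γ ℓe e τ) : FTyped ty Γ pc e.thunk (.arrow (.unit ⊥) ℓe τ ⊥) :=
  .lam (h.rename _ _ fun _ => rfl)

/-- Running a translated computation is well-typed at its pc-label. -/
theorem FTyped.run {n : ℕ} {Γ : Fin n → FTy L B} {pc ℓe : L} {e : FExp K n} {τ : FTy L B}
    (h : FTyped ty Γ ⊤ e (.arrow (.unit ⊥) ℓe τ ⊥)) (hpc : pc ≤ ℓe) :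
    FTyped ty Γ pc (.app e .unit) τ :=
  .app (.sub h le_top (.refl _)) .unit (by simpa using hpc) bot_le

theorem trans_scons {n : ℕ} (τ : CTy L B) (Γ : Fin n → CTy L B) :
    (fun i => (scons τ Γ i).trans) = scons τ.trans (fun i => (Γ i).trans) :=
  funext <| Fin.cases rfl fun _ => rfl

/-- A translated term is typed at the highest pc-label: evaluating a CG term has no effect, and
effects happen only in the bodies of thunks, whose pc-labels come from the monadic types. -/
theorem CTrans.typed {n : ℕ} {Γ : Fin n → CTy L B} {e : CExp K n} {τ : CTy L B}
    {f : FExp K n} (h : CTrans ty Γ e τ f) :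
    FTyped ty (fun i => (Γ i).trans) ⊤ f τ.trans := by
  induction h with
  | var i => exact .var (Γ := fun i => (_ : CTy L B).trans) i
  | const k => exact .const k
  | unit => exact .unit
  | lam _ ih => rw [trans_scons] at ih; exact .lam ih
  | app _ _ ih₁ ih₂ => exact .app ih₁ ih₂ (by simp) bot_le
  | pair _ _ ih₁ ih₂ => exact .pair ih₁ ih₂
  | fst _ ih => exact .fst ih bot_le
  | snd _ ih => exact .snd ih bot_le
  | inl _ ih => exact .inl ih
  | inr _ ih => exact .inr ih
  | caseOf _ _ _ ih ih₁ ih₂ =>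
    rw [trans_scons] at ih₁ ih₂
    exact .caseOf ih (by simpa using ih₁) (by simpa using ih₂) bot_le
  | label _ ih => exact .sub (.inl ih) le_rfl (.sum (.refl _) (.refl _) bot_le)
  | unlabel _ ih => exact .thunk ih
  | toLabeled _ ih => exact .thunk (.inl (.run ih le_rfl))
  | ret _ ih => exact .thunk (.inl ih)
  | bind _ _ h₁ h₂ h₃ h₄ ih₁ ih₂ =>
    rw [trans_scons] at ih₂
    exact .thunk (.caseOf (.run ih₁ h₁) (.run ih₂ (sup_le h₂ h₃))
      (.sub (.inr .unit) le_rfl (.sum (.refl _) (.refl _) bot_le)) h₄)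
  | newRef _ ih => exact .thunk (.inl (.newRef (.sub ih le_top (.refl _)) le_rfl))
  | deref _ ih => exact .thunk (.inl (.deref ih (.refl _) bot_le))
  | assign _ _ ih₁ ih₂ =>
    exact .thunk (.inl (.assign (.sub ih₁ le_top (.refl _)) (.sub ih₂ le_top (.refl _))
      (sup_le le_rfl bot_le)))
  | sub _ hs ih => exact .sub ih le_rfl hs.trans_sub

end Translation

/-! ### Store typings, partial bijections and fresh locations -/

section Worlds

variable {T : Type*}

theorem StoreTy.Le.refl (θ : StoreTy T) : θ.Le θ := fun _ _ h => h

theorem StoreTy.Le.trans {θ θ' θ'' : StoreTy T} (h : θ.Le θ') (h' : θ'.Le θ'') : θ.Le θ'' :=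
  fun a t ha => h' a t (h a t ha)

theorem StoreTy.le_update {θ : StoreTy T} {a : ℕ} (h : θ a = none) (t : T) :
    θ.Le (Function.update θ a (some t)) := by
  intro b s hb
  rwa [Function.update_of_ne]
  rintro rfl
  simp [h] at hb

theorem PBij.Le.refl (β : PBij) : β.Le β := fun _ _ h => h

theorem PBij.Le.trans {β β' β'' : PBij} (h : β.Le β') (h' : β'.Le β'') : β.Le β'' :=
  fun a b hab => h' a b (h a b hab)

/-- The partial bijection with no pairs. -/
def PBij.empty : PBij where
  rel _ _ := False
  functional h := h.elim
  injective h := h.elim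

/-- Extension of a partial bijection by a pair of fresh locations. -/
def PBij.insert (β : PBij) (a b : ℕ) (ha : ∀ b', ¬ β.rel a b') (hb : ∀ a', ¬ β.rel a' b) :
    PBij where
  rel a' b' := (a' = a ∧ b' = b) ∨ β.rel a' b'
  functional := by
    rintro x y y' (⟨rfl, rfl⟩ | h) (⟨h₁, rfl⟩ | h')
    · rfl
    · exact (ha _ h').elim
    · exact (ha _ (h₁ ▸ h)).elim
    · exact β.functional h h'
  injective := by
    rintro x x' y (⟨rfl, rfl⟩ | h) (⟨rfl, h₁⟩ | h')
    · rfl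
    · exact (hb _ h').elim
    · exact (hb _ (h₁ ▸ h)).elim
    · exact β.injective h h'

theorem PBij.le_insert (β : PBij) (a b : ℕ) (ha : ∀ b', ¬ β.rel a b')
    (hb : ∀ a', ¬ β.rel a' b) : β.Le (β.insert a b ha hb) :=
  fun _ _ h => .inr h

theorem exists_fresh {α : Type*} (H : Finmap (fun _ : ℕ => α)) : ∃ a, a ∉ H := by
  obtain ⟨a, ha⟩ := Infinite.exists_notMem_finset H.keys
  exact ⟨a, by rwa [Finmap.mem_keys] at ha⟩

theorem mem_of_lookup {α : Type*} {H : Finmap (fun _ : ℕ => α)} {a : ℕ} {v : α}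
    (h : H.lookup a = some v) : a ∈ H :=
  Finmap.mem_iff.2 ⟨v, h⟩

end Worlds

/-! ### The cross-language relation -/

section Cross

variable {L : Type*} {B : Type*} {K : Type*} {ty : K → B}

theorem CrossV.mono {τ : CTy L B} {θ θ' : StoreTy (CTy L B)} {m m' : ℕ} {β β' : PBij}
    {v : CExp K 0} {w : FExp K 0} (h : CrossV ty τ θ m β v w) (hθ : θ.Le θ') (hm : m' ≤ m)
    (hβ : β.Le β') : CrossV ty τ θ' m' β' v w := by
  induction τ generalizing v w with
  | base b => rw [CrossV] at h ⊢; exact h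
  | unit => rw [CrossV] at h ⊢; exact h
  | arrow τ₁ τ₂ =>
    rw [CrossV] at h ⊢
    obtain ⟨e, f, rfl, rfl, h⟩ := h
    exact ⟨e, f, rfl, rfl, fun θ₁ hθ₁ β₁ hβ₁ j hj =>
      h θ₁ (hθ.trans hθ₁) β₁ (hβ.trans hβ₁) j (by omega)⟩
  | prod τ₁ τ₂ ih₁ ih₂ =>
    rw [CrossV] at h ⊢
    obtain ⟨v₁, v₂, w₁, w₂, rfl, rfl, h₁, h₂⟩ := h
    exact ⟨v₁, v₂, w₁, w₂, rfl, rfl, ih₁ h₁, ih₂ h₂⟩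
  | sum τ₁ τ₂ ih₁ ih₂ =>
    rw [CrossV] at h ⊢
    rcases h with ⟨v', w', rfl, rfl, h⟩ | ⟨v', w', rfl, rfl, h⟩
    · exact .inl ⟨v', w', rfl, rfl, ih₁ h⟩
    · exact .inr ⟨v', w', rfl, rfl, ih₂ h⟩
  | ref ℓ τ =>
    rw [CrossV] at h ⊢
    obtain ⟨a, b, rfl, rfl, ha, hab⟩ := h
    exact ⟨a, b, rfl, rfl, hθ _ _ ha, hβ _ _ hab⟩
  | labeled ℓ τ ih =>
    rw [CrossV] at h ⊢
    obtain ⟨v', w', rfl, rfl, h⟩ := h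
    exact ⟨v', w', rfl, rfl, ih h⟩
  | comp ℓ₁ ℓ₂ τ =>
    rw [CrossV] at h ⊢
    exact ⟨h.1, h.2.1, fun θ₁ hθ₁ β₁ hβ₁ k hk =>
      h.2.2 θ₁ (hθ.trans hθ₁) β₁ (hβ.trans hβ₁) k (by omega)⟩

theorem CrossV.isVal {τ : CTy L B} {θ : StoreTy (CTy L B)} {m : ℕ} {β : PBij}
    {v : CExp K 0} {w : FExp K 0} (h : CrossV ty τ θ m β v w) : CVal v ∧ FVal w := by
  induction τ generalizing v w with
  | base b => rw [CrossV] at h; obtain ⟨k, -, rfl, rfl⟩ := h; exact ⟨.const k, .const k⟩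
  | unit => rw [CrossV] at h; obtain ⟨rfl, rfl⟩ := h; exact ⟨.unit, .unit⟩
  | arrow τ₁ τ₂ =>
    rw [CrossV] at h
    obtain ⟨e, f, rfl, rfl, h⟩ := h
    exact ⟨.lam e, .lam f⟩
  | prod τ₁ τ₂ ih₁ ih₂ =>
    rw [CrossV] at h
    obtain ⟨v₁, v₂, w₁, w₂, rfl, rfl, h₁, h₂⟩ := h
    exact ⟨.pair (ih₁ h₁).1 (ih₂ h₂).1, .pair (ih₁ h₁).2 (ih₂ h₂).2⟩
  | sum τ₁ τ₂ ih₁ ih₂ =>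
    rw [CrossV] at h
    rcases h with ⟨v', w', rfl, rfl, h⟩ | ⟨v', w', rfl, rfl, h⟩
    · exact ⟨.inl (ih₁ h).1, .inl (ih₁ h).2⟩
    · exact ⟨.inr (ih₂ h).1, .inr (ih₂ h).2⟩
  | ref ℓ τ =>
    rw [CrossV] at h
    obtain ⟨a, b, rfl, rfl, ha, hab⟩ := h
    exact ⟨.loc a, .loc b⟩
  | labeled ℓ τ ih =>
    rw [CrossV] at h
    obtain ⟨v', w', rfl, rfl, h⟩ := h
    exact ⟨.label (ih h).1, .inl (ih h).2⟩
  | comp ℓ₁ ℓ₂ τ => rw [CrossV] at h; exact ⟨h.1, h.2.1⟩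

theorem CrossV.scons {n : ℕ} {Γ : Fin n → CTy L B} {τ : CTy L B} {θ : StoreTy (CTy L B)} {m : ℕ}
    {β : PBij} {δs : Fin n → CExp K 0} {δt : Fin n → FExp K 0} {v : CExp K 0} {w : FExp K 0}
    (h : CrossV ty τ θ m β v w) (hδ : ∀ i, CrossV ty (Γ i) θ m β (δs i) (δt i)) :
    ∀ i, CrossV ty (IFC.scons τ Γ i) θ m β (IFC.scons v δs i) (IFC.scons w δt i) :=
  Fin.cases h hδ

theorem CrossE.eval {τ : CTy L B} {θ : StoreTy (CTy L B)} {n : ℕ} {β : PBij} {e v : CExp K 0}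
    {f : FExp K 0} {i : ℕ} (h : CrossE ty τ θ n β e f) (hi : i < n) (he : CEval e i v)
    (Ht : FHeap K) : ∃ i' w, FEval Ht f i' Ht w ∧ CrossV ty τ θ (n - i) β v w := by
  rw [CrossE] at h
  exact h Ht i v hi he

theorem CrossH.mono {n n' : ℕ} {Hs : CHeap K} {Ht : FHeap K} {θ : StoreTy (CTy L B)} {β : PBij}
    (h : CrossH ty n Hs Ht θ β) (hn : n' ≤ n) : CrossH ty n' Hs Ht θ β := by
  rw [CrossH] at h ⊢
  refine ⟨h.1, fun a b hab => ?_⟩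
  obtain ⟨t, v, w, ht, hv, hw, h⟩ := h.2 a b hab
  exact ⟨t, v, w, ht, hv, hw, fun j hj => h j (by omega)⟩

theorem crossH_empty {n : ℕ} (Hs : CHeap K) (Ht : FHeap K) :
    CrossH ty n Hs Ht (fun _ => none : StoreTy (CTy L B)) .empty := by
  rw [CrossH]
  exact ⟨fun _ _ h => by simp at h, fun _ _ h => h.elim⟩

/-- Evaluating a term of monadic type and then running the resulting computation. -/
theorem CrossE.run {ℓ₁ ℓ₂ : L} {τ : CTy L B} {θ : StoreTy (CTy L B)} {n : ℕ} {β : PBij}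
    {e v v' : CExp K 0} {f : FExp K 0} {i j : ℕ} {Hs Hs' : CHeap K} {Ht : FHeap K}
    (h : CrossE ty (.comp ℓ₁ ℓ₂ τ) θ n β e f) (hH : CrossH ty n Hs Ht θ β) (hij : i + j < n)
    (he : CEval e i v) (hv : CForce Hs v j Hs' v') :
    ∃ (i' : ℕ) (Ht' : FHeap K) (w' : FExp K 0), FEval Ht (.app f .unit) i' Ht' (.inl w') ∧
      ∃ (θ' : StoreTy (CTy L B)) (β' : PBij), θ.Le θ' ∧ β.Le β' ∧
        CrossH ty (n - (i + j)) Hs' Ht' θ' β' ∧ CrossV ty τ θ' (n - (i + j)) β' v' w' := by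
  obtain ⟨_, w, hw, hvw⟩ := h.eval (by omega) he Ht
  rw [CrossV] at hvw
  obtain ⟨-, hval, hvw⟩ := hvw
  obtain ⟨_, Ht', w', hev, θ', β', hθ, hβ, hH', hvw'⟩ := hvw θ (.refl θ) β (.refl β) (n - i) le_rfl
    Hs Ht (hH.mono (by omega)) j Hs' v' (by omega) hv
  obtain ⟨k, hk⟩ := hw.app_of_fun_eval hval hev
  rw [Nat.sub_sub] at hH' hvw'
  exact ⟨k, Ht', w', hk, θ', β', hθ, hβ, hH', hvw'⟩

/-- The relation at monadic types for a value of CG and a thunk: it is enough to consider the runs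
of the computation and of the body of the thunk. -/
theorem crossE_thunk {ℓ₁ ℓ₂ : L} {τ : CTy L B} {θ : StoreTy (CTy L B)} {n : ℕ} {β : PBij}
    {v : CExp K 0} {f : FExp K 0} (hv : CVal v)
    (h : ∀ θ₁ : StoreTy (CTy L B), θ.Le θ₁ → ∀ β₁ : PBij, β.Le β₁ → ∀ k ≤ n,
      ∀ (Hs : CHeap K) (Ht : FHeap K), CrossH ty k Hs Ht θ₁ β₁ →
      ∀ i (Hs' : CHeap K) v', i < k → CForce Hs v i Hs' v' →
      ∃ (i' : ℕ) (Ht' : FHeap K) (w' : FExp K 0), FEval Ht f i' Ht' (.inl w') ∧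
      ∃ (θ₂ : StoreTy (CTy L B)) (β₂ : PBij), θ₁.Le θ₂ ∧ β₁.Le β₂ ∧
        CrossH ty (k - i) Hs' Ht' θ₂ β₂ ∧ CrossV ty τ θ₂ (k - i) β₂ v' w') :
    CrossE ty (.comp ℓ₁ ℓ₂ τ) θ n β v f.thunk := by
  rw [CrossE]
  intro Ht i v' hi he
  obtain rfl := hv.eq_of_eval he
  refine ⟨0, _, .lam _, ?_⟩
  rw [CrossV]
  refine ⟨hv, .lam _, fun θ₁ hθ β₁ hβ k hk Hs Ht hH i Hs' v' hi hf => ?_⟩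
  obtain ⟨_, Ht', w', hw, hr⟩ := h θ₁ hθ β₁ hβ k (by omega) Hs Ht hH i Hs' v' hi hf
  obtain ⟨i', hi'⟩ := hw.thunk_app
  exact ⟨i', Ht', w', hi', hr⟩

theorem CrossH.exists_insert_new {n : ℕ} {Hs : CHeap K} {Ht : FHeap K} {θ : StoreTy (CTy L B)}
    {β : PBij} (h : CrossH ty n Hs Ht θ β) {a b : ℕ} (ha : a ∉ Hs) (hb : b ∉ Ht) {τ : CTy L B}
    {v : CExp K 0} {w : FExp K 0} (hvw : CrossV ty τ θ n β v w) :
    ∃ (θ' : StoreTy (CTy L B)) (β' : PBij), θ.Le θ' ∧ β.Le β' ∧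
      CrossH ty n (Hs.insert a v) (Ht.insert b w) θ' β' ∧ θ' a = some τ ∧ β'.rel a b := by
  rw [CrossH] at h
  obtain ⟨hdom, hrel⟩ := h
  have hθa : θ a = none := by
    by_contra hne
    obtain ⟨t, ht⟩ := Option.ne_none_iff_exists'.1 hne
    exact ha (hdom a t ht)
  have hθ := StoreTy.le_update hθa τ
  have hβ := β.le_insert a b
    (fun b' hab => by obtain ⟨t, _, _, ht, -⟩ := hrel _ _ hab; simp [hθa] at ht)
    (fun a' hab => by obtain ⟨_, _, w, -, -, hw, -⟩ := hrel _ _ hab; exact hb (mem_of_lookup hw))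
  refine ⟨_, _, hθ, hβ, ?_, Function.update_self .., .inl ⟨rfl, rfl⟩⟩
  rw [CrossH]
  refine ⟨fun a' t ht => ?_, fun a' b' hab => ?_⟩
  · rw [Finmap.mem_insert]
    by_cases haa : a' = a
    · exact .inl haa
    · rw [Function.update_of_ne haa] at ht
      exact .inr (hdom _ _ ht)
  · rcases hab with ⟨rfl, rfl⟩ | hab
    · exact ⟨τ, v, w, Function.update_self .., Finmap.lookup_insert _, Finmap.lookup_insert _,
        fun j hj => hvw.mono hθ hj.le hβ⟩
    · obtain ⟨t, v', w', ht, hv', hw', hr⟩ := hrel _ _ hab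
      refine ⟨t, v', w', hθ _ _ ht, ?_, ?_, fun j hj => (hr j hj).mono hθ le_rfl hβ⟩
      · rwa [Finmap.lookup_insert_of_ne]
        rintro rfl
        exact ha (mem_of_lookup hv')
      · rwa [Finmap.lookup_insert_of_ne]
        rintro rfl
        exact hb (mem_of_lookup hw')

theorem CrossH.insert {n : ℕ} {Hs : CHeap K} {Ht : FHeap K} {θ : StoreTy (CTy L B)} {β : PBij}
    (h : CrossH ty n Hs Ht θ β) {a b : ℕ} (hab : β.rel a b) {τ : CTy L B} (ha : θ a = some τ)
    {v : CExp K 0} {w : FExp K 0} (hvw : CrossV ty τ θ n β v w) :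
    CrossH ty n (Hs.insert a v) (Ht.insert b w) θ β := by
  rw [CrossH] at h ⊢
  obtain ⟨hdom, hrel⟩ := h
  refine ⟨fun a' t ht => Finmap.mem_insert.2 (.inr (hdom _ _ ht)), fun a' b' hab' => ?_⟩
  by_cases haa : a' = a
  · subst haa
    obtain rfl := β.functional hab hab'
    exact ⟨τ, v, w, ha, Finmap.lookup_insert _, Finmap.lookup_insert _,
      fun j hj => hvw.mono (.refl _) hj.le (.refl _)⟩
  · have hbb : b' ≠ b := by
      rintro rfl
      exact haa (β.injective hab' hab)
    obtain ⟨t, v', w', ht, hv', hw', hr⟩ := hrel _ _ hab'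
    exact ⟨t, v', w', ht, by rwa [Finmap.lookup_insert_of_ne _ haa],
      by rwa [Finmap.lookup_insert_of_ne _ hbb], hr⟩

theorem SameData.of_crossV {τ : CTy L B} (hτ : τ.Ground) {θ : StoreTy (CTy L B)} {m : ℕ}
    {β : PBij} {v : CExp K 0} {w : FExp K 0} (h : CrossV ty τ θ m β v w) : SameData v w := by
  induction hτ generalizing v w with
  | base b => rw [CrossV] at h; obtain ⟨k, -, rfl, rfl⟩ := h; exact .const k
  | unit => rw [CrossV] at h; obtain ⟨rfl, rfl⟩ := h; exact .unit
  | prod _ _ ih₁ ih₂ =>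
    rw [CrossV] at h
    obtain ⟨v₁, v₂, w₁, w₂, rfl, rfl, h₁, h₂⟩ := h
    exact .pair (ih₁ h₁) (ih₂ h₂)
  | sum _ _ ih₁ ih₂ =>
    rw [CrossV] at h
    rcases h with ⟨v', w', rfl, rfl, h⟩ | ⟨v', w', rfl, rfl, h⟩
    · exact .inl (ih₁ h)
    · exact .inr (ih₂ h)
  | labeled _ ih =>
    rw [CrossV] at h
    obtain ⟨v', w', rfl, rfl, h⟩ := h
    exact .label (ih h)

variable [Lattice L]

/-- The cross-language relation does not look at labels, and so subtyping leaves it unchanged. -/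
theorem CrossV.sub {τ τ' : CTy L B} (hs : CSub τ τ') {θ : StoreTy (CTy L B)} {m : ℕ} {β : PBij}
    {v : CExp K 0} {w : FExp K 0} (h : CrossV ty τ θ m β v w) : CrossV ty τ' θ m β v w := by
  induction hs generalizing θ m β v w with
  | refl τ => exact h
  | arrow _ _ ih₁ ih₂ =>
    rw [CrossV] at h ⊢
    obtain ⟨e, f, rfl, rfl, h⟩ := h
    refine ⟨e, f, rfl, rfl, fun θ' hθ β' hβ j hj v' w' hvw => ?_⟩
    have h := h θ' hθ β' hβ j hj v' w' (ih₁ hvw)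
    rw [CrossE]
    intro Ht i v hi he
    obtain ⟨i', w, hw, hr⟩ := h.eval hi he Ht
    exact ⟨i', w, hw, ih₂ hr⟩
  | prod _ _ ih₁ ih₂ =>
    rw [CrossV] at h ⊢
    obtain ⟨v₁, v₂, w₁, w₂, rfl, rfl, h₁, h₂⟩ := h
    exact ⟨v₁, v₂, w₁, w₂, rfl, rfl, ih₁ h₁, ih₂ h₂⟩
  | sum _ _ ih₁ ih₂ =>
    rw [CrossV] at h ⊢
    rcases h with ⟨v', w', rfl, rfl, h⟩ | ⟨v', w', rfl, rfl, h⟩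
    · exact .inl ⟨v', w', rfl, rfl, ih₁ h⟩
    · exact .inr ⟨v', w', rfl, rfl, ih₂ h⟩
  | labeled _ _ ih =>
    rw [CrossV] at h ⊢
    obtain ⟨v', w', rfl, rfl, h⟩ := h
    exact ⟨v', w', rfl, rfl, ih h⟩
  | comp _ _ _ ih =>
    rw [CrossV] at h ⊢
    refine ⟨h.1, h.2.1, fun θ₁ hθ₁ β₁ hβ₁ k hk Hs Ht hH i Hs' v' hi hf => ?_⟩
    obtain ⟨i', Ht', w', hw, θ₂, β₂, hθ₂, hβ₂, hH', hr⟩ :=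
      h.2.2 θ₁ hθ₁ β₁ hβ₁ k hk Hs Ht hH i Hs' v' hi hf
    exact ⟨i', Ht', w', hw, θ₂, β₂, hθ₂, hβ₂, hH', ih hr⟩

variable [BoundedOrder L]

/-- The fundamental theorem of the cross-language relation: a term and its translation are
related. -/
theorem CTrans.crossE {n : ℕ} {Γ : Fin n → CTy L B} {e : CExp K n} {τ : CTy L B} {f : FExp K n}
    (h : CTrans ty Γ e τ f) {θ : StoreTy (CTy L B)} {m : ℕ} {β : PBij} {δs : Fin n → CExp K 0}
    {δt : Fin n → FExp K 0} (hδ : ∀ i, CrossV ty (Γ i) θ m β (δs i) (δt i)) :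
    CrossE ty τ θ m β (e.subst δs) (f.subst δt) := by
  induction h generalizing θ m β with
  | var i =>
    rw [CrossE]
    intro Ht k v hk he
    obtain rfl := (hδ i).isVal.1.eq_of_eval he
    obtain ⟨k', hk'⟩ := (hδ i).isVal.2.exists_eval
    exact ⟨k', _, hk' Ht, (hδ i).mono (.refl _) (by omega) (.refl _)⟩
  | const k =>
    rw [CrossE]
    intro Ht i v hi he
    cases he
    exact ⟨_, _, .const k, by rw [CrossV]; exact ⟨k, rfl, rfl, rfl⟩⟩
  | unit =>
    rw [CrossE]
    intro Ht i v hi he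
    cases he
    exact ⟨_, _, .unit, by rw [CrossV]; exact ⟨rfl, rfl⟩⟩
  | lam _ ih =>
    rw [CrossE]
    intro Ht i v hi he
    cases he
    refine ⟨_, _, .lam _, ?_⟩
    rw [CrossV]
    refine ⟨_, _, rfl, rfl, fun θ' hθ β' hβ j hj v' w' hvw => ?_⟩
    rw [CExp.inst_subst_lift, FExp.inst_subst_lift]
    exact ih (hvw.scons fun i => (hδ i).mono hθ (by omega) hβ)
  | app _ _ ih₁ ih₂ =>
    rw [CrossE]
    intro Ht i v hi he
    cases he with
    | app h₁ h₂ h₃ =>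
      rename_i i j k
      obtain ⟨_, w₁, hw₁, hr₁⟩ := (ih₁ hδ).eval (by omega) h₁ Ht
      obtain ⟨_, w₂, hw₂, hr₂⟩ := (ih₂ hδ).eval (by omega) h₂ Ht
      rw [CrossV] at hr₁
      obtain ⟨_, f, heq, rfl, hr₁⟩ := hr₁
      cases heq
      -- The step of the application itself pays for the strict decrease of the index that the
      -- function relation asks for.
      obtain ⟨_, w, hw, hr⟩ := (hr₁ θ (.refl _) β (.refl _) (m - (i + j + 1)) (by omega) _ _
        (hr₂.mono (.refl _) (by omega) (.refl _))).eval (by omega) h₃ Ht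
      exact ⟨_, w, .app hw₁ hw₂ hw, hr.mono (.refl _) (by omega) (.refl _)⟩
  | pair _ _ ih₁ ih₂ =>
    rw [CrossE]
    intro Ht i v hi he
    cases he with
    | pair h₁ h₂ =>
      obtain ⟨_, w₁, hw₁, hr₁⟩ := (ih₁ hδ).eval (by omega) h₁ Ht
      obtain ⟨_, w₂, hw₂, hr₂⟩ := (ih₂ hδ).eval (by omega) h₂ Ht
      refine ⟨_, _, .pair hw₁ hw₂, ?_⟩
      rw [CrossV]
      exact ⟨_, _, _, _, rfl, rfl, hr₁.mono (.refl _) (by omega) (.refl _),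
        hr₂.mono (.refl _) (by omega) (.refl _)⟩
  | fst _ ih =>
    rw [CrossE]
    intro Ht i v hi he
    cases he with
    | fst h =>
      obtain ⟨_, w, hw, hr⟩ := (ih hδ).eval (by omega) h Ht
      rw [CrossV] at hr
      obtain ⟨_, _, _, _, heq, rfl, hr, -⟩ := hr
      cases heq
      exact ⟨_, _, .fst hw, hr.mono (.refl _) (by omega) (.refl _)⟩
  | snd _ ih =>
    rw [CrossE]
    intro Ht i v hi he
    cases he with
    | snd h =>
      obtain ⟨_, w, hw, hr⟩ := (ih hδ).eval (by omega) h Ht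
      rw [CrossV] at hr
      obtain ⟨_, _, _, _, heq, rfl, -, hr⟩ := hr
      cases heq
      exact ⟨_, _, .snd hw, hr.mono (.refl _) (by omega) (.refl _)⟩
  | inl _ ih =>
    rw [CrossE]
    intro Ht i v hi he
    cases he with
    | inl h =>
      obtain ⟨_, w, hw, hr⟩ := (ih hδ).eval (by omega) h Ht
      refine ⟨_, _, .inl hw, ?_⟩
      rw [CrossV]
      exact .inl ⟨_, _, rfl, rfl, hr.mono (.refl _) (by omega) (.refl _)⟩
  | inr _ ih =>
    rw [CrossE]
    intro Ht i v hi he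
    cases he with
    | inr h =>
      obtain ⟨_, w, hw, hr⟩ := (ih hδ).eval (by omega) h Ht
      refine ⟨_, _, .inr hw, ?_⟩
      rw [CrossV]
      exact .inr ⟨_, _, rfl, rfl, hr.mono (.refl _) (by omega) (.refl _)⟩
  | caseOf _ _ _ ih ih₁ ih₂ =>
    rw [CrossE]
    intro Ht i v hi he
    cases he with
    | caseInl h h' =>
      obtain ⟨_, w, hw, hr⟩ := (ih hδ).eval (by omega) h Ht
      rw [CrossV] at hr
      obtain ⟨_, w₁, heq, rfl, hr⟩ | ⟨_, _, heq, -⟩ := hr <;> cases heq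
      rw [CExp.inst_subst_lift] at h'
      obtain ⟨_, w', hw', hr'⟩ := (ih₁ (hr.scons fun x =>
        (hδ x).mono (.refl _) (by omega) (.refl _))).eval (by omega) h' Ht
      rw [← FExp.inst_subst_lift] at hw'
      exact ⟨_, _, .caseInl hw hw', hr'.mono (.refl _) (by omega) (.refl _)⟩
    | caseInr h h' =>
      obtain ⟨_, w, hw, hr⟩ := (ih hδ).eval (by omega) h Ht
      rw [CrossV] at hr
      obtain ⟨_, _, heq, -⟩ | ⟨_, w₁, heq, rfl, hr⟩ := hr <;> cases heq
      rw [CExp.inst_subst_lift] at h'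
      obtain ⟨_, w', hw', hr'⟩ := (ih₂ (hr.scons fun x =>
        (hδ x).mono (.refl _) (by omega) (.refl _))).eval (by omega) h' Ht
      rw [← FExp.inst_subst_lift] at hw'
      exact ⟨_, _, .caseInr hw hw', hr'.mono (.refl _) (by omega) (.refl _)⟩
  | label _ ih =>
    rw [CrossE]
    intro Ht i v hi he
    cases he with
    | label h =>
      obtain ⟨_, w, hw, hr⟩ := (ih hδ).eval (by omega) h Ht
      refine ⟨_, _, .inl hw, ?_⟩
      rw [CrossV]
      exact ⟨_, _, rfl, rfl, hr.mono (.refl _) (by omega) (.refl _)⟩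
  | unlabel _ ih =>
    rw [FExp.thunk_subst]
    refine crossE_thunk (.unlabel _) fun θ₁ hθ₁ β₁ hβ₁ k hk Hs Ht hH i Hs' v' hi hf => ?_
    cases hf with
    | unlabel h =>
      obtain ⟨_, w, hw, hr⟩ := (ih fun x => (hδ x).mono hθ₁ hk hβ₁).eval (by omega) h Ht
      rw [CrossV] at hr
      obtain ⟨_, w', heq, rfl, hr⟩ := hr
      cases heq
      exact ⟨_, _, w', hw, θ₁, β₁, .refl _, .refl _, hH.mono (by omega),
        hr.mono (.refl _) (by omega) (.refl _)⟩
  | toLabeled _ ih =>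
    rw [FExp.thunk_subst]
    refine crossE_thunk (.toLabeled _) fun θ₁ hθ₁ β₁ hβ₁ k hk Hs Ht hH i Hs' v' hi hf => ?_
    cases hf with
    | toLabeled h h' =>
      obtain ⟨_, Ht', w', hw, θ₂, β₂, hθ₂, hβ₂, hH', hr⟩ :=
        (ih fun x => (hδ x).mono hθ₁ hk hβ₁).run hH (by omega) h h'
      refine ⟨_, Ht', _, .inl hw, θ₂, β₂, hθ₂, hβ₂, hH'.mono (by omega), ?_⟩
      rw [CrossV]
      exact ⟨_, _, rfl, rfl, hr.mono (.refl _) (by omega) (.refl _)⟩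
  | ret _ ih =>
    rw [FExp.thunk_subst]
    refine crossE_thunk (.ret _) fun θ₁ hθ₁ β₁ hβ₁ k hk Hs Ht hH i Hs' v' hi hf => ?_
    cases hf with
    | ret h =>
      obtain ⟨_, w, hw, hr⟩ := (ih fun x => (hδ x).mono hθ₁ hk hβ₁).eval (by omega) h Ht
      exact ⟨_, _, w, .inl hw, θ₁, β₁, .refl _, .refl _, hH.mono (by omega),
        hr.mono (.refl _) (by omega) (.refl _)⟩
  | bind _ _ _ _ _ _ ih₁ ih₂ =>
    rw [FExp.thunk_subst]
    refine crossE_thunk (.bind _ _) fun θ₁ hθ₁ β₁ hβ₁ k hk Hs Ht hH i Hs' v' hi hf => ?_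
    cases hf with
    | bind h₁ h₁' h₂ h₂' =>
      obtain ⟨_, Ht₂, w₁, hw₁, θ₂, β₂, hθ₂, hβ₂, hH₂, hr₁⟩ :=
        (ih₁ fun x => (hδ x).mono hθ₁ hk hβ₁).run hH (by omega) h₁ h₁'
      rw [CExp.inst_subst_lift] at h₂
      obtain ⟨_, Ht₃, w₂, hw₂, θ₃, β₃, hθ₃, hβ₃, hH₃, hr₂⟩ :=
        (ih₂ (hr₁.scons fun x => (hδ x).mono (hθ₁.trans hθ₂) (by omega) (hβ₁.trans hβ₂))).run
          hH₂ (by omega) h₂ h₂'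
      rw [← FExp.inst_subst_lift] at hw₂
      exact ⟨_, Ht₃, w₂, .caseInl hw₁ hw₂, θ₃, β₃, hθ₂.trans hθ₃, hβ₂.trans hβ₃,
        hH₃.mono (by omega), hr₂.mono (.refl _) (by omega) (.refl _)⟩
  | newRef _ ih =>
    rw [FExp.thunk_subst]
    refine crossE_thunk (.newRef _) fun θ₁ hθ₁ β₁ hβ₁ k hk Hs Ht hH i Hs' v' hi hf => ?_
    cases hf with
    | newRef h ha =>
      obtain ⟨_, w, hw, hr⟩ := (ih fun x => (hδ x).mono hθ₁ hk hβ₁).eval (by omega) h Ht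
      obtain ⟨b, hb⟩ := exists_fresh Ht
      obtain ⟨θ₂, β₂, hθ₂, hβ₂, hH₂, hθa, hab⟩ :=
        (hH.mono (Nat.sub_le _ _)).exists_insert_new ha hb hr
      refine ⟨_, _, _, .inl (.newRef hw hb), θ₂, β₂, hθ₂, hβ₂, hH₂.mono (by omega), ?_⟩
      rw [CrossV]
      exact ⟨_, b, rfl, rfl, hθa, hab⟩
  | deref _ ih =>
    rw [FExp.thunk_subst]
    refine crossE_thunk (.deref _) fun θ₁ hθ₁ β₁ hβ₁ k hk Hs Ht hH i Hs' v' hi hf => ?_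
    cases hf with
    | deref h hl =>
      obtain ⟨_, w, hw, hr⟩ := (ih fun x => (hδ x).mono hθ₁ hk hβ₁).eval (by omega) h Ht
      rw [CrossV] at hr
      obtain ⟨_, b, heq, rfl, hθa, hab⟩ := hr
      cases heq
      have hH' := hH
      rw [CrossH] at hH'
      obtain ⟨t, v, w', ht, hv, hw', hvw⟩ := hH'.2 _ _ hab
      obtain rfl : _ = t := Option.some.inj (hθa.symm.trans ht)
      obtain rfl : _ = v := Option.some.inj (hl.symm.trans hv)
      exact ⟨_, _, w', .inl (.deref hw hw'), θ₁, β₁, .refl _, .refl _, hH.mono (by omega),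
        hvw _ (by omega)⟩
  | assign _ _ ih₁ ih₂ =>
    rw [FExp.thunk_subst]
    refine crossE_thunk (.assign _ _) fun θ₁ hθ₁ β₁ hβ₁ k hk Hs Ht hH i Hs' v' hi hf => ?_
    cases hf with
    | assign h₁ h₂ ha =>
      obtain ⟨_, w, hw, hr⟩ := (ih₁ fun x => (hδ x).mono hθ₁ hk hβ₁).eval (by omega) h₁ Ht
      obtain ⟨_, w₂, hw₂, hr₂⟩ := (ih₂ fun x => (hδ x).mono hθ₁ hk hβ₁).eval (by omega) h₂ Ht
      rw [CrossV] at hr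
      obtain ⟨_, b, heq, rfl, hθa, hab⟩ := hr
      cases heq
      have hb : b ∈ Ht := by
        have hH' := hH
        rw [CrossH] at hH'
        obtain ⟨_, _, _, -, -, hw, -⟩ := hH'.2 _ _ hab
        exact mem_of_lookup hw
      refine ⟨_, _, _, .inl (.assign hw hw₂ hb), θ₁, β₁, .refl _, .refl _,
        ((hH.mono (Nat.sub_le _ _)).insert hab hθa hr₂).mono (by omega), ?_⟩
      rw [CrossV]
      exact ⟨rfl, rfl⟩
  | sub _ hs ih =>
    rw [CrossE]
    intro Ht i v hi he
    obtain ⟨i', w, hw, hr⟩ := (ih hδ).eval hi he Ht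
    exact ⟨i', w, hw, hr.sub hs⟩

end Cross

/-! ### The unary model of FG -/

section Unary

variable {L : Type*} {B : Type*} {K : Type*} [Lattice L] {ty : K → B}

theorem UnV.mono {τ : FTy L B} {θ θ' : StoreTy (FTy L B)} {m m' : ℕ} {v : FExp K 0}
    (h : UnV ty τ θ m v) (hθ : θ.Le θ') (hm : m' ≤ m) : UnV ty τ θ' m' v := by
  induction τ generalizing v with
  | base b ℓ => rw [UnV] at h ⊢; exact h
  | unit ℓ => rw [UnV] at h ⊢; exact h
  | arrow τ₁ ℓe τ₂ ℓ =>
    rw [UnV] at h ⊢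
    obtain ⟨e, rfl, h⟩ := h
    exact ⟨e, rfl, fun θ₁ hθ₁ j hj => h θ₁ (hθ.trans hθ₁) j (by omega)⟩
  | prod τ₁ τ₂ ℓ ih₁ ih₂ =>
    rw [UnV] at h ⊢
    obtain ⟨v₁, v₂, rfl, h₁, h₂⟩ := h
    exact ⟨v₁, v₂, rfl, ih₁ h₁, ih₂ h₂⟩
  | sum τ₁ τ₂ ℓ ih₁ ih₂ =>
    rw [UnV] at h ⊢
    rcases h with ⟨v', rfl, h⟩ | ⟨v', rfl, h⟩
    · exact .inl ⟨v', rfl, ih₁ h⟩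
    · exact .inr ⟨v', rfl, ih₂ h⟩
  | ref τ ℓ =>
    rw [UnV] at h ⊢
    obtain ⟨a, rfl, ha⟩ := h
    exact ⟨a, rfl, hθ _ _ ha⟩

theorem UnV.isVal {τ : FTy L B} {θ : StoreTy (FTy L B)} {m : ℕ} {v : FExp K 0}
    (h : UnV ty τ θ m v) : FVal v := by
  induction τ generalizing v with
  | base b ℓ => rw [UnV] at h; obtain ⟨k, -, rfl⟩ := h; exact .const k
  | unit ℓ => rw [UnV] at h; obtain rfl := h; exact .unit
  | arrow τ₁ ℓe τ₂ ℓ => rw [UnV] at h; obtain ⟨e, rfl, -⟩ := h; exact .lam e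
  | prod τ₁ τ₂ ℓ ih₁ ih₂ =>
    rw [UnV] at h
    obtain ⟨v₁, v₂, rfl, h₁, h₂⟩ := h
    exact .pair (ih₁ h₁) (ih₂ h₂)
  | sum τ₁ τ₂ ℓ ih₁ ih₂ =>
    rw [UnV] at h
    rcases h with ⟨v', rfl, h⟩ | ⟨v', rfl, h⟩
    · exact .inl (ih₁ h)
    · exact .inr (ih₂ h)
  | ref τ ℓ => rw [UnV] at h; obtain ⟨a, rfl, -⟩ := h; exact .loc a

theorem UnV.scons {n : ℕ} {Γ : Fin n → FTy L B} {τ : FTy L B} {θ : StoreTy (FTy L B)} {m : ℕ}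
    {γ : Fin n → FExp K 0} {v : FExp K 0} (h : UnV ty τ θ m v)
    (hγ : ∀ i, UnV ty (Γ i) θ m (γ i)) :
    ∀ i, UnV ty (IFC.scons τ Γ i) θ m (IFC.scons v γ i) :=
  Fin.cases h hγ

theorem UnH.mono {n n' : ℕ} {H : FHeap K} {θ : StoreTy (FTy L B)} (h : UnH ty n H θ)
    (hn : n' ≤ n) : UnH ty n' H θ := by
  rw [UnH] at h ⊢
  intro a t ha
  obtain ⟨v, hv, h⟩ := h a t ha
  exact ⟨v, hv, fun j hj => h j (by omega)⟩

theorem UnH.lookup {n : ℕ} {H : FHeap K} {θ : StoreTy (FTy L B)} (h : UnH ty n H θ) {a : ℕ}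
    {τ : FTy L B} (ha : θ a = some τ) {v : FExp K 0} (hv : H.lookup a = some v) {j : ℕ}
    (hj : j < n) : UnV ty τ θ j v := by
  rw [UnH] at h
  obtain ⟨v', hv', h⟩ := h a τ ha
  rw [hv] at hv'
  cases hv'
  exact h j hj

theorem UnH.eq_none {n : ℕ} {H : FHeap K} {θ : StoreTy (FTy L B)} (h : UnH ty n H θ) {a : ℕ}
    (ha : a ∉ H) : θ a = none := by
  rw [UnH] at h
  by_contra hne
  obtain ⟨t, ht⟩ := Option.ne_none_iff_exists'.1 hne
  obtain ⟨v, hv, -⟩ := h a t ht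
  exact ha (mem_of_lookup hv)

theorem unH_empty (n : ℕ) (H : FHeap K) : UnH ty n H (fun _ => none : StoreTy (FTy L B)) := by
  rw [UnH]
  intro a t h
  simp at h

theorem UnH.insert {n : ℕ} {H : FHeap K} {θ : StoreTy (FTy L B)} (h : UnH ty n H θ) {a : ℕ}
    {τ : FTy L B} (ha : θ a = some τ) {v : FExp K 0} (hv : UnV ty τ θ n v) :
    UnH ty n (H.insert a v) θ := by
  rw [UnH] at h ⊢
  intro b t hb
  by_cases hba : b = a
  · subst hba
    obtain rfl : τ = t := Option.some.inj (ha.symm.trans hb)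
    exact ⟨v, Finmap.lookup_insert _, fun j hj => hv.mono (.refl _) hj.le⟩
  · rw [Finmap.lookup_insert_of_ne _ hba]
    exact h b t hb

theorem UnH.insert_new {n : ℕ} {H : FHeap K} {θ : StoreTy (FTy L B)} (h : UnH ty n H θ) {a : ℕ}
    (ha : a ∉ H) {τ : FTy L B} {v : FExp K 0} (hv : UnV ty τ θ n v) :
    UnH ty n (H.insert a v) (Function.update θ a (some τ)) := by
  have hθ := StoreTy.le_update (h.eq_none ha) τ
  rw [UnH] at h ⊢
  intro b t hb
  by_cases hba : b = a
  · subst hba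
    rw [Function.update_self] at hb
    cases hb
    exact ⟨v, Finmap.lookup_insert _, fun j hj => hv.mono hθ hj.le⟩
  · rw [Finmap.lookup_insert_of_ne _ hba]
    rw [Function.update_of_ne hba] at hb
    obtain ⟨v', hv', h⟩ := h b t hb
    exact ⟨v', hv', fun j hj => (h j hj).mono hθ le_rfl⟩

/-- The effect of a run from the heap `H` to the heap `H'`, during which the store typing grows
from `θ` to `θ'`, is confined to locations whose types are labeled `pc` or above. -/
structure Confined (pc : L) (θ θ' : StoreTy (FTy L B)) (H H' : FHeap K) : Prop where
  le : θ.Le θ'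
  of_ne : ∀ a t, θ a = some t → H.lookup a ≠ H'.lookup a → pc ≤ t.lab
  of_new : ∀ a t, θ a = none → θ' a = some t → pc ≤ t.lab

theorem Confined.refl (pc : L) (θ : StoreTy (FTy L B)) (H : FHeap K) : Confined pc θ θ H H :=
  ⟨.refl θ, fun _ _ _ h => (h rfl).elim, fun _ _ h h' => by simp [h] at h'⟩

theorem Confined.trans {pc : L} {θ θ' θ'' : StoreTy (FTy L B)} {H H' H'' : FHeap K}
    (h : Confined pc θ θ' H H') (h' : Confined pc θ' θ'' H' H'') :
    Confined pc θ θ'' H H'' := by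
  refine ⟨h.le.trans h'.le, fun a t ha hne => ?_, fun a t ha hat => ?_⟩
  · by_cases heq : H.lookup a = H'.lookup a
    · exact h'.of_ne a t (h.le a t ha) (heq ▸ hne)
    · exact h.of_ne a t ha heq
  · cases hθ' : θ' a with
    | none => exact h'.of_new a t hθ' hat
    | some s =>
      obtain rfl : s = t := Option.some.inj ((h'.le a s hθ').symm.trans hat)
      exact h.of_new a s ha hθ'

theorem Confined.mono {pc pc' : L} {θ θ' : StoreTy (FTy L B)} {H H' : FHeap K}
    (h : Confined pc θ θ' H H') (hpc : pc' ≤ pc) : Confined pc' θ θ' H H' :=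
  ⟨h.le, fun a t ha hne => hpc.trans (h.of_ne a t ha hne),
    fun a t ha hat => hpc.trans (h.of_new a t ha hat)⟩

theorem Confined.insert {pc : L} {θ : StoreTy (FTy L B)} {a : ℕ} {τ : FTy L B}
    (ha : θ a = some τ) (hτ : pc ≤ τ.lab) (H : FHeap K) (v : FExp K 0) :
    Confined pc θ θ H (H.insert a v) := by
  refine ⟨.refl θ, fun b t hb hne => ?_, fun _ _ h h' => by simp [h] at h'⟩
  by_cases hba : b = a
  · subst hba
    obtain rfl : τ = t := Option.some.inj (ha.symm.trans hb)
    exact hτ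
  · exact (hne (Finmap.lookup_insert_of_ne _ hba).symm).elim

theorem Confined.insert_new {pc : L} {θ : StoreTy (FTy L B)} {a : ℕ} (ha : θ a = none)
    {τ : FTy L B} (hτ : pc ≤ τ.lab) (H : FHeap K) (v : FExp K 0) :
    Confined pc θ (Function.update θ a (some τ)) H (H.insert a v) := by
  refine ⟨StoreTy.le_update ha τ, fun b t hb hne => ?_, fun b t hb hbt => ?_⟩
  · have hba : b ≠ a := by
      rintro rfl
      simp [ha] at hb
    exact (hne (Finmap.lookup_insert_of_ne _ hba).symm).elim
  · by_cases hba : b = a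
    · subst hba
      rw [Function.update_self] at hbt
      cases hbt
      exact hτ
    · rw [Function.update_of_ne hba, hb] at hbt
      cases hbt

/-- The unary expression relation in terms of `Confined`. -/
theorem unE_iff {pc : L} {τ : FTy L B} {θ : StoreTy (FTy L B)} {n : ℕ} {e : FExp K 0} :
    UnE ty pc τ θ n e ↔ ∀ (H : FHeap K) (i : ℕ) (H' : FHeap K) (v : FExp K 0),
      UnH ty n H θ → i < n → FEval H e i H' v →
      ∃ θ' : StoreTy (FTy L B), Confined pc θ θ' H H' ∧ UnH ty (n - i) H' θ' ∧
        UnV ty τ θ' (n - i) v := by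
  rw [UnE]
  refine forall₄_congr fun H i H' v => forall₃_congr fun _ _ _ => exists_congr fun θ' => ?_
  exact ⟨fun ⟨h₁, h₂, h₃, h₄, h₅⟩ => ⟨⟨h₁, h₄, h₅⟩, h₂, h₃⟩,
    fun ⟨⟨h₁, h₄, h₅⟩, h₂, h₃⟩ => ⟨h₁, h₂, h₃, h₄, h₅⟩⟩

theorem UnE.eval {pc : L} {τ : FTy L B} {θ : StoreTy (FTy L B)} {n i : ℕ} {e v : FExp K 0}
    {H H' : FHeap K} (h : UnE ty pc τ θ n e) (hH : UnH ty n H θ) (hi : i < n)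
    (he : FEval H e i H' v) :
    ∃ θ' : StoreTy (FTy L B), Confined pc θ θ' H H' ∧ UnH ty (n - i) H' θ' ∧
      UnV ty τ θ' (n - i) v :=
  unE_iff.1 h H i H' v hH hi he

theorem UnV.sub {τ τ' : FTy L B} (hs : FSub τ τ') {θ : StoreTy (FTy L B)} {m : ℕ}
    {v : FExp K 0} (h : UnV ty τ θ m v) : UnV ty τ' θ m v := by
  induction hs generalizing θ m v with
  | base => rw [UnV] at h ⊢; exact h
  | unit => rw [UnV] at h ⊢; exact h
  | arrow _ _ hpc _ ih₁ ih₂ =>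
    rw [UnV] at h ⊢
    obtain ⟨e, rfl, h⟩ := h
    refine ⟨e, rfl, fun θ' hθ j hj v' hv => unE_iff.2 fun H i H' v hH hi he => ?_⟩
    obtain ⟨θ'', hc, hH', hv'⟩ := (h θ' hθ j hj v' (ih₁ hv)).eval hH hi he
    exact ⟨θ'', hc.mono hpc, hH', ih₂ hv'⟩
  | prod _ _ _ ih₁ ih₂ =>
    rw [UnV] at h ⊢
    obtain ⟨v₁, v₂, rfl, h₁, h₂⟩ := h
    exact ⟨v₁, v₂, rfl, ih₁ h₁, ih₂ h₂⟩
  | sum _ _ _ ih₁ ih₂ =>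
    rw [UnV] at h ⊢
    rcases h with ⟨v', rfl, h⟩ | ⟨v', rfl, h⟩
    · exact .inl ⟨v', rfl, ih₁ h⟩
    · exact .inr ⟨v', rfl, ih₂ h⟩
  | ref _ => rw [UnV] at h ⊢; exact h

variable [BoundedOrder L]

/-- The unary fundamental theorem: a well-typed term is good, and its effects are confined to
locations labeled at its pc-label or above. -/
theorem FTyped.unE {n : ℕ} {Γ : Fin n → FTy L B} {pc : L} {e : FExp K n} {τ : FTy L B}
    (h : FTyped ty Γ pc e τ) {θ : StoreTy (FTy L B)} {m : ℕ} {γ : Fin n → FExp K 0}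
    (hγ : ∀ i, UnV ty (Γ i) θ m (γ i)) : UnE ty pc τ θ m (e.subst γ) := by
  induction h generalizing θ m with
  | var i =>
    refine unE_iff.2 fun H k H' v hH hk he => ?_
    obtain ⟨rfl, rfl⟩ := (hγ i).isVal.eq_of_eval he
    exact ⟨θ, .refl _ _ _, hH.mono (by omega), (hγ i).mono (.refl _) (by omega)⟩
  | const k =>
    refine unE_iff.2 fun H i H' v hH hi he => ?_
    cases he
    exact ⟨θ, .refl _ _ _, hH.mono (by omega), by rw [UnV]; exact ⟨k, rfl, rfl⟩⟩
  | unit =>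
    refine unE_iff.2 fun H i H' v hH hi he => ?_
    cases he
    exact ⟨θ, .refl _ _ _, hH.mono (by omega), by rw [UnV]⟩
  | lam _ ih =>
    refine unE_iff.2 fun H i H' v hH hi he => ?_
    cases he
    refine ⟨θ, .refl _ _ _, hH.mono (by omega), ?_⟩
    rw [UnV]
    refine ⟨_, rfl, fun θ' hθ j hj v hv => ?_⟩
    rw [FExp.inst_subst_lift]
    exact ih (hv.scons fun i => (hγ i).mono hθ (by omega))
  | app _ _ hpc _ ih₁ ih₂ =>
    refine unE_iff.2 fun H i H' v hH hi he => ?_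
    cases he with
    | app h₁ h₂ h₃ =>
      rename_i i j k
      obtain ⟨θ₁, hc₁, hH₁, hv₁⟩ := (ih₁ hγ).eval hH (by omega) h₁
      obtain ⟨θ₂, hc₂, hH₂, hv₂⟩ :=
        (ih₂ fun x => (hγ x).mono hc₁.le (by omega)).eval hH₁ (by omega) h₂
      rw [UnV] at hv₁
      obtain ⟨_, heq, hv₁⟩ := hv₁
      cases heq
      -- The step of the application itself pays for the strict decrease of the index that the
      -- function relation asks for.
      obtain ⟨θ₃, hc₃, hH₃, hv₃⟩ := (hv₁ θ₂ hc₂.le (m - (i + j + 1)) (by omega) _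
        (hv₂.mono (.refl _) (by omega))).eval (hH₂.mono (by omega)) (by omega) h₃
      exact ⟨θ₃, (hc₁.trans hc₂).trans (hc₃.mono (le_sup_right.trans hpc)),
        hH₃.mono (by omega), hv₃.mono (.refl _) (by omega)⟩
  | pair _ _ ih₁ ih₂ =>
    refine unE_iff.2 fun H i H' v hH hi he => ?_
    cases he with
    | pair h₁ h₂ =>
      obtain ⟨θ₁, hc₁, hH₁, hv₁⟩ := (ih₁ hγ).eval hH (by omega) h₁
      obtain ⟨θ₂, hc₂, hH₂, hv₂⟩ :=
        (ih₂ fun x => (hγ x).mono hc₁.le (by omega)).eval hH₁ (by omega) h₂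
      refine ⟨θ₂, hc₁.trans hc₂, hH₂.mono (by omega), ?_⟩
      rw [UnV]
      exact ⟨_, _, rfl, hv₁.mono hc₂.le (by omega), hv₂.mono (.refl _) (by omega)⟩
  | fst _ _ ih =>
    refine unE_iff.2 fun H i H' v hH hi he => ?_
    cases he with
    | fst h =>
      obtain ⟨θ₁, hc, hH', hv⟩ := (ih hγ).eval hH (by omega) h
      rw [UnV] at hv
      obtain ⟨_, _, heq, hv, -⟩ := hv
      cases heq
      exact ⟨θ₁, hc, hH'.mono (by omega), hv.mono (.refl _) (by omega)⟩
  | snd _ _ ih =>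
    refine unE_iff.2 fun H i H' v hH hi he => ?_
    cases he with
    | snd h =>
      obtain ⟨θ₁, hc, hH', hv⟩ := (ih hγ).eval hH (by omega) h
      rw [UnV] at hv
      obtain ⟨_, _, heq, -, hv⟩ := hv
      cases heq
      exact ⟨θ₁, hc, hH'.mono (by omega), hv.mono (.refl _) (by omega)⟩
  | inl _ ih =>
    refine unE_iff.2 fun H i H' v hH hi he => ?_
    cases he with
    | inl h =>
      obtain ⟨θ₁, hc, hH', hv⟩ := (ih hγ).eval hH (by omega) h
      refine ⟨θ₁, hc, hH'.mono (by omega), ?_⟩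
      rw [UnV]
      exact .inl ⟨_, rfl, hv.mono (.refl _) (by omega)⟩
  | inr _ ih =>
    refine unE_iff.2 fun H i H' v hH hi he => ?_
    cases he with
    | inr h =>
      obtain ⟨θ₁, hc, hH', hv⟩ := (ih hγ).eval hH (by omega) h
      refine ⟨θ₁, hc, hH'.mono (by omega), ?_⟩
      rw [UnV]
      exact .inr ⟨_, rfl, hv.mono (.refl _) (by omega)⟩
  | caseOf _ _ _ _ ih ih₁ ih₂ =>
    refine unE_iff.2 fun H i H' v hH hi he => ?_
    cases he with
    | caseInl h h' =>
      obtain ⟨θ₁, hc₁, hH₁, hv₁⟩ := (ih hγ).eval hH (by omega) h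
      rw [UnV] at hv₁
      obtain ⟨_, heq, hv₁⟩ | ⟨_, heq, -⟩ := hv₁ <;> cases heq
      rw [FExp.inst_subst_lift] at h'
      obtain ⟨θ₂, hc₂, hH₂, hv₂⟩ :=
        (ih₁ (hv₁.scons fun x => (hγ x).mono hc₁.le (by omega))).eval hH₁ (by omega) h'
      exact ⟨θ₂, hc₁.trans (hc₂.mono le_sup_left), hH₂.mono (by omega),
        hv₂.mono (.refl _) (by omega)⟩
    | caseInr h h' =>
      obtain ⟨θ₁, hc₁, hH₁, hv₁⟩ := (ih hγ).eval hH (by omega) h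
      rw [UnV] at hv₁
      obtain ⟨_, heq, -⟩ | ⟨_, heq, hv₁⟩ := hv₁ <;> cases heq
      rw [FExp.inst_subst_lift] at h'
      obtain ⟨θ₂, hc₂, hH₂, hv₂⟩ :=
        (ih₂ (hv₁.scons fun x => (hγ x).mono hc₁.le (by omega))).eval hH₁ (by omega) h'
      exact ⟨θ₂, hc₁.trans (hc₂.mono le_sup_left), hH₂.mono (by omega),
        hv₂.mono (.refl _) (by omega)⟩
  | newRef _ hpc ih =>
    refine unE_iff.2 fun H i H' v hH hi he => ?_
    cases he with
    | newRef h ha =>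
      obtain ⟨θ₁, hc₁, hH₁, hv₁⟩ := (ih hγ).eval hH (by omega) h
      refine ⟨_, hc₁.trans (.insert_new (hH₁.eq_none ha) hpc _ _),
        (hH₁.insert_new ha hv₁).mono (by omega), ?_⟩
      rw [UnV]
      exact ⟨_, rfl, Function.update_self ..⟩
  | deref _ hs _ ih =>
    refine unE_iff.2 fun H i H' v hH hi he => ?_
    cases he with
    | deref h hl =>
      obtain ⟨θ₁, hc₁, hH₁, hv₁⟩ := (ih hγ).eval hH (by omega) h
      rw [UnV] at hv₁
      obtain ⟨_, heq, ha⟩ := hv₁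
      cases heq
      exact ⟨θ₁, hc₁, hH₁.mono (by omega), (hH₁.lookup ha hl (by omega)).sub hs⟩
  | assign _ _ hpc ih₁ ih₂ =>
    refine unE_iff.2 fun H i H' v hH hi he => ?_
    cases he with
    | assign h₁ h₂ ha =>
      obtain ⟨θ₁, hc₁, hH₁, hv₁⟩ := (ih₁ hγ).eval hH (by omega) h₁
      obtain ⟨θ₂, hc₂, hH₂, hv₂⟩ :=
        (ih₂ fun x => (hγ x).mono hc₁.le (by omega)).eval hH₁ (by omega) h₂
      rw [UnV] at hv₁
      obtain ⟨_, heq, ha⟩ := hv₁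
      cases heq
      have ha' := hc₂.le _ _ ha
      exact ⟨θ₂, (hc₁.trans hc₂).trans (.insert ha' (le_sup_left.trans hpc) _ _),
        (hH₂.insert ha' hv₂).mono (by omega), by rw [UnV]⟩
  | sub _ hpc hs ih =>
    refine unE_iff.2 fun H i H' v hH hi he => ?_
    obtain ⟨θ₁, hc, hH', hv⟩ := (ih hγ).eval hH hi he
    exact ⟨θ₁, hc.mono hpc, hH', hv.sub hs⟩

end Unary

/-! ### The binary model of FG -/

section Binary

variable {L : Type*} {B : Type*} {K : Type*}

theorem World.Le.refl (W : World L B) : W.Le W := ⟨.refl _, .refl _, .refl _⟩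

theorem World.Le.trans {W W' W'' : World L B} (h : W.Le W') (h' : W'.Le W'') : W.Le W'' :=
  ⟨h.1.trans h'.1, h.2.1.trans h'.2.1, h.2.2.trans h'.2.2⟩

variable [Lattice L] {ty : K → B} {A : L}

/-- At a label that the observer does not see, being related means being good. -/
theorem binV_iff_of_not_le {τ : FTy L B} {W : World L B} {n : ℕ} {v₁ v₂ : FExp K 0}
    (hτ : ¬ τ.lab ≤ A) :
    BinV ty A τ W n v₁ v₂ ↔ UnV ty τ W.θ₁ n v₁ ∧ UnV ty τ W.θ₂ n v₂ := by
  cases τ <;> rw [BinV] <;> exact ⟨fun h => h.1 hτ, fun h => ⟨fun _ => h, fun h' => absurd h' hτ⟩⟩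

/-- Related values are good in the unary sense. At function types this holds since the binary
relation demands it. -/
theorem BinV.unary {τ : FTy L B} {W : World L B} {n : ℕ} {v₁ v₂ : FExp K 0}
    (h : BinV ty A τ W n v₁ v₂) : UnV ty τ W.θ₁ n v₁ ∧ UnV ty τ W.θ₂ n v₂ := by
  induction τ generalizing v₁ v₂ with
  | base b ℓ =>
    by_cases hl : ℓ ≤ A
    · rw [BinV] at h
      obtain ⟨k, hk, rfl, rfl⟩ := h.2 hl
      rw [UnV, UnV]
      exact ⟨⟨k, hk, rfl⟩, ⟨k, hk, rfl⟩⟩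
    · exact (binV_iff_of_not_le hl).1 h
  | unit ℓ =>
    by_cases hl : ℓ ≤ A
    · rw [BinV] at h
      rw [UnV, UnV]
      exact h.2 hl
    · exact (binV_iff_of_not_le hl).1 h
  | arrow τ₁ ℓe τ₂ ℓ =>
    by_cases hl : ℓ ≤ A
    · rw [BinV] at h
      obtain ⟨_, _, _, _, _, h⟩ := h.2 hl
      exact h
    · exact (binV_iff_of_not_le hl).1 h
  | prod τ₁ τ₂ ℓ ih₁ ih₂ =>
    by_cases hl : ℓ ≤ A
    · rw [BinV] at h
      obtain ⟨u₁, u₁', u₂, u₂', rfl, rfl, h, h'⟩ := h.2 hl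
      rw [UnV, UnV]
      exact ⟨⟨u₁, u₁', rfl, (ih₁ h).1, (ih₂ h').1⟩, ⟨u₂, u₂', rfl, (ih₁ h).2, (ih₂ h').2⟩⟩
    · exact (binV_iff_of_not_le hl).1 h
  | sum τ₁ τ₂ ℓ ih₁ ih₂ =>
    by_cases hl : ℓ ≤ A
    · rw [BinV] at h
      rw [UnV, UnV]
      obtain ⟨u₁, u₂, rfl, rfl, hu⟩ | ⟨u₁, u₂, rfl, rfl, hu⟩ := h.2 hl
      · exact ⟨.inl ⟨u₁, rfl, (ih₁ hu).1⟩, .inl ⟨u₂, rfl, (ih₁ hu).2⟩⟩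
      · exact ⟨.inr ⟨u₁, rfl, (ih₂ hu).1⟩, .inr ⟨u₂, rfl, (ih₂ hu).2⟩⟩
    · exact (binV_iff_of_not_le hl).1 h
  | ref τ ℓ =>
    by_cases hl : ℓ ≤ A
    · rw [BinV] at h
      obtain ⟨a₁, a₂, rfl, rfl, -, h₁, h₂⟩ := h.2 hl
      rw [UnV, UnV]
      exact ⟨⟨a₁, rfl, h₁⟩, ⟨a₂, rfl, h₂⟩⟩
    · exact (binV_iff_of_not_le hl).1 h

theorem BinV.mono {τ : FTy L B} {W W' : World L B} {m m' : ℕ} {v₁ v₂ : FExp K 0}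
    (h : BinV ty A τ W m v₁ v₂) (hW : W.Le W') (hm : m' ≤ m) : BinV ty A τ W' m' v₁ v₂ := by
  have un {τ : FTy L B} {v₁ v₂ : FExp K 0} (h : UnV ty τ W.θ₁ m v₁ ∧ UnV ty τ W.θ₂ m v₂) :
      UnV ty τ W'.θ₁ m' v₁ ∧ UnV ty τ W'.θ₂ m' v₂ := ⟨h.1.mono hW.1 hm, h.2.mono hW.2.1 hm⟩
  induction τ generalizing v₁ v₂ with
  | base b ℓ => rw [BinV] at h ⊢; exact ⟨fun hl => un (h.1 hl), h.2⟩
  | unit ℓ => rw [BinV] at h ⊢; exact ⟨fun hl => un (h.1 hl), h.2⟩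
  | arrow τ₁ ℓe τ₂ ℓ =>
    rw [BinV] at h ⊢
    refine ⟨fun hl => un (h.1 hl), fun hl => ?_⟩
    obtain ⟨e₁, e₂, rfl, rfl, hu, hun⟩ := h.2 hl
    exact ⟨e₁, e₂, rfl, rfl, fun W₁ hW₁ j hj => hu W₁ (hW.trans hW₁) j (by omega), un hun⟩
  | prod τ₁ τ₂ ℓ ih₁ ih₂ =>
    rw [BinV] at h ⊢
    refine ⟨fun hl => un (h.1 hl), fun hl => ?_⟩
    obtain ⟨u₁, u₁', u₂, u₂', rfl, rfl, hu, hu'⟩ := h.2 hl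
    exact ⟨u₁, u₁', u₂, u₂', rfl, rfl, ih₁ hu, ih₂ hu'⟩
  | sum τ₁ τ₂ ℓ ih₁ ih₂ =>
    rw [BinV] at h ⊢
    refine ⟨fun hl => un (h.1 hl), fun hl => ?_⟩
    obtain ⟨u₁, u₂, rfl, rfl, hu⟩ | ⟨u₁, u₂, rfl, rfl, hu⟩ := h.2 hl
    · exact .inl ⟨u₁, u₂, rfl, rfl, ih₁ hu⟩
    · exact .inr ⟨u₁, u₂, rfl, rfl, ih₂ hu⟩
  | ref τ ℓ =>
    rw [BinV] at h ⊢
    refine ⟨fun hl => un (h.1 hl), fun hl => ?_⟩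
    obtain ⟨a₁, a₂, rfl, rfl, hab, h₁, h₂⟩ := h.2 hl
    exact ⟨a₁, a₂, rfl, rfl, hW.2.2 _ _ hab, hW.1 _ _ h₁, hW.2.1 _ _ h₂⟩

theorem BinV.scons {n : ℕ} {Γ : Fin n → FTy L B} {τ : FTy L B} {W : World L B} {m : ℕ}
    {γ₁ γ₂ : Fin n → FExp K 0} {v₁ v₂ : FExp K 0} (h : BinV ty A τ W m v₁ v₂)
    (hγ : ∀ i, BinV ty A (Γ i) W m (γ₁ i) (γ₂ i)) :
    ∀ i, BinV ty A (IFC.scons τ Γ i) W m (IFC.scons v₁ γ₁ i) (IFC.scons v₂ γ₂ i) :=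
  Fin.cases h hγ

theorem BinH.mono {n n' : ℕ} {H₁ H₂ : FHeap K} {W : World L B} (h : BinH ty A n H₁ H₂ W)
    (hn : n' ≤ n) : BinH ty A n' H₁ H₂ W := by
  rw [BinH] at h ⊢
  refine ⟨h.1.mono hn, h.2.1.mono hn, fun a₁ a₂ hab => ?_⟩
  obtain ⟨t, v₁, v₂, ht₁, ht₂, hv₁, hv₂, h⟩ := h.2.2 a₁ a₂ hab
  exact ⟨t, v₁, v₂, ht₁, ht₂, hv₁, hv₂, fun j hj => h j (by omega)⟩

theorem BinH.unary {n : ℕ} {H₁ H₂ : FHeap K} {W : World L B} (h : BinH ty A n H₁ H₂ W) :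
    UnH ty n H₁ W.θ₁ ∧ UnH ty n H₂ W.θ₂ := by
  rw [BinH] at h
  exact ⟨h.1, h.2.1⟩

theorem BinH.lookup {n : ℕ} {H₁ H₂ : FHeap K} {W : World L B} (h : BinH ty A n H₁ H₂ W)
    {a₁ a₂ : ℕ} (hab : W.β.rel a₁ a₂) {τ : FTy L B} (ha : W.θ₁ a₁ = some τ) {v₁ v₂ : FExp K 0}
    (hv₁ : H₁.lookup a₁ = some v₁) (hv₂ : H₂.lookup a₂ = some v₂) {j : ℕ} (hj : j < n) :
    BinV ty A τ W j v₁ v₂ := by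
  rw [BinH] at h
  obtain ⟨t, u₁, u₂, ht, -, hu₁, hu₂, h⟩ := h.2.2 a₁ a₂ hab
  obtain rfl := Option.some.inj (ha.symm.trans ht)
  obtain rfl := Option.some.inj (hv₁.symm.trans hu₁)
  obtain rfl := Option.some.inj (hv₂.symm.trans hu₂)
  exact h j hj

theorem BinH.insert {n : ℕ} {H₁ H₂ : FHeap K} {W : World L B} (h : BinH ty A n H₁ H₂ W)
    {a₁ a₂ : ℕ} (hab : W.β.rel a₁ a₂) {τ : FTy L B} (ha₁ : W.θ₁ a₁ = some τ)
    (ha₂ : W.θ₂ a₂ = some τ) {v₁ v₂ : FExp K 0} (hv : BinV ty A τ W n v₁ v₂) :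
    BinH ty A n (H₁.insert a₁ v₁) (H₂.insert a₂ v₂) W := by
  rw [BinH] at h ⊢
  refine ⟨h.1.insert ha₁ hv.unary.1, h.2.1.insert ha₂ hv.unary.2, fun b₁ b₂ hb => ?_⟩
  by_cases hba : b₁ = a₁
  · subst hba
    obtain rfl := W.β.functional hab hb
    exact ⟨τ, v₁, v₂, ha₁, ha₂, Finmap.lookup_insert _, Finmap.lookup_insert _,
      fun j hj => hv.mono (.refl _) hj.le⟩
  · have hba' : b₂ ≠ a₂ := by
      rintro rfl
      exact hba (W.β.injective hb hab)
    rw [Finmap.lookup_insert_of_ne _ hba, Finmap.lookup_insert_of_ne _ hba']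
    exact h.2.2 b₁ b₂ hb

theorem BinH.exists_insert_new {n : ℕ} {H₁ H₂ : FHeap K} {W : World L B}
    (h : BinH ty A n H₁ H₂ W) {a₁ a₂ : ℕ} (ha₁ : a₁ ∉ H₁) (ha₂ : a₂ ∉ H₂) {τ : FTy L B}
    {v₁ v₂ : FExp K 0} (hv : BinV ty A τ W n v₁ v₂) :
    ∃ W' : World L B, W.Le W' ∧ BinH ty A n (H₁.insert a₁ v₁) (H₂.insert a₂ v₂) W' ∧
      W'.β.rel a₁ a₂ ∧ W'.θ₁ a₁ = some τ ∧ W'.θ₂ a₂ = some τ := by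
  have hθ₁ := h.unary.1.eq_none ha₁
  have hθ₂ := h.unary.2.eq_none ha₂
  rw [BinH] at h
  obtain ⟨h₁, h₂, hrel⟩ := h
  have hβ₁ (b : ℕ) : ¬ W.β.rel a₁ b := fun hab => by
    obtain ⟨t, _, _, ht, -⟩ := hrel _ _ hab
    simp [hθ₁] at ht
  have hβ₂ (b : ℕ) : ¬ W.β.rel b a₂ := fun hab => by
    obtain ⟨t, _, _, -, ht, -⟩ := hrel _ _ hab
    simp [hθ₂] at ht
  let W' : World L B := ⟨Function.update W.θ₁ a₁ (some τ), Function.update W.θ₂ a₂ (some τ),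
    W.β.insert a₁ a₂ hβ₁ hβ₂⟩
  have hW : W.Le W' :=
    ⟨StoreTy.le_update hθ₁ τ, StoreTy.le_update hθ₂ τ, W.β.le_insert a₁ a₂ hβ₁ hβ₂⟩
  refine ⟨W', hW, ?_, .inl ⟨rfl, rfl⟩, Function.update_self .., Function.update_self ..⟩
  rw [BinH]
  refine ⟨h₁.insert_new ha₁ hv.unary.1, h₂.insert_new ha₂ hv.unary.2, fun b₁ b₂ hb => ?_⟩
  rcases hb with ⟨rfl, rfl⟩ | hb
  · exact ⟨τ, v₁, v₂, Function.update_self .., Function.update_self .., Finmap.lookup_insert _,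
      Finmap.lookup_insert _, fun j hj => hv.mono hW hj.le⟩
  · obtain ⟨t, u₁, u₂, ht₁, ht₂, hu₁, hu₂, hu⟩ := hrel b₁ b₂ hb
    refine ⟨t, u₁, u₂, hW.1 _ _ ht₁, hW.2.1 _ _ ht₂, ?_, ?_, fun j hj => (hu j hj).mono hW le_rfl⟩
    · rwa [Finmap.lookup_insert_of_ne]
      rintro rfl
      exact ha₁ (mem_of_lookup hu₁)
    · rwa [Finmap.lookup_insert_of_ne]
      rintro rfl
      exact ha₂ (mem_of_lookup hu₂)

/-- Two runs whose effects are confined to levels that the observer does not see preserve the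
relation of heaps: a corresponding pair of locations either keeps its contents in both runs or
has a type at which any two good values are related. -/
theorem BinH.of_confined {pc : L} {n n' : ℕ} {H₁ H₂ H₁' H₂' : FHeap K} {W : World L B}
    {θ₁ θ₂ : StoreTy (FTy L B)} (h : BinH ty A n H₁ H₂ W) (hpc : ¬ pc ≤ A)
    (hc₁ : Confined pc W.θ₁ θ₁ H₁ H₁') (hc₂ : Confined pc W.θ₂ θ₂ H₂ H₂')
    (h₁ : UnH ty n' H₁' θ₁) (h₂ : UnH ty n' H₂' θ₂) (hn : n' ≤ n) :
    BinH ty A n' H₁' H₂' ⟨θ₁, θ₂, W.β⟩ := by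
  have hW : W.Le ⟨θ₁, θ₂, W.β⟩ := ⟨hc₁.le, hc₂.le, .refl _⟩
  rw [BinH] at h ⊢
  refine ⟨h₁, h₂, fun a₁ a₂ hab => ?_⟩
  obtain ⟨t, v₁, v₂, ht₁, ht₂, hv₁, hv₂, h⟩ := h.2.2 a₁ a₂ hab
  by_cases hkeep : H₁.lookup a₁ = H₁'.lookup a₁ ∧ H₂.lookup a₂ = H₂'.lookup a₂
  · exact ⟨t, v₁, v₂, hc₁.le _ _ ht₁, hc₂.le _ _ ht₂, hkeep.1 ▸ hv₁, hkeep.2 ▸ hv₂,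
      fun j hj => (h j (by omega)).mono hW le_rfl⟩
  · have ht : ¬ t.lab ≤ A := by
      refine fun hl => hpc (le_trans ?_ hl)
      by_cases hne : H₁.lookup a₁ = H₁'.lookup a₁
      · exact hc₂.of_ne a₂ t ht₂ fun heq => hkeep ⟨hne, heq⟩
      · exact hc₁.of_ne a₁ t ht₁ hne
    rw [UnH] at h₁ h₂
    obtain ⟨u₁, hu₁, hu₁'⟩ := h₁ a₁ t (hc₁.le _ _ ht₁)
    obtain ⟨u₂, hu₂, hu₂'⟩ := h₂ a₂ t (hc₂.le _ _ ht₂)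
    exact ⟨t, u₁, u₂, hc₁.le _ _ ht₁, hc₂.le _ _ ht₂, hu₁, hu₂,
      fun j hj => (binV_iff_of_not_le ht).2 ⟨hu₁' j hj, hu₂' j hj⟩⟩

theorem BinE.eval {τ : FTy L B} {W : World L B} {n i j : ℕ} {e₁ e₂ v₁ v₂ : FExp K 0}
    {H₁ H₂ H₁' H₂' : FHeap K} (h : BinE ty A τ W n e₁ e₂) (hH : BinH ty A n H₁ H₂ W)
    (hij : i + j < n) (he₁ : FEval H₁ e₁ i H₁' v₁) (he₂ : FEval H₂ e₂ j H₂' v₂) :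
    ∃ W' : World L B, W.Le W' ∧ BinH ty A (n - (i + j)) H₁' H₂' W' ∧
      BinV ty A τ W' (n - (i + j)) v₁ v₂ := by
  rw [BinE] at h
  exact h H₁ H₂ i j H₁' H₂' v₁ v₂ hH hij he₁ he₂

/-- Any two good expressions are related if neither their effects nor their values can be
observed. -/
theorem BinE.of_unE {pc : L} {τ : FTy L B} {W : World L B} {n : ℕ} {e₁ e₂ : FExp K 0}
    (hpc : ¬ pc ≤ A) (hτ : ¬ τ.lab ≤ A) (h₁ : UnE ty pc τ W.θ₁ n e₁)
    (h₂ : UnE ty pc τ W.θ₂ n e₂) : BinE ty A τ W n e₁ e₂ := by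
  rw [BinE]
  intro H₁ H₂ i j H₁' H₂' v₁ v₂ hH hij he₁ he₂
  obtain ⟨θ₁, hc₁, hH₁, hv₁⟩ := h₁.eval hH.unary.1 (by omega) he₁
  obtain ⟨θ₂, hc₂, hH₂, hv₂⟩ := h₂.eval hH.unary.2 (by omega) he₂
  exact ⟨⟨θ₁, θ₂, W.β⟩, ⟨hc₁.le, hc₂.le, .refl _⟩,
    hH.of_confined hpc hc₁ hc₂ (hH₁.mono (by omega)) (hH₂.mono (by omega)) (by omega),
    (binV_iff_of_not_le hτ).2
      ⟨hv₁.mono (.refl _) (by omega), hv₂.mono (.refl _) (by omega)⟩⟩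

theorem BinV.sub {τ τ' : FTy L B} (hs : FSub τ τ') {W : World L B} {m : ℕ} {v₁ v₂ : FExp K 0}
    (h : BinV ty A τ W m v₁ v₂) : BinV ty A τ' W m v₁ v₂ := by
  have hun := h.unary
  induction hs generalizing W m v₁ v₂ with
  | @base b ℓ ℓ' hle =>
    rw [BinV] at h ⊢
    exact ⟨fun _ => ⟨hun.1.sub (.base hle), hun.2.sub (.base hle)⟩, fun hl => h.2 (hle.trans hl)⟩
  | @unit ℓ ℓ' hle =>
    rw [BinV] at h ⊢
    exact ⟨fun _ => ⟨hun.1.sub (.unit hle), hun.2.sub (.unit hle)⟩, fun hl => h.2 (hle.trans hl)⟩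
  | arrow hs₁ hs₂ hpc hle ih₁ ih₂ =>
    have hun' := And.intro (hun.1.sub (.arrow hs₁ hs₂ hpc hle))
      (hun.2.sub (.arrow hs₁ hs₂ hpc hle))
    rw [BinV] at h ⊢
    refine ⟨fun _ => hun', fun hl => ?_⟩
    obtain ⟨e₁, e₂, rfl, rfl, h, -⟩ := h.2 (hle.trans hl)
    refine ⟨e₁, e₂, rfl, rfl, fun W' hW j hj u₁ u₂ hu => ?_, hun'⟩
    have h := h W' hW j hj u₁ u₂ (ih₁ hu hu.unary)
    rw [BinE]
    intro H₁ H₂ i j H₁' H₂' v₁ v₂ hH hij he₁ he₂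
    obtain ⟨W'', hW', hH', hv⟩ := h.eval hH hij he₁ he₂
    exact ⟨W'', hW', hH', ih₂ hv hv.unary⟩
  | prod hs₁ hs₂ hle ih₁ ih₂ =>
    have hun' := And.intro (hun.1.sub (.prod hs₁ hs₂ hle)) (hun.2.sub (.prod hs₁ hs₂ hle))
    rw [BinV] at h ⊢
    refine ⟨fun _ => hun', fun hl => ?_⟩
    obtain ⟨u₁, u₁', u₂, u₂', rfl, rfl, h, h'⟩ := h.2 (hle.trans hl)
    exact ⟨u₁, u₁', u₂, u₂', rfl, rfl, ih₁ h h.unary, ih₂ h' h'.unary⟩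
  | sum hs₁ hs₂ hle ih₁ ih₂ =>
    have hun' := And.intro (hun.1.sub (.sum hs₁ hs₂ hle)) (hun.2.sub (.sum hs₁ hs₂ hle))
    rw [BinV] at h ⊢
    refine ⟨fun _ => hun', fun hl => ?_⟩
    obtain ⟨u₁, u₂, rfl, rfl, hu⟩ | ⟨u₁, u₂, rfl, rfl, hu⟩ := h.2 (hle.trans hl)
    · exact .inl ⟨u₁, u₂, rfl, rfl, ih₁ hu hu.unary⟩
    · exact .inr ⟨u₁, u₂, rfl, rfl, ih₂ hu hu.unary⟩
  | @ref τ ℓ ℓ' hle =>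
    rw [BinV] at h ⊢
    exact ⟨fun _ => ⟨hun.1.sub (.ref hle), hun.2.sub (.ref hle)⟩, fun hl => h.2 (hle.trans hl)⟩

/-- Inversion of the evaluation of a case distinction, uniformly in the branch taken. -/
theorem FEval.caseOf_inv {H H' : FHeap K} {e v : FExp K 0} {e₁ e₂ : FExp K 1} {i : ℕ}
    (h : FEval H (.caseOf e e₁ e₂) i H' v) :
    ∃ (j k : ℕ) (H₁ : FHeap K) (s f : FExp K 0), i = j + k + 1 ∧ FEval H e j H₁ s ∧
      FEval H₁ f k H' v ∧
      ((∃ u, s = .inl u ∧ f = e₁.inst u) ∨ (∃ u, s = .inr u ∧ f = e₂.inst u)) := by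
  cases h with
  | caseInl h h' => exact ⟨_, _, _, _, _, rfl, h, h', .inl ⟨_, rfl, rfl⟩⟩
  | caseInr h h' => exact ⟨_, _, _, _, _, rfl, h, h', .inr ⟨_, rfl, rfl⟩⟩

variable [BoundedOrder L]

/-- The binary fundamental theorem. Where a secret is eliminated, the two runs may take different
paths; then the elimination rules make both the effects and the result unobservable, and the unary
fundamental theorem applies. -/
theorem FTyped.binE {n : ℕ} {Γ : Fin n → FTy L B} {pc : L} {e : FExp K n} {τ : FTy L B}
    (h : FTyped ty Γ pc e τ) {W : World L B} {m : ℕ} {γ₁ γ₂ : Fin n → FExp K 0}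
    (hγ : ∀ i, BinV ty A (Γ i) W m (γ₁ i) (γ₂ i)) :
    BinE ty A τ W m (e.subst γ₁) (e.subst γ₂) := by
  induction h generalizing W m with
  | var x =>
    rw [BinE]
    intro H₁ H₂ i j H₁' H₂' v₁ v₂ hH hij he₁ he₂
    obtain ⟨rfl, rfl⟩ := (hγ x).unary.1.isVal.eq_of_eval he₁
    obtain ⟨rfl, rfl⟩ := (hγ x).unary.2.isVal.eq_of_eval he₂
    exact ⟨W, .refl _, hH.mono (by omega), (hγ x).mono (.refl _) (by omega)⟩
  | const k =>
    rw [BinE]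
    intro H₁ H₂ i j H₁' H₂' v₁ v₂ hH hij he₁ he₂
    cases he₁
    cases he₂
    refine ⟨W, .refl _, hH.mono (by omega), ?_⟩
    rw [BinV]
    exact ⟨fun h => absurd bot_le h, fun _ => ⟨k, rfl, rfl, rfl⟩⟩
  | unit =>
    rw [BinE]
    intro H₁ H₂ i j H₁' H₂' v₁ v₂ hH hij he₁ he₂
    cases he₁
    cases he₂
    refine ⟨W, .refl _, hH.mono (by omega), ?_⟩
    rw [BinV]
    exact ⟨fun h => absurd bot_le h, fun _ => ⟨rfl, rfl⟩⟩
  | @lam n Γ pc ℓe e τ₁ τ₂ h ih =>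
    rw [BinE]
    intro H₁ H₂ i j H₁' H₂' v₁ v₂ hH hij he₁ he₂
    cases he₁
    cases he₂
    refine ⟨W, .refl _, hH.mono (by omega), ?_⟩
    rw [BinV]
    refine ⟨fun h => absurd bot_le h, fun _ => ⟨_, _, rfl, rfl, fun W' hW j hj u₁ u₂ hu => ?_, ?_⟩⟩
    · rw [FExp.inst_subst_lift, FExp.inst_subst_lift]
      exact ih (hu.scons fun x => (hγ x).mono hW (by omega))
    · constructor
      · rw [UnV]
        refine ⟨_, rfl, fun θ' hθ j hj v' hv => ?_⟩
        rw [FExp.inst_subst_lift]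
        exact h.unE (hv.scons fun x => (hγ x).unary.1.mono hθ (by omega))
      · rw [UnV]
        refine ⟨_, rfl, fun θ' hθ j hj v' hv => ?_⟩
        rw [FExp.inst_subst_lift]
        exact h.unE (hv.scons fun x => (hγ x).unary.2.mono hθ (by omega))
  | @app n Γ pc ℓe ℓ e₁ e₂ τ₁ τ₂ _ _ hpc hlab ih₁ ih₂ =>
    rw [BinE]
    intro H₁ H₂ i j H₁' H₂' v₁ v₂ hH hij he₁ he₂
    cases he₁ with
    | @app _ H₁₁ H₁₂ _ _ _ f₁ u₁ _ i₁ i₂ i₃ h₁ h₁' h₁'' =>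
    cases he₂ with
    | @app _ H₂₁ H₂₂ _ _ _ f₂ u₂ _ j₁ j₂ j₃ h₂ h₂' h₂'' =>
    obtain ⟨W₁, hW₁, hH₁, hv₁⟩ := (ih₁ hγ).eval hH (by omega) h₁ h₂
    obtain ⟨W₂, hW₂, hH₂, hv₂⟩ :=
      (ih₂ fun x => (hγ x).mono hW₁ (by omega)).eval hH₁ (by omega) h₁' h₂'
    -- The step of the application itself pays for the strict decrease of the index that the
    -- function relation asks for.
    have hbody : BinE ty A τ₂ W₂ (m - (i₁ + j₁ + i₂ + j₂ + 1)) (f₁.inst u₁) (f₂.inst u₂) := by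
      have hu := hv₂.mono (.refl _) (show m - (i₁ + j₁ + i₂ + j₂ + 1) ≤ _ by omega)
      by_cases hl : ℓ ≤ A
      · rw [BinV] at hv₁
        obtain ⟨_, _, heq₁, heq₂, hv₁, -⟩ := hv₁.2 hl
        cases heq₁
        cases heq₂
        exact hv₁ W₂ hW₂ _ (by omega) _ _ hu
      · have hun := hv₁.unary
        rw [UnV, UnV] at hun
        obtain ⟨⟨_, heq₁, hf₁⟩, ⟨_, heq₂, hf₂⟩⟩ := hun
        cases heq₁
        cases heq₂
        exact .of_unE (fun h => hl (le_sup_left.trans (hpc.trans h)))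
          (fun h => hl (hlab.trans h)) (hf₁ _ hW₂.1 _ (by omega) _ hu.unary.1)
          (hf₂ _ hW₂.2.1 _ (by omega) _ hu.unary.2)
    obtain ⟨W₃, hW₃, hH₃, hv₃⟩ := hbody.eval (hH₂.mono (by omega)) (by omega) h₁'' h₂''
    exact ⟨W₃, (hW₁.trans hW₂).trans hW₃, hH₃.mono (by omega), hv₃.mono (.refl _) (by omega)⟩
  | pair _ _ ih₁ ih₂ =>
    rw [BinE]
    intro H₁ H₂ i j H₁' H₂' v₁ v₂ hH hij he₁ he₂
    cases he₁ with | pair h₁ h₁' =>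
    cases he₂ with | pair h₂ h₂' =>
    obtain ⟨W₁, hW₁, hH₁, hv₁⟩ := (ih₁ hγ).eval hH (by omega) h₁ h₂
    obtain ⟨W₂, hW₂, hH₂, hv₂⟩ :=
      (ih₂ fun x => (hγ x).mono hW₁ (by omega)).eval hH₁ (by omega) h₁' h₂'
    refine ⟨W₂, hW₁.trans hW₂, hH₂.mono (by omega), ?_⟩
    rw [BinV]
    exact ⟨fun h => absurd bot_le h, fun _ => ⟨_, _, _, _, rfl, rfl, hv₁.mono hW₂ (by omega),
      hv₂.mono (.refl _) (by omega)⟩⟩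
  | @fst n Γ pc ℓ e τ₁ τ₂ _ hlab ih =>
    rw [BinE]
    intro H₁ H₂ i j H₁' H₂' v₁ v₂ hH hij he₁ he₂
    cases he₁ with | fst h₁ =>
    cases he₂ with | fst h₂ =>
    obtain ⟨W₁, hW₁, hH₁, hv⟩ := (ih hγ).eval hH (by omega) h₁ h₂
    refine ⟨W₁, hW₁, hH₁.mono (by omega), ?_⟩
    by_cases hl : ℓ ≤ A
    · rw [BinV] at hv
      obtain ⟨_, _, _, _, heq₁, heq₂, hv, -⟩ := hv.2 hl
      cases heq₁
      cases heq₂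
      exact hv.mono (.refl _) (by omega)
    · have hun := hv.unary
      rw [UnV, UnV] at hun
      obtain ⟨⟨_, _, heq₁, hv₁, -⟩, ⟨_, _, heq₂, hv₂, -⟩⟩ := hun
      cases heq₁
      cases heq₂
      exact (binV_iff_of_not_le fun h => hl (hlab.trans h)).2
        ⟨hv₁.mono (.refl _) (by omega), hv₂.mono (.refl _) (by omega)⟩
  | @snd n Γ pc ℓ e τ₁ τ₂ _ hlab ih =>
    rw [BinE]
    intro H₁ H₂ i j H₁' H₂' v₁ v₂ hH hij he₁ he₂
    cases he₁ with | snd h₁ =>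
    cases he₂ with | snd h₂ =>
    obtain ⟨W₁, hW₁, hH₁, hv⟩ := (ih hγ).eval hH (by omega) h₁ h₂
    refine ⟨W₁, hW₁, hH₁.mono (by omega), ?_⟩
    by_cases hl : ℓ ≤ A
    · rw [BinV] at hv
      obtain ⟨_, _, _, _, heq₁, heq₂, -, hv⟩ := hv.2 hl
      cases heq₁
      cases heq₂
      exact hv.mono (.refl _) (by omega)
    · have hun := hv.unary
      rw [UnV, UnV] at hun
      obtain ⟨⟨_, _, heq₁, -, hv₁⟩, ⟨_, _, heq₂, -, hv₂⟩⟩ := hun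
      cases heq₁
      cases heq₂
      exact (binV_iff_of_not_le fun h => hl (hlab.trans h)).2
        ⟨hv₁.mono (.refl _) (by omega), hv₂.mono (.refl _) (by omega)⟩
  | inl _ ih =>
    rw [BinE]
    intro H₁ H₂ i j H₁' H₂' v₁ v₂ hH hij he₁ he₂
    cases he₁ with | inl h₁ =>
    cases he₂ with | inl h₂ =>
    obtain ⟨W₁, hW₁, hH₁, hv⟩ := (ih hγ).eval hH (by omega) h₁ h₂
    refine ⟨W₁, hW₁, hH₁.mono (by omega), ?_⟩
    rw [BinV]
    exact ⟨fun h => absurd bot_le h, fun _ => .inl ⟨_, _, rfl, rfl, hv.mono (.refl _) (by omega)⟩⟩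
  | inr _ ih =>
    rw [BinE]
    intro H₁ H₂ i j H₁' H₂' v₁ v₂ hH hij he₁ he₂
    cases he₁ with | inr h₁ =>
    cases he₂ with | inr h₂ =>
    obtain ⟨W₁, hW₁, hH₁, hv⟩ := (ih hγ).eval hH (by omega) h₁ h₂
    refine ⟨W₁, hW₁, hH₁.mono (by omega), ?_⟩
    rw [BinV]
    exact ⟨fun h => absurd bot_le h, fun _ => .inr ⟨_, _, rfl, rfl, hv.mono (.refl _) (by omega)⟩⟩
  | @caseOf n Γ pc ℓ e e₁ e₂ τ₁ τ₂ τ _ ht₁ ht₂ hlab ih ih₁ ih₂ =>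
    rw [BinE]
    intro H₁ H₂ i j H₁' H₂' v₁ v₂ hH hij he₁ he₂
    obtain ⟨i, i', H₁₁, s₁, f₁, rfl, h₁, h₁', hs₁⟩ := he₁.caseOf_inv
    obtain ⟨j, j', H₂₁, s₂, f₂, rfl, h₂, h₂', hs₂⟩ := he₂.caseOf_inv
    simp only [FExp.inst_subst_lift] at hs₁ hs₂
    obtain ⟨W₁, hW₁, hH₁, hv⟩ := (ih hγ).eval hH (by omega) h₁ h₂
    have hγ' (x) := (hγ x).mono hW₁ (Nat.sub_le m (i + j))
    have hbody : BinE ty A τ W₁ (m - (i + j)) f₁ f₂ := by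
      by_cases hl : ℓ ≤ A
      · rw [BinV] at hv
        obtain ⟨u₁, u₂, rfl, rfl, hu⟩ | ⟨u₁, u₂, rfl, rfl, hu⟩ := hv.2 hl
        · obtain ⟨_, heq₁, rfl⟩ | ⟨_, heq₁, -⟩ := hs₁ <;> cases heq₁
          obtain ⟨_, heq₂, rfl⟩ | ⟨_, heq₂, -⟩ := hs₂ <;> cases heq₂
          exact ih₁ (hu.scons hγ')
        · obtain ⟨_, heq₁, -⟩ | ⟨_, heq₁, rfl⟩ := hs₁ <;> cases heq₁
          obtain ⟨_, heq₂, -⟩ | ⟨_, heq₂, rfl⟩ := hs₂ <;> cases heq₂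
          exact ih₂ (hu.scons hγ')
      -- The scrutinee is secret, and the two runs may take different branches.
      · have branch {θ : StoreTy (FTy L B)} {n' : ℕ} {γ : Fin n → FExp K 0} {s f : FExp K 0}
            (hγ : ∀ x, UnV ty (Γ x) θ n' (γ x)) (hs : UnV ty (.sum τ₁ τ₂ ℓ) θ n' s)
            (hf : (∃ u, s = .inl u ∧ f = e₁.subst (scons u γ)) ∨
              (∃ u, s = .inr u ∧ f = e₂.subst (scons u γ))) :
            UnE ty (pc ⊔ ℓ) τ θ n' f := by
          rw [UnV] at hs
          obtain ⟨_, rfl, hu⟩ | ⟨_, rfl, hu⟩ := hs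
          · obtain ⟨_, heq, rfl⟩ | ⟨_, heq, -⟩ := hf <;> cases heq
            exact ht₁.unE (hu.scons hγ)
          · obtain ⟨_, heq, -⟩ | ⟨_, heq, rfl⟩ := hf <;> cases heq
            exact ht₂.unE (hu.scons hγ)
        exact .of_unE (fun h => hl (le_sup_right.trans h)) (fun h => hl (hlab.trans h))
          (branch (fun x => (hγ' x).unary.1) hv.unary.1 hs₁)
          (branch (fun x => (hγ' x).unary.2) hv.unary.2 hs₂)
    obtain ⟨W₂, hW₂, hH₂, hv₂⟩ := hbody.eval hH₁ (by omega) h₁' h₂'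
    exact ⟨W₂, hW₁.trans hW₂, hH₂.mono (by omega), hv₂.mono (.refl _) (by omega)⟩
  | newRef _ _ ih =>
    rw [BinE]
    intro H₁ H₂ i j H₁' H₂' v₁ v₂ hH hij he₁ he₂
    cases he₁ with | newRef h₁ ha₁ =>
    cases he₂ with | newRef h₂ ha₂ =>
    obtain ⟨W₁, hW₁, hH₁, hv⟩ := (ih hγ).eval hH (by omega) h₁ h₂
    obtain ⟨W₂, hW₂, hH₂, hab, hθ₁, hθ₂⟩ := hH₁.exists_insert_new ha₁ ha₂ hv
    refine ⟨W₂, hW₁.trans hW₂, hH₂.mono (by omega), ?_⟩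
    rw [BinV]
    exact ⟨fun h => absurd bot_le h, fun _ => ⟨_, _, rfl, rfl, hab, hθ₁, hθ₂⟩⟩
  | @deref n Γ pc ℓ e τ τ' _ hs hlab ih =>
    rw [BinE]
    intro H₁ H₂ i j H₁' H₂' v₁ v₂ hH hij he₁ he₂
    cases he₁ with | deref h₁ hl₁ =>
    cases he₂ with | deref h₂ hl₂ =>
    obtain ⟨W₁, hW₁, hH₁, hv⟩ := (ih hγ).eval hH (by omega) h₁ h₂
    refine ⟨W₁, hW₁, hH₁.mono (by omega), ?_⟩
    by_cases hl : ℓ ≤ A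
    · rw [BinV] at hv
      obtain ⟨_, _, heq₁, heq₂, hab, hθ₁, -⟩ := hv.2 hl
      cases heq₁
      cases heq₂
      exact (hH₁.lookup hab hθ₁ hl₁ hl₂ (by omega)).sub hs
    · have hun := hv.unary
      rw [UnV, UnV] at hun
      obtain ⟨⟨_, heq₁, hθ₁⟩, ⟨_, heq₂, hθ₂⟩⟩ := hun
      cases heq₁
      cases heq₂
      exact (binV_iff_of_not_le fun h => hl (hlab.trans h)).2
        ⟨(hH₁.unary.1.lookup hθ₁ hl₁ (by omega)).sub hs,
          (hH₁.unary.2.lookup hθ₂ hl₂ (by omega)).sub hs⟩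
  | @assign n Γ pc ℓ e₁ e₂ τ _ _ hpc ih₁ ih₂ =>
    rw [BinE]
    intro H₁ H₂ i j H₁' H₂' v₁ v₂ hH hij he₁ he₂
    cases he₁ with | assign h₁ h₁' ha₁ =>
    cases he₂ with | assign h₂ h₂' ha₂ =>
    obtain ⟨W₁, hW₁, hH₁, hv₁⟩ := (ih₁ hγ).eval hH (by omega) h₁ h₂
    obtain ⟨W₂, hW₂, hH₂, hv₂⟩ :=
      (ih₂ fun x => (hγ x).mono hW₁ (by omega)).eval hH₁ (by omega) h₁' h₂'
    refine ⟨W₂, hW₁.trans hW₂, ?_, ?_⟩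
    · by_cases hl : ℓ ≤ A
      · rw [BinV] at hv₁
        obtain ⟨_, _, heq₁, heq₂, hab, hθ₁, hθ₂⟩ := hv₁.2 hl
        cases heq₁
        cases heq₂
        exact (hH₂.insert (hW₂.2.2 _ _ hab) (hW₂.1 _ _ hθ₁) (hW₂.2.1 _ _ hθ₂) hv₂).mono (by omega)
      · have hun := hv₁.unary
        rw [UnV, UnV] at hun
        obtain ⟨⟨_, heq₁, hθ₁⟩, ⟨_, heq₂, hθ₂⟩⟩ := hun
        cases heq₁
        cases heq₂
        have hθ₁' := hW₂.1 _ _ hθ₁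
        have hθ₂' := hW₂.2.1 _ _ hθ₂
        exact (hH₂.of_confined (fun h => hl (le_sup_right.trans (hpc.trans h)))
          (.insert hθ₁' le_rfl _ _) (.insert hθ₂' le_rfl _ _)
          (hH₂.unary.1.insert hθ₁' hv₂.unary.1) (hH₂.unary.2.insert hθ₂' hv₂.unary.2) le_rfl).mono
            (by omega)
    · rw [BinV]
      exact ⟨fun h => absurd bot_le h, fun _ => ⟨rfl, rfl⟩⟩
  | sub _ _ hs ih =>
    rw [BinE]
    intro H₁ H₂ i j H₁' H₂' v₁ v₂ hH hij he₁ he₂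
    obtain ⟨W₁, hW₁, hH₁, hv⟩ := (ih hγ).eval hH hij he₁ he₂
    exact ⟨W₁, hW₁, hH₁, hv.sub hs⟩

end Binary

/-! ### Noninterference for CG -/

section Noninterference

variable {L : Type*} {B : Type*} {K : Type*} [Lattice L] [BoundedOrder L] {ty : K → B}

theorem CTrans.crossE_closed {e : CExp K 0} {τ : CTy L B} {f : FExp K 0}
    (h : CTrans ty Fin.elim0 e τ f) (n : ℕ) :
    CrossE ty τ (fun _ => none) n .empty e f := by
  have := h.crossE (θ := fun _ => none) (m := n) (β := .empty) (δs := Fin.elim0)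
    (δt := Fin.elim0) fun i => i.elim0
  rwa [CExp.subst_closed, FExp.subst_closed] at this

/-- A closed well-typed CG value has a counterpart in FG, which is a good value for any number of
steps. -/
theorem CTyped.exists_crossV {v : CExp K 0} {τ : CTy L B} (h : CTyped ty Fin.elim0 v τ)
    (hv : CVal v) (n : ℕ) :
    ∃ w : FExp K 0, CrossV ty τ (fun _ => none) n .empty v w ∧
      ∀ m, UnV ty τ.trans (fun _ => none) m w := by
  obtain ⟨i, hi⟩ := hv.exists_eval
  obtain ⟨j, w, hw, hvw⟩ :=
    (h.translate.crossE_closed (n + i + 1)).eval (by omega) hi (∅ : FHeap K)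
  refine ⟨w, hvw.mono (.refl _) (by omega) (.refl _), fun m => ?_⟩
  have hun := h.translate.typed.unE (θ := fun _ => none) (m := m + j + 1) (γ := Fin.elim0)
    fun i => i.elim0
  rw [FExp.subst_closed] at hun
  obtain ⟨θ', -, hH, hw'⟩ := hun.eval (unH_empty _ _) (by omega) hw
  -- The run ends in the empty heap, which can only have the empty store typing.
  obtain rfl : θ' = fun _ => none := funext fun a => hH.eq_none Finmap.notMem_empty
  exact hw'.mono (.refl _) (by omega)

/-- CG booleans are equal if they have FG counterparts that an observer relates: the translation
of `bool` is labeled `⊥` and so visible to everyone. -/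
theorem eq_of_crossV_bool {θ θ' : StoreTy (CTy L B)} {m m' : ℕ} {β β' : PBij}
    {r₁ r₂ : CExp K 0} {w₁ w₂ : FExp K 0} {A : L} {W : World L B} {n : ℕ}
    (h₁ : CrossV ty (CTy.bool L B) θ m β r₁ w₁) (h₂ : CrossV ty (CTy.bool L B) θ' m' β' r₂ w₂)
    (h : BinV ty A (CTy.bool L B).trans W n w₁ w₂) : r₁ = r₂ := by
  simp only [CTy.bool, CrossV] at h₁ h₂
  simp only [CTy.bool, CTy.trans] at h
  rw [BinV] at h
  obtain ⟨_, _, rfl, rfl, rfl, rfl⟩ | ⟨_, _, rfl, rfl, rfl, rfl⟩ := h₁ <;>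
    obtain ⟨_, _, rfl, rfl, rfl, rfl⟩ | ⟨_, _, rfl, rfl, rfl, rfl⟩ := h₂
  · rfl
  · obtain ⟨_, _, _, h₂, -⟩ | ⟨_, _, h₁, -⟩ := h.2 bot_le
    · cases h₂
    · cases h₁
  · obtain ⟨_, _, h₁, -⟩ | ⟨_, _, _, h₂, -⟩ := h.2 bot_le
    · cases h₁
    · cases h₂
  · rfl

/-- Noninterference for CG, by simulation in FG. The FG runs start in the empty heap, whatever the
heaps of the CG runs are: a program without locations depends on the locations it creates only. -/
theorem noninterference {ℓi ℓ ℓ' : L} {τ : CTy L B} {e : CExp K 1} {v₁ v₂ : CExp K 0}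
    (hℓ : ¬ ℓi ≤ ℓ)
    (he : CTyped ty (scons (.labeled ℓi τ) Fin.elim0) e (.comp ℓ' ℓ (CTy.bool L B)))
    (hv₁ : CVal v₁) (hv₂ : CVal v₂) (ht₁ : CTyped ty Fin.elim0 v₁ (.labeled ℓi τ))
    (ht₂ : CTyped ty Fin.elim0 v₂ (.labeled ℓi τ)) {i₁ i₂ j₁ j₂ : ℕ} {c₁ c₂ r₁ r₂ : CExp K 0}
    {H₁ H₂ H₁' H₂' : CHeap K} (he₁ : CEval (e.inst v₁) i₁ c₁) (hf₁ : CForce H₁ c₁ j₁ H₁' r₁)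
    (he₂ : CEval (e.inst v₂) i₂ c₂) (hf₂ : CForce H₂ c₂ j₂ H₂' r₂) : r₁ = r₂ := by
  have simulate {v c r : CExp K 0} {i j : ℕ} {H H' : CHeap K} (hv : CVal v)
      (ht : CTyped ty Fin.elim0 v (.labeled ℓi τ)) (he' : CEval (e.inst v) i c)
      (hf : CForce H c j H' r) : ∃ (w : FExp K 0) (k : ℕ) (Ht : FHeap K) (u : FExp K 0),
        (∀ m, UnV ty (CTy.labeled ℓi τ).trans (fun _ => none : StoreTy (FTy L B)) m w) ∧
        FEval ∅ (.app (e.translate.subst (scons w FExp.var)) .unit) k Ht (.inl u) ∧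
        ∃ (θ : StoreTy (CTy L B)) (m : ℕ) (β : PBij), CrossV ty (CTy.bool L B) θ m β r u := by
    obtain ⟨w, hw, hun⟩ := ht.exists_crossV hv (i + j + 1)
    obtain ⟨k, Ht, u, hk, θ, β, -, -, -, hu⟩ :=
      (he.translate.crossE (hw.scons (δs := CExp.var) (δt := FExp.var) fun i => i.elim0)).run
        (crossH_empty H ∅) (by omega) he' hf
    exact ⟨w, k, Ht, u, hun, hk, θ, _, β, hu⟩
  obtain ⟨w₁, k₁, _, u₁, hun₁, hk₁, _, _, _, hu₁⟩ := simulate hv₁ ht₁ he₁ hf₁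
  obtain ⟨w₂, k₂, _, u₂, hun₂, hk₂, _, _, _, hu₂⟩ := simulate hv₂ ht₂ he₂ hf₂
  have htyped := FTyped.run he.translate.typed bot_le
  -- The inputs are secret to the observer at level `ℓ`: they are related because both are good.
  have hrel := htyped.binE (A := ℓ) (W := ⟨fun _ => none, fun _ => none, .empty⟩)
    (m := k₁ + k₂ + 1) (γ₁ := scons w₁ FExp.var) (γ₂ := scons w₂ FExp.var)
    (Fin.cases ((binV_iff_of_not_le hℓ).2 ⟨hun₁ _, hun₂ _⟩) fun i => i.elim0)
  have hH : BinH ty ℓ (k₁ + k₂ + 1) (∅ : FHeap K) ∅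
      (⟨fun _ => none, fun _ => none, .empty⟩ : World L B) := by
    rw [BinH]
    exact ⟨unH_empty _ _, unH_empty _ _, fun _ _ h => h.elim⟩
  obtain ⟨W, -, -, hu⟩ := hrel.eval hH (by omega) hk₁ hk₂
  rw [FTy.opt, BinV] at hu
  obtain ⟨_, _, heq₁, heq₂, hu⟩ | ⟨_, _, heq₁, -⟩ := hu.2 le_rfl <;> cases heq₁
  cases heq₂
  exact eq_of_crossV_bool hu₁ hu₂ hu

end Noninterference

end IFC

theorem mainTheorem6 {L : Type*} {B : Type*} {K : Type*} [Lattice L] [BoundedOrder L]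
    (ty : K → B) :
    -- the translation is defined on all well-typed terms, unique, and preserves typing
    (∀ (n : ℕ) (Γ : Fin n → CTy L B) (e : CExp K n) (τ : CTy L B), CTyped ty Γ e τ →
      (∃! f : FExp K n, CTrans ty Γ e τ f) ∧
      ∀ f : FExp K n, CTrans ty Γ e τ f → FTyped ty (fun i => (Γ i).trans) ⊤ f τ.trans) ∧
    -- fundamental theorem of the cross-language relation
    (∀ (n : ℕ) (Γ : Fin n → CTy L B) (e : CExp K n) (τ : CTy L B) (f : FExp K n),
      CTrans ty Γ e τ f →
      ∀ (θ : StoreTy (CTy L B)) (m : ℕ) (β : PBij) (δs : Fin n → CExp K 0)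
        (δt : Fin n → FExp K 0),
        (∀ i, CrossV ty (Γ i) θ m β (δs i) (δt i)) →
        CrossE ty τ θ m β (e.subst δs) (f.subst δt)) ∧
    -- the translation preserves the results of closed pure programs of ground type
    (∀ (e : CExp K 0) (τ : CTy L B) (f : FExp K 0), CTrans ty Fin.elim0 e τ f → τ.Ground →
      ∀ (i : ℕ) (v : CExp K 0), CEval e i v →
        ∀ Ht : FHeap K, ∃ (i' : ℕ) (w : FExp K 0), FEval Ht f i' Ht w ∧ SameData v w) ∧
    -- the translation preserves the results of closed computations of ground output type
    (∀ (e : CExp K 0) (ℓ₁ ℓ₂ : L) (τ : CTy L B) (f : FExp K 0),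
      CTrans ty Fin.elim0 e (.comp ℓ₁ ℓ₂ τ) f → τ.Ground →
      ∀ (i j : ℕ) (c v : CExp K 0) (Hs Hs' : CHeap K), CEval e i c → CForce Hs c j Hs' v →
        ∀ Ht : FHeap K, ∃ (i' : ℕ) (Ht' : FHeap K) (w : FExp K 0),
          FEval Ht (.app f .unit) i' Ht' (.inl w) ∧ SameData v w) ∧
    -- binary fundamental theorem of FG
    (∀ (A : L) (n : ℕ) (Γ : Fin n → FTy L B) (pc : L) (e : FExp K n) (τ : FTy L B),
      FTyped ty Γ pc e τ →
      ∀ (W : World L B) (m : ℕ) (γ₁ γ₂ : Fin n → FExp K 0),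
        (∀ i, BinV ty A (Γ i) W m (γ₁ i) (γ₂ i)) →
        BinE ty A τ W m (e.subst γ₁) (e.subst γ₂)) ∧
    -- noninterference for CG
    (∀ (ℓi ℓ ℓ' : L) (τ : CTy L B) (e : CExp K 1) (v₁ v₂ : CExp K 0),
      ¬ ℓi ≤ ℓ →
      CTyped ty (scons (.labeled ℓi τ) Fin.elim0) e (.comp ℓ' ℓ (CTy.bool L B)) →
      CVal v₁ → CVal v₂ →
      CTyped ty Fin.elim0 v₁ (.labeled ℓi τ) → CTyped ty Fin.elim0 v₂ (.labeled ℓi τ) →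
      ∀ (i₁ i₂ j₁ j₂ : ℕ) (c₁ c₂ r₁ r₂ : CExp K 0) (H₁ H₂ H₁' H₂' : CHeap K),
        CEval (e.inst v₁) i₁ c₁ → CForce H₁ c₁ j₁ H₁' r₁ →
        CEval (e.inst v₂) i₂ c₂ → CForce H₂ c₂ j₂ H₂' r₂ →
        r₁ = r₂) := by
  refine ⟨fun n Γ e τ h => ⟨⟨e.translate, h.translate, fun f hf => hf.eq_translate⟩,
      fun f hf => hf.typed⟩,
    fun n Γ e τ f h θ m β δs δt hδ => h.crossE hδ,
    fun e τ f h hτ i v he Ht => ?_,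
    fun e ℓ₁ ℓ₂ τ f h hτ i j c v Hs Hs' he hf Ht => ?_,
    fun A n Γ pc e τ h W m γ₁ γ₂ hγ => h.binE hγ,
    fun ℓi ℓ ℓ' τ e v₁ v₂ hℓ he hv₁ hv₂ ht₁ ht₂ i₁ i₂ j₁ j₂ c₁ c₂ r₁ r₂ H₁ H₂ H₁' H₂'
      he₁ hf₁ he₂ hf₂ => noninterference hℓ he hv₁ hv₂ ht₁ ht₂ he₁ hf₁ he₂ hf₂⟩
  · obtain ⟨i', w, hw, hvw⟩ := (h.crossE_closed (i + 1)).eval (by omega) he Ht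
    exact ⟨i', w, hw, .of_crossV hτ hvw⟩
  · obtain ⟨i', Ht', w, hw, _, _, -, -, -, hvw⟩ :=
      (h.crossE_closed (i + j + 1)).run (crossH_empty Hs Ht) (by omega) he hf
    exact ⟨i', Ht', w, hw, .of_crossV hτ hvw⟩
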